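/- Let $n\ge 1$ be an integer and let $\nu,\mu\in\mathbb{R}$ with $\mu>0$. On $\mathbb{C}^n=\mathbb{R}^{2n}$, with coordinates $z_j=x_j+iy_j$ and Lebesgue measure $dm$, consider the magnetic Laplacian $$\Delta_{\nu,\mu}=4\sum_{j=1}^n\frac{\partial^2}{\partial z_j\,\partial\bar z_j}+2i\nu\,(E+\overline{E}+n)+2\mu\,(E-\overline{E})-(\nu^2+\mu^2)|z|^2,$$ where $E=\sum_{j=1}^n z_j\frac{\partial}{\partial z_j}$ and $\overline{E}=\sum_{j=1}^n\bar z_j\frac{\partial}{\partial\bar z_j}$. For $\lambda\in\mathbb{C}$ let $$A^2_\lambda(\Delta_{\nu,\mu})=\{F\in L^2(\mathbb{C}^n,dm)\,:\,F\in C^\infty(\mathbb{C}^n),\ \Delta_{\nu,\mu}F=-2\mu(2\lambda+n)F\}$$ (classes in $L^2$ that have a smooth representative satisfying the equation), and let $H_{\nu,\mu}$ be the closure in $L^2(\mathbb{C}^n,dm)$ of $\Delta_{\nu,\mu}$ with domain $C_c^\infty(\mathbb{C}^n)$. Then: 1. For every $\lambda\in\mathbb{C}$, $A^2_\lambda(\Delta_{\nu,\mu})$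 is a closed subspace of $L^2(\mathbb{C}^n,dm)$, hence a Hilbert space, and it is nonzero if and only if $\lambda=l$ for some integer $l\ge 0$. 2. The spaces $A^2_l(\Delta_{\nu,\mu})$, $l=0,1,2,\dots$, are pairwise orthogonal, and $L^2(\mathbb{C}^n,dm)=\bigoplus_{l=0}^\infty A^2_l(\Delta_{\nu,\mu})$ as an orthogonal Hilbert direct sum. 3. Each $A^2_l(\Delta_{\nu,\mu})$, $l=0,1,2,\dots$, is infinite dimensional. 4. For every $\lambda\in\mathbb{C}$, $A^2_\lambda(\Delta_{\nu,\mu})$ is the eigenspace $\{F\in\operatorname{dom}H_{\nu,\mu}: H_{\nu,\mu}F=-2\mu(2\lambda+n)F\}$. The spectrum of $H_{\nu,\mu}$ and its set of eigenvalues are both equal to $\{-2\mu(2l+n): l=0,1,2,\dots\}$; in particular they do not depend on $\nu$, and the spectrum is a discrete subset of $\mathbb{C}$. -/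

import Mathlib

open MeasureTheory
open scoped ContDiff

noncomputable section

namespace MagneticLaplacian

/-- `ℂⁿ`. It carries the Lebesgue measure `volume` (the product of the measures `dx_j dy_j`) and the
structure of a finite dimensional real normed space. -/
abbrev Cn (n : ℕ) : Type := Fin n → ℂ

/-- The Hilbert space `L²(ℂⁿ, dm)`. -/
abbrev L2 (n : ℕ) : Type := Lp ℂ 2 (volume : Measure (Cn n))

/-- The partial derivative `∂f/∂x_j`, where `z_j = x_j + i y_j`. -/
def dx {n : ℕ} (j : Fin n) (f : Cn n → ℂ) (z : Cn n) : ℂ :=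
  fderiv ℝ f z (Pi.single j 1)

/-- The partial derivative `∂f/∂y_j`, where `z_j = x_j + i y_j`. -/
def dy {n : ℕ} (j : Fin n) (f : Cn n → ℂ) (z : Cn n) : ℂ :=
  fderiv ℝ f z (Pi.single j Complex.I)

/-- The Wirtinger derivative `∂f/∂z_j`. -/
def dz {n : ℕ} (j : Fin n) (f : Cn n → ℂ) (z : Cn n) : ℂ :=
  (1 / 2 : ℂ) * (dx j f z - Complex.I * dy j f z)

/-- The Wirtinger derivative `∂f/∂z̄_j`. -/
def dzbar {n : ℕ} (j : Fin n) (f : Cn n → ℂ) (z : Cn n) : ℂ :=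
  (1 / 2 : ℂ) * (dx j f z + Complex.I * dy j f z)

/-- The complex Euler operator `E = ∑ z_j ∂/∂z_j`. -/
def euler {n : ℕ} (f : Cn n → ℂ) (z : Cn n) : ℂ :=
  ∑ j, z j * dz j f z

/-- The conjugate Euler operator `Ē = ∑ z̄_j ∂/∂z̄_j`. -/
def eulerBar {n : ℕ} (f : Cn n → ℂ) (z : Cn n) : ℂ :=
  ∑ j, (starRingEnd ℂ) (z j) * dzbar j f z

/-- The magnetic Laplacian
`Δ_{ν,μ} = 4 ∑ ∂²/∂z_j∂z̄_j + 2iν (E + Ē + n) + 2μ (E - Ē) - (ν² + μ²)|z|²`. -/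
def magLaplacian {n : ℕ} (ν μ : ℝ) (f : Cn n → ℂ) (z : Cn n) : ℂ :=
  4 * ∑ j, dz j (dzbar j f) z
    + 2 * Complex.I * (ν : ℂ) * (euler f z + eulerBar f z + (n : ℂ) * f z)
    + 2 * (μ : ℂ) * (euler f z - eulerBar f z)
    - (((ν ^ 2 + μ ^ 2) * ∑ j, ‖z j‖ ^ 2 : ℝ) : ℂ) * f z

/-- The number `-2μ(2λ+n)`. -/
def eigval (n : ℕ) (μ : ℝ) (lam : ℂ) : ℂ := -2 * (μ : ℂ) * (2 * lam + (n : ℂ))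

/-! ### Linearity and smoothness -/

lemma contDiff_dx {n : ℕ} (j : Fin n) {f : Cn n → ℂ} (hf : ContDiff ℝ ∞ f) :
    ContDiff ℝ ∞ (dx j f) :=
  (hf.fderiv_right (m := ∞) (by simp)).clm_apply contDiff_const

lemma contDiff_dy {n : ℕ} (j : Fin n) {f : Cn n → ℂ} (hf : ContDiff ℝ ∞ f) :
    ContDiff ℝ ∞ (dy j f) :=
  (hf.fderiv_right (m := ∞) (by simp)).clm_apply contDiff_const

lemma contDiff_dz {n : ℕ} (j : Fin n) {f : Cn n → ℂ} (hf : ContDiff ℝ ∞ f) :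
    ContDiff ℝ ∞ (dz j f) :=
  contDiff_const.mul ((contDiff_dx j hf).sub (contDiff_const.mul (contDiff_dy j hf)))

lemma contDiff_dzbar {n : ℕ} (j : Fin n) {f : Cn n → ℂ} (hf : ContDiff ℝ ∞ f) :
    ContDiff ℝ ∞ (dzbar j f) :=
  contDiff_const.mul ((contDiff_dx j hf).add (contDiff_const.mul (contDiff_dy j hf)))

lemma contDiff_coord {n : ℕ} (j : Fin n) : ContDiff ℝ ∞ (fun z : Cn n => z j) :=
  (ContinuousLinearMap.proj (R := ℝ) (φ := fun _ : Fin n => ℂ) j).contDiff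

lemma contDiff_euler {n : ℕ} {f : Cn n → ℂ} (hf : ContDiff ℝ ∞ f) : ContDiff ℝ ∞ (euler f) :=
  ContDiff.sum fun j _ => (contDiff_coord j).mul (contDiff_dz j hf)

lemma contDiff_eulerBar {n : ℕ} {f : Cn n → ℂ} (hf : ContDiff ℝ ∞ f) :
    ContDiff ℝ ∞ (eulerBar f) :=
  ContDiff.sum fun j _ =>
    (Complex.conjCLE.contDiff.comp (contDiff_coord j)).mul (contDiff_dzbar j hf)

lemma contDiff_magLaplacian {n : ℕ} (ν μ : ℝ) {f : Cn n → ℂ} (hf : ContDiff ℝ ∞ f) :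
    ContDiff ℝ ∞ (magLaplacian ν μ f) := by
  have h1 : ContDiff ℝ ∞ (fun z : Cn n => (((ν ^ 2 + μ ^ 2) * ∑ j, ‖z j‖ ^ 2 : ℝ) : ℂ)) :=
    Complex.ofRealCLM.contDiff.comp
      (contDiff_const.mul (ContDiff.sum fun j _ => (contDiff_coord j).norm_sq ℝ))
  have h2 : ContDiff ℝ ∞ (fun z : Cn n => ∑ j, dz j (dzbar j f) z) :=
    ContDiff.sum fun j _ => contDiff_dz j (contDiff_dzbar j hf)
  exact (((contDiff_const.mul h2).add (contDiff_const.mul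
    (((contDiff_euler hf).add (contDiff_eulerBar hf)).add (contDiff_const.mul hf)))).add
    (contDiff_const.mul ((contDiff_euler hf).sub (contDiff_eulerBar hf)))).sub (h1.mul hf)

lemma differentiable_of_smooth {n : ℕ} {f : Cn n → ℂ} (hf : ContDiff ℝ ∞ f) :
    Differentiable ℝ f := hf.differentiable (by simp)

lemma dz_add {n : ℕ} (j : Fin n) {f g : Cn n → ℂ} (hf : ContDiff ℝ ∞ f) (hg : ContDiff ℝ ∞ g) :
    dz j (f + g) = dz j f + dz j g := by
  funext z
  simp only [dz, dx, dy, Pi.add_apply,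
    fderiv_add (differentiable_of_smooth hf z) (differentiable_of_smooth hg z),
    add_apply]
  ring

lemma dzbar_add {n : ℕ} (j : Fin n) {f g : Cn n → ℂ} (hf : ContDiff ℝ ∞ f)
    (hg : ContDiff ℝ ∞ g) : dzbar j (f + g) = dzbar j f + dzbar j g := by
  funext z
  simp only [dzbar, dx, dy, Pi.add_apply,
    fderiv_add (differentiable_of_smooth hf z) (differentiable_of_smooth hg z),
    add_apply]
  ring

lemma dz_smul {n : ℕ} (j : Fin n) (c : ℂ) {f : Cn n → ℂ} (hf : ContDiff ℝ ∞ f) :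
    dz j (c • f) = c • dz j f := by
  funext z
  simp only [dz, dx, dy, Pi.smul_apply, fderiv_const_smul (differentiable_of_smooth hf z) c,
    smul_apply, smul_eq_mul]
  ring

lemma dzbar_smul {n : ℕ} (j : Fin n) (c : ℂ) {f : Cn n → ℂ} (hf : ContDiff ℝ ∞ f) :
    dzbar j (c • f) = c • dzbar j f := by
  funext z
  simp only [dzbar, dx, dy, Pi.smul_apply, fderiv_const_smul (differentiable_of_smooth hf z) c,
    smul_apply, smul_eq_mul]
  ring

lemma magLaplacian_add {n : ℕ} (ν μ : ℝ) {f g : Cn n → ℂ} (hf : ContDiff ℝ ∞ f)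
    (hg : ContDiff ℝ ∞ g) :
    magLaplacian ν μ (f + g) = magLaplacian ν μ f + magLaplacian ν μ g := by
  funext z
  simp only [magLaplacian, euler, eulerBar, dzbar_add _ hf hg, dz_add _ hf hg,
    dz_add _ (contDiff_dzbar _ hf) (contDiff_dzbar _ hg), Pi.add_apply, mul_add,
    Finset.sum_add_distrib]
  ring

lemma magLaplacian_smul {n : ℕ} (ν μ : ℝ) (c : ℂ) {f : Cn n → ℂ} (hf : ContDiff ℝ ∞ f) :
    magLaplacian ν μ (c • f) = c • magLaplacian ν μ f := by
  funext z
  simp only [magLaplacian, euler, eulerBar, dzbar_smul _ c hf, dz_smul _ c hf,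
    dz_smul _ c (contDiff_dzbar _ hf), Pi.smul_apply, smul_eq_mul, mul_left_comm _ c,
    ← Finset.mul_sum]
  ring

/-! ### Eigenspaces -/

/-- The eigenspace `E_λ(Δ_{ν,μ})` of all smooth `f` with `Δ_{ν,μ} f = -2μ(2λ+n) f`. -/
def smoothEigenspace (n : ℕ) (ν μ : ℝ) (lam : ℂ) : Submodule ℂ (Cn n → ℂ) where
  carrier := {f | ContDiff ℝ ∞ f ∧ ∀ z, magLaplacian ν μ f z = eigval n μ lam * f z}
  zero_mem' := by
    refine ⟨contDiff_const, fun z => ?_⟩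
    have h := magLaplacian_smul (n := n) ν μ 0 (f := 0) contDiff_const
    rw [zero_smul, zero_smul] at h
    simp [h]
  add_mem' := by
    rintro f g ⟨hf, hf'⟩ ⟨hg, hg'⟩
    refine ⟨hf.add hg, fun z => ?_⟩
    rw [magLaplacian_add ν μ hf hg, Pi.add_apply, Pi.add_apply, hf' z, hg' z]
    ring
  smul_mem' := by
    rintro c f ⟨hf, hf'⟩
    refine ⟨hf.const_smul c, fun z => ?_⟩
    rw [magLaplacian_smul ν μ c hf, Pi.smul_apply, Pi.smul_apply, hf' z, smul_eq_mul, smul_eq_mul]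
    ring

/-- The `L²`-eigenspace `A²_λ(Δ_{ν,μ}) = L²(ℂⁿ, dm) ∩ E_λ(Δ_{ν,μ})`: the classes in `L²` that have
a representative in `E_λ(Δ_{ν,μ})`. -/
def L2Eigenspace (n : ℕ) (ν μ : ℝ) (lam : ℂ) : Submodule ℂ (L2 n) where
  carrier := {F | ∃ f ∈ smoothEigenspace n ν μ lam, F =ᵐ[volume] f}
  zero_mem' := ⟨0, Submodule.zero_mem _, Lp.coeFn_zero _ _ _⟩
  add_mem' := by
    rintro F G ⟨f, hf, hF⟩ ⟨g, hg, hG⟩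
    exact ⟨f + g, Submodule.add_mem _ hf hg, (Lp.coeFn_add F G).trans (hF.add hG)⟩
  smul_mem' := by
    rintro c F ⟨f, hf, hF⟩
    exact ⟨c • f, Submodule.smul_mem _ c hf, (Lp.coeFn_smul c F).trans (hF.const_smul c)⟩

/-! ### The operator in `L²` -/

/-- The space `C_c^∞(ℂⁿ)` of smooth compactly supported functions. -/
def testSpace (n : ℕ) : Submodule ℂ (Cn n → ℂ) where
  carrier := {f | ContDiff ℝ ∞ f ∧ HasCompactSupport f}
  zero_mem' := ⟨contDiff_const, HasCompactSupport.zero⟩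
  add_mem' := by
    rintro f g ⟨hf, hf'⟩ ⟨hg, hg'⟩
    exact ⟨hf.add hg, hf'.add hg'⟩
  smul_mem' := by
    rintro c f ⟨hf, hf'⟩
    exact ⟨hf.const_smul c, hf'.smul_left (f := fun _ => c)⟩

lemma magLaplacian_mem_testSpace {n : ℕ} (ν μ : ℝ) {f : Cn n → ℂ} (hf : f ∈ testSpace n) :
    magLaplacian ν μ f ∈ testSpace n := by
  obtain ⟨hs, hc⟩ := hf
  refine ⟨contDiff_magLaplacian ν μ hs, HasCompactSupport.of_support_subset_isCompact
    hc.isCompact fun z hz => ?_⟩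
  by_contra hz'
  apply hz
  have hev : f =ᶠ[nhds z] 0 := notMem_tsupport_iff_eventuallyEq.mp hz'
  have hd : ∀ᶠ w in nhds z, fderiv ℝ f w = 0 := by
    filter_upwards [hev.fderiv (𝕜 := ℝ)] with w hw
    rw [hw]; exact fderiv_const_apply (0 : ℂ)
  have hb : ∀ j, dzbar j f =ᶠ[nhds z] 0 := fun j => by
    filter_upwards [hd] with w hw
    simp [dzbar, dx, dy, hw]
  have hbd : ∀ j, fderiv ℝ (dzbar j f) z = 0 := fun j => by
    rw [(hb j).fderiv_eq]; exact fderiv_const_apply (0 : ℂ)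
  have h0 : f z = 0 := hev.eq_of_nhds
  have h1 : fderiv ℝ f z = 0 := hd.self_of_nhds
  have h2 : ∀ j, dz j (dzbar j f) z = 0 := fun j => by simp [dz, dx, dy, hbd j]
  have h3 : euler f z = 0 := by simp [euler, dz, dx, dy, h1]
  have h4 : eulerBar f z = 0 := by simp [eulerBar, dzbar, dx, dy, h1]
  simp [magLaplacian, h0, h2, h3, h4]

/-- `Δ_{ν,μ}` as a linear map on `C_c^∞(ℂⁿ)`. -/
def testLaplacian (n : ℕ) (ν μ : ℝ) : testSpace n →ₗ[ℂ] testSpace n where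
  toFun f := ⟨magLaplacian ν μ f, magLaplacian_mem_testSpace ν μ f.2⟩
  map_add' f g := Subtype.ext (magLaplacian_add ν μ f.2.1 g.2.1)
  map_smul' c f := Subtype.ext (magLaplacian_smul ν μ c f.2.1)

lemma memLp_testSpace {n : ℕ} (f : testSpace n) :
    MemLp (f : Cn n → ℂ) 2 (volume : Measure (Cn n)) :=
  f.2.1.continuous.memLp_of_hasCompactSupport f.2.2

/-- The inclusion `C_c^∞(ℂⁿ) → L²(ℂⁿ, dm)`. -/
def testToL2 (n : ℕ) : testSpace n →ₗ[ℂ] L2 n where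
  toFun f := (memLp_testSpace f).toLp f
  map_add' f g := MemLp.toLp_add (memLp_testSpace f) (memLp_testSpace g)
  map_smul' c f := MemLp.toLp_const_smul c (memLp_testSpace f)

lemma testToL2_injective (n : ℕ) : Function.Injective (testToL2 n) := by
  intro f g h
  have h' := (MemLp.toLp_eq_toLp_iff (memLp_testSpace f) (memLp_testSpace g)).mp h
  exact Subtype.ext
    ((Continuous.ae_eq_iff_eq volume f.2.1.continuous g.2.1.continuous).mp h')

/-- `Δ_{ν,μ}` as an unbounded operator in `L²(ℂⁿ, dm)` with domain `C_c^∞(ℂⁿ)`. -/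
def minimalOperator (n : ℕ) (ν μ : ℝ) : L2 n →ₗ.[ℂ] L2 n where
  domain := LinearMap.range (testToL2 n)
  toFun := (testToL2 n) ∘ₗ (testLaplacian n ν μ) ∘ₗ
    (LinearEquiv.ofInjective (testToL2 n) (testToL2_injective n)).symm.toLinearMap

/-- `Δ_{ν,μ}` as a closed unbounded operator in `L²(ℂⁿ, dm)`: the closure of its restriction
to `C_c^∞(ℂⁿ)`. -/
def magOperator (n : ℕ) (ν μ : ℝ) : L2 n →ₗ.[ℂ] L2 n := (minimalOperator n ν μ).closure

/-- The resolvent set of an unbounded operator `T`: all `c` such that `T - c` is a bijection from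
the domain of `T` onto the whole space, with a bounded inverse `R`. -/
def resolventSet {H : Type*} [NormedAddCommGroup H] [NormedSpace ℂ H] (T : H →ₗ.[ℂ] H) : Set ℂ :=
  {c | ∃ R : H →L[ℂ] H, (∀ x : T.domain, R (T x - c • (x : H)) = x) ∧
    ∀ y : H, ∃ x : T.domain, (x : H) = R y ∧ T x - c • (x : H) = y}

/-- The spectrum of an unbounded operator. -/
def unboundedSpectrum {H : Type*} [NormedAddCommGroup H] [NormedSpace ℂ H] (T : H →ₗ.[ℂ] H) :
    Set ℂ := (resolventSet T)ᶜ

/-- The eigenvalues of an unbounded operator. -/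
def eigenvalueSet {H : Type*} [NormedAddCommGroup H] [NormedSpace ℂ H] (T : H →ₗ.[ℂ] H) : Set ℂ :=
  {c | ∃ x : T.domain, (x : H) ≠ 0 ∧ T x = c • (x : H)}

end MagneticLaplacian

end

/-! Put `g = gauge ν μ = (μ + iν)/2`, so that `g + ḡ = μ`. With `A_j = ∂/∂z̄_j + g z_j` and its
formal adjoint `A_j^*`, the operator factors as `Δ = -4 ∑ A_j^* A_j - 2μn` (`magLaplacian_eq`). The
canonical relations `[A_j, A_k^*] = μ δ_jk` turn the problem into ladder algebra. A second family
`B_j`, `B_j^*` satisfies the same relations; `B_j` commutes with every `A_k^*`, and `B_j^*` with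
every `A_k` and `A_k^*`. The Gaussian `e^{-g|z|²}` is killed by all `A_j` and `B_j`. Applying `l`
operators `A_j^*` and any number of `B_j^*` to it gives eigenfunctions with `∑ A_j^* A_j = μl`, that
is, with eigenvalue `-2μ(2l+n)` (`numberOperator_landau`).

Completeness: `A_j + B_j^* = μ z_j` and `B_j + A_j^* = μ z̄_j`, so the levels together contain every
polynomial times the Gaussian (`mem_iSup_landau_of_isPolyGauss`). These are total in `L²`, because a
function orthogonal to all of them has, after multiplication by a Gaussian, a vanishing Fourier
transform (`eq_zero_of_forall_isPolyGauss`).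

Passage to the closed operator: cutoffs put the polynomial Gaussians in the domain of the closure
(`mem_closure_graph_of_isPolyGauss`), and integration by parts makes the closure symmetric. A
distributional eigenvector is therefore orthogonal to every level with a different eigenvalue. By
completeness it vanishes unless its eigenvalue is `-2μ(2l+n)`, and then it lies in the closure of
level `l`. So weak eigenspaces, eigenspaces of the closed operator and closed Landau levels
coincide.

Smoothness is obtained without elliptic regularity. An explicit Mehler integral operator acts on
level `l` as a nonzero scalar times a fixed Gaussian factor (`mehler_landau`). It sends `L²` to
smooth functions and turns `L²` convergence into pointwise convergence, so limits of elements of a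
level inherit a smooth representative (`exists_smooth_of_mem_closure_landauL2`).

The levels are infinite dimensional because `B_j`, `B_j^*` act on each of them with a nonzero scalar
commutator, which a trace forbids in nonzero finite dimension. The spectrum follows from the
orthogonal decomposition: away from the eigenvalues the resolvent is a bounded diagonal operator
(`mem_resolventSet_of_isHilbertSum`). -/

noncomputable section

namespace MagneticLaplacian

variable {n : ℕ}

/-! ### Calculus of the Wirtinger derivatives -/

lemma dz_mul_apply (j : Fin n) {f g : Cn n → ℂ} {z : Cn n} (hf : DifferentiableAt ℝ f z)
    (hg : DifferentiableAt ℝ g z) :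
    dz j (fun w => f w * g w) z = dz j f z * g z + f z * dz j g z := by
  simp only [dz, dx, dy, fderiv_fun_mul hf hg, add_apply, smul_apply, smul_eq_mul]
  ring

lemma dzbar_mul_apply (j : Fin n) {f g : Cn n → ℂ} {z : Cn n} (hf : DifferentiableAt ℝ f z)
    (hg : DifferentiableAt ℝ g z) :
    dzbar j (fun w => f w * g w) z = dzbar j f z * g z + f z * dzbar j g z := by
  simp only [dzbar, dx, dy, fderiv_fun_mul hf hg, add_apply, smul_apply, smul_eq_mul]
  ring

lemma dz_cexp_apply (j : Fin n) {f : Cn n → ℂ} {z : Cn n} (hf : DifferentiableAt ℝ f z) :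
    dz j (fun w => Complex.exp (f w)) z = Complex.exp (f z) * dz j f z := by
  simp only [dz, dx, dy, hf.hasFDerivAt.cexp.fderiv, smul_apply, smul_eq_mul]
  ring

lemma dzbar_cexp_apply (j : Fin n) {f : Cn n → ℂ} {z : Cn n} (hf : DifferentiableAt ℝ f z) :
    dzbar j (fun w => Complex.exp (f w)) z = Complex.exp (f z) * dzbar j f z := by
  simp only [dzbar, dx, dy, hf.hasFDerivAt.cexp.fderiv, smul_apply, smul_eq_mul]
  ring

lemma dz_conj_apply (j : Fin n) {f : Cn n → ℂ} {z : Cn n} (hf : DifferentiableAt ℝ f z) :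
    dz j (fun w => (starRingEnd ℂ) (f w)) z = (starRingEnd ℂ) (dzbar j f z) := by
  have h : fderiv ℝ (fun w => (starRingEnd ℂ) (f w)) z =
      (Complex.conjCLE : ℂ →L[ℝ] ℂ).comp (fderiv ℝ f z) :=
    ((Complex.conjCLE : ℂ →L[ℝ] ℂ).hasFDerivAt.comp z hf.hasFDerivAt).fderiv
  simp only [dz, dzbar, dx, dy, h]
  simp [Complex.conj_ofNat]
  ring

lemma dzbar_conj_apply (j : Fin n) {f : Cn n → ℂ} {z : Cn n} (hf : DifferentiableAt ℝ f z) :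
    dzbar j (fun w => (starRingEnd ℂ) (f w)) z = (starRingEnd ℂ) (dz j f z) := by
  have h : fderiv ℝ (fun w => (starRingEnd ℂ) (f w)) z =
      (Complex.conjCLE : ℂ →L[ℝ] ℂ).comp (fderiv ℝ f z) :=
    ((Complex.conjCLE : ℂ →L[ℝ] ℂ).hasFDerivAt.comp z hf.hasFDerivAt).fderiv
  simp only [dz, dzbar, dx, dy, h]
  simp [Complex.conj_ofNat]

lemma dz_coord (j k : Fin n) (z : Cn n) : dz j (fun w : Cn n => w k) z = if j = k then 1 else 0 := by
  have h : fderiv ℝ (fun w : Cn n => w k) z =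
    ContinuousLinearMap.proj (R := ℝ) (φ := fun _ : Fin n => ℂ) k :=
    (ContinuousLinearMap.proj (R := ℝ) (φ := fun _ : Fin n => ℂ) k).fderiv
  by_cases hjk : j = k
  · subst hjk
    simp [dz, dx, dy, h]
    norm_num
  · simp [dz, dx, dy, h, hjk, Ne.symm hjk]

lemma dzbar_coord (j k : Fin n) (z : Cn n) : dzbar j (fun w : Cn n => w k) z = 0 := by
  have h : fderiv ℝ (fun w : Cn n => w k) z =
    ContinuousLinearMap.proj (R := ℝ) (φ := fun _ : Fin n => ℂ) k :=
    (ContinuousLinearMap.proj (R := ℝ) (φ := fun _ : Fin n => ℂ) k).fderiv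
  by_cases hjk : j = k
  · subst hjk
    simp [dzbar, dx, dy, h]
  · simp [dzbar, dx, dy, h, Ne.symm hjk]

lemma contDiff_conj_coord (j : Fin n) : ContDiff ℝ ∞ (fun z : Cn n => (starRingEnd ℂ) (z j)) :=
  Complex.conjCLE.contDiff.comp (contDiff_coord j)

lemma differentiableAt_coord (j : Fin n) (z : Cn n) :
    DifferentiableAt ℝ (fun w : Cn n => w j) z := differentiable_of_smooth (contDiff_coord j) z

lemma differentiableAt_conj_coord (j : Fin n) (z : Cn n) :
    DifferentiableAt ℝ (fun w : Cn n => (starRingEnd ℂ) (w j)) z :=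
  differentiable_of_smooth (contDiff_conj_coord j) z

lemma dz_conj_coord (j k : Fin n) (z : Cn n) :
    dz j (fun w : Cn n => (starRingEnd ℂ) (w k)) z = 0 := by
  rw [dz_conj_apply j (differentiableAt_coord k z), dzbar_coord, map_zero]

lemma dzbar_conj_coord (j k : Fin n) (z : Cn n) :
    dzbar j (fun w : Cn n => (starRingEnd ℂ) (w k)) z = if j = k then 1 else 0 := by
  rw [dzbar_conj_apply j (differentiableAt_coord k z), dz_coord]
  split_ifs <;> simp

lemma dz_const_mul_apply (j : Fin n) (c : ℂ) {f : Cn n → ℂ} {z : Cn n}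
    (hf : DifferentiableAt ℝ f z) : dz j (fun w => c * f w) z = c * dz j f z := by
  simp only [dz, dx, dy, fderiv_const_mul hf, smul_apply, smul_eq_mul]
  ring

lemma dzbar_const_mul_apply (j : Fin n) (c : ℂ) {f : Cn n → ℂ} {z : Cn n}
    (hf : DifferentiableAt ℝ f z) : dzbar j (fun w => c * f w) z = c * dzbar j f z := by
  simp only [dzbar, dx, dy, fderiv_const_mul hf, smul_apply, smul_eq_mul]
  ring

lemma dz_sum_apply (j : Fin n) {ι : Type*} (s : Finset ι) {f : ι → Cn n → ℂ} {z : Cn n}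
    (hf : ∀ i ∈ s, DifferentiableAt ℝ (f i) z) :
    dz j (fun w => ∑ i ∈ s, f i w) z = ∑ i ∈ s, dz j (f i) z := by
  simp only [dz, dx, dy, fderiv_fun_sum hf, sum_apply, ← Finset.mul_sum,
    Finset.sum_sub_distrib]

lemma dzbar_sum_apply (j : Fin n) {ι : Type*} (s : Finset ι) {f : ι → Cn n → ℂ} {z : Cn n}
    (hf : ∀ i ∈ s, DifferentiableAt ℝ (f i) z) :
    dzbar j (fun w => ∑ i ∈ s, f i w) z = ∑ i ∈ s, dzbar j (f i) z := by
  simp only [dzbar, dx, dy, fderiv_fun_sum hf, sum_apply, ← Finset.mul_sum,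
    Finset.sum_add_distrib]

/-- A function is determined up to a constant by its Wirtinger derivatives. -/
lemma eq_of_dz_dzbar_eq_zero {f : Cn n → ℂ} (hf : Differentiable ℝ f) (h : ∀ j z, dz j f z = 0)
    (h' : ∀ j z, dzbar j f z = 0) (z w : Cn n) : f z = f w := by
  refine is_const_of_fderiv_eq_zero (𝕜 := ℝ) hf (fun z => ?_) z w
  have key : ∀ j, fderiv ℝ f z (Pi.single j 1) = 0 ∧ fderiv ℝ f z (Pi.single j Complex.I) = 0 := by
    intro j
    have h1 := h j z
    have h2 := h' j z
    simp only [dz, dzbar, dx, dy] at h1 h2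
    constructor
    · linear_combination h1 + h2
    · linear_combination Complex.I * h1 - Complex.I * h2 +
        (fderiv ℝ f z (Pi.single j Complex.I)) * Complex.I_sq
  ext v
  have hv : v = ∑ j, ((v j).re • (Pi.single j 1 : Cn n) + (v j).im • (Pi.single j Complex.I : Cn n)) := by
    ext k
    simp only [Finset.sum_apply, Pi.add_apply, Pi.smul_apply, Pi.single_apply]
    simp [Finset.sum_add_distrib]
  rw [hv, map_sum]
  simp only [map_add, map_smul, (key _).1, (key _).2]
  simp

/-! ### Commutation of the Wirtinger derivatives -/

lemma fderiv_symm {f : Cn n → ℂ} (hf : ContDiff ℝ ∞ f) (u v z : Cn n) :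
    fderiv ℝ (fun w => fderiv ℝ f w u) z v = fderiv ℝ (fun w => fderiv ℝ f w v) z u := by
  have hd : Differentiable ℝ (fderiv ℝ f) :=
    (hf.fderiv_right (m := ∞) (by simp)).differentiable (by simp)
  have h1 : ∀ u : Cn n, fderiv ℝ (fun w => fderiv ℝ f w u) z =
      (fderiv ℝ (fderiv ℝ f) z).flip u := fun u => by
    ext v
    rw [fderiv_clm_apply (hd z) (differentiableAt_const u)]
    simp
  have hs : IsSymmSndFDerivAt ℝ f z :=
    hf.contDiffAt.isSymmSndFDerivAt (by
      rw [minSmoothness_of_isRCLikeNormedField]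
      exact WithTop.coe_le_coe.2 (le_top : (2 : ℕ∞) ≤ ⊤))
  rw [h1, h1]
  exact hs v u

lemma dx_comm_aux (u v : Cn n) (a b : ℂ) {f : Cn n → ℂ} (hf : ContDiff ℝ ∞ f) (z w : Cn n) :
    fderiv ℝ (fun w => a * (fderiv ℝ f w u + b * fderiv ℝ f w v)) z w =
      a * (fderiv ℝ (fun x => fderiv ℝ f x w) z u + b * fderiv ℝ (fun x => fderiv ℝ f x w) z v) := by
  have hd : ∀ u, DifferentiableAt ℝ (fun w => fderiv ℝ f w u) z := fun u =>
    (((hf.fderiv_right (m := ∞) (by simp)).clm_apply contDiff_const).differentiable (by simp)) z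
  rw [fderiv_const_mul ((hd u).fun_add ((hd v).const_mul b)), fderiv_fun_add (hd u)
    ((hd v).const_mul b), fderiv_const_mul (hd v)]
  simp only [smul_apply, add_apply, smul_eq_mul, fderiv_symm hf u w, fderiv_symm hf v w]

lemma dz_eq (j : Fin n) (f : Cn n → ℂ) : dz j f = fun w => (1 / 2 : ℂ) *
    (fderiv ℝ f w (Pi.single j 1) + (-Complex.I) * fderiv ℝ f w (Pi.single j Complex.I)) := by
  funext w; simp only [dz, dx, dy]; ring

lemma dzbar_eq (j : Fin n) (f : Cn n → ℂ) : dzbar j f = fun w => (1 / 2 : ℂ) *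
    (fderiv ℝ f w (Pi.single j 1) + Complex.I * fderiv ℝ f w (Pi.single j Complex.I)) := rfl

/-- Both Wirtinger derivatives have the form `a (∂_u + b ∂_v)`, so this single identity yields all
three commutation lemmas below. -/
lemma wirtinger_comm_aux (a b c d : ℂ) (u v u' v' : Cn n) {f : Cn n → ℂ} (hf : ContDiff ℝ ∞ f)
    (z : Cn n) :
    a * (fderiv ℝ (fun w => c * (fderiv ℝ f w u' + d * fderiv ℝ f w v')) z u +
      b * fderiv ℝ (fun w => c * (fderiv ℝ f w u' + d * fderiv ℝ f w v')) z v) =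
    c * (fderiv ℝ (fun w => a * (fderiv ℝ f w u + b * fderiv ℝ f w v)) z u' +
      d * fderiv ℝ (fun w => a * (fderiv ℝ f w u + b * fderiv ℝ f w v)) z v') := by
  simp only [dx_comm_aux _ _ _ _ hf, fderiv_symm hf u u', fderiv_symm hf u v',
    fderiv_symm hf v u', fderiv_symm hf v v']
  ring

lemma dz_dz_comm (j k : Fin n) {f : Cn n → ℂ} (hf : ContDiff ℝ ∞ f) :
    dz j (dz k f) = dz k (dz j f) := by
  simp only [dz_eq]
  funext z
  exact wirtinger_comm_aux _ _ _ _ _ _ _ _ hf z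

lemma dz_dzbar_comm (j k : Fin n) {f : Cn n → ℂ} (hf : ContDiff ℝ ∞ f) :
    dz j (dzbar k f) = dzbar k (dz j f) := by
  simp only [dz_eq, dzbar_eq]
  funext z
  exact wirtinger_comm_aux _ _ _ _ _ _ _ _ hf z

lemma dzbar_dzbar_comm (j k : Fin n) {f : Cn n → ℂ} (hf : ContDiff ℝ ∞ f) :
    dzbar j (dzbar k f) = dzbar k (dzbar j f) := by
  simp only [dzbar_eq]
  funext z
  exact wirtinger_comm_aux _ _ _ _ _ _ _ _ hf z

/-! ### Ladder operators on smooth functions -/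

/-- The space of smooth functions on `ℂⁿ`. -/
def smoothSpace (n : ℕ) : Submodule ℂ (Cn n → ℂ) where
  carrier := {f | ContDiff ℝ ∞ f}
  zero_mem' := show ContDiff ℝ ∞ (fun _ : Cn n => (0 : ℂ)) from contDiff_const
  add_mem' {f g} hf hg := show ContDiff ℝ ∞ (f + g) from
    ContDiff.add (f := f) (g := g) hf hg
  smul_mem' c f hf := show ContDiff ℝ ∞ (c • f) from ContDiff.const_smul (f := f) c hf

/-- `∂/∂z_j` on smooth functions. -/
def opDz (j : Fin n) : Module.End ℂ (smoothSpace n) where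
  toFun f := ⟨dz j f, contDiff_dz j f.2⟩
  map_add' f g := Subtype.ext (dz_add j f.2 g.2)
  map_smul' c f := Subtype.ext (dz_smul j c f.2)

/-- `∂/∂z̄_j` on smooth functions. -/
def opDzbar (j : Fin n) : Module.End ℂ (smoothSpace n) where
  toFun f := ⟨dzbar j f, contDiff_dzbar j f.2⟩
  map_add' f g := Subtype.ext (dzbar_add j f.2 g.2)
  map_smul' c f := Subtype.ext (dzbar_smul j c f.2)

/-- Multiplication by a smooth function. -/
def opMul (p : smoothSpace n) : Module.End ℂ (smoothSpace n) where
  toFun f := ⟨fun z => p.1 z * f.1 z, show ContDiff ℝ ∞ (fun z => p.1 z * f.1 z) from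
    ContDiff.mul (f := p.1) (g := f.1) p.2 f.2⟩
  map_add' _ _ := Subtype.ext (funext fun _ => mul_add _ _ _)
  map_smul' _ _ := Subtype.ext (funext fun _ => mul_left_comm _ _ _)

/-- Multiplication by `z_j` on smooth functions. -/
def opZ (j : Fin n) : Module.End ℂ (smoothSpace n) := opMul ⟨fun z => z j, contDiff_coord j⟩

/-- Multiplication by `z̄_j` on smooth functions. -/
def opZbar (j : Fin n) : Module.End ℂ (smoothSpace n) :=
  opMul ⟨fun z => (starRingEnd ℂ) (z j), contDiff_conj_coord j⟩

@[simp] lemma opDz_apply (j : Fin n) (f : smoothSpace n) (z : Cn n) :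
    (opDz j f).1 z = dz j f.1 z := rfl

@[simp] lemma opDzbar_apply (j : Fin n) (f : smoothSpace n) (z : Cn n) :
    (opDzbar j f).1 z = dzbar j f.1 z := rfl

@[simp] lemma opZ_apply (j : Fin n) (f : smoothSpace n) (z : Cn n) :
    (opZ j f).1 z = z j * f.1 z := rfl

@[simp] lemma opZbar_apply (j : Fin n) (f : smoothSpace n) (z : Cn n) :
    (opZbar j f).1 z = (starRingEnd ℂ) (z j) * f.1 z := rfl

lemma differentiableAt_of_mem_smoothSpace (f : smoothSpace n) (z : Cn n) :
    DifferentiableAt ℝ f.1 z := differentiable_of_smooth f.2 z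

/-! ### Commutation relations of derivatives and coordinate multiplications -/

lemma opDz_opZ (j k : Fin n) (f : smoothSpace n) :
    opDz j (opZ k f) = opZ k (opDz j f) + (if j = k then (1 : ℂ) else 0) • f := by
  refine Subtype.ext (funext fun z => ?_)
  change dz j (fun w => w k * f.1 w) z = z k * dz j f.1 z + (if j = k then (1 : ℂ) else 0) * f.1 z
  rw [dz_mul_apply j (differentiableAt_coord k z) (differentiableAt_of_mem_smoothSpace f z), dz_coord]
  ring

lemma opDz_opZbar (j k : Fin n) (f : smoothSpace n) :
    opDz j (opZbar k f) = opZbar k (opDz j f) := by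
  refine Subtype.ext (funext fun z => ?_)
  change dz j (fun w => (starRingEnd ℂ) (w k) * f.1 w) z = (starRingEnd ℂ) (z k) * dz j f.1 z
  rw [dz_mul_apply j (differentiableAt_conj_coord k z) (differentiableAt_of_mem_smoothSpace f z), dz_conj_coord]
  ring

lemma opDzbar_opZ (j k : Fin n) (f : smoothSpace n) :
    opDzbar j (opZ k f) = opZ k (opDzbar j f) := by
  refine Subtype.ext (funext fun z => ?_)
  change dzbar j (fun w => w k * f.1 w) z = z k * dzbar j f.1 z
  rw [dzbar_mul_apply j (differentiableAt_coord k z) (differentiableAt_of_mem_smoothSpace f z), dzbar_coord]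
  ring

lemma opDzbar_opZbar (j k : Fin n) (f : smoothSpace n) :
    opDzbar j (opZbar k f) = opZbar k (opDzbar j f) + (if j = k then (1 : ℂ) else 0) • f := by
  refine Subtype.ext (funext fun z => ?_)
  change dzbar j (fun w => (starRingEnd ℂ) (w k) * f.1 w) z =
    (starRingEnd ℂ) (z k) * dzbar j f.1 z + (if j = k then (1 : ℂ) else 0) * f.1 z
  rw [dzbar_mul_apply j (differentiableAt_conj_coord k z) (differentiableAt_of_mem_smoothSpace f z), dzbar_conj_coord]
  ring

lemma opDz_opDz (j k : Fin n) (f : smoothSpace n) : opDz j (opDz k f) = opDz k (opDz j f) :=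
  Subtype.ext (dz_dz_comm j k f.2)

lemma opDzbar_opDz (j k : Fin n) (f : smoothSpace n) :
    opDzbar j (opDz k f) = opDz k (opDzbar j f) :=
  Subtype.ext (dz_dzbar_comm k j f.2).symm

lemma opDzbar_opDzbar (j k : Fin n) (f : smoothSpace n) :
    opDzbar j (opDzbar k f) = opDzbar k (opDzbar j f) :=
  Subtype.ext (dzbar_dzbar_comm j k f.2)

lemma opZ_opZ (j k : Fin n) (f : smoothSpace n) : opZ j (opZ k f) = opZ k (opZ j f) :=
  Subtype.ext (funext fun _ => mul_left_comm _ _ _)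

lemma opZ_opZbar (j k : Fin n) (f : smoothSpace n) : opZ j (opZbar k f) = opZbar k (opZ j f) :=
  Subtype.ext (funext fun _ => mul_left_comm _ _ _)

lemma opZbar_opZbar (j k : Fin n) (f : smoothSpace n) :
    opZbar j (opZbar k f) = opZbar k (opZbar j f) :=
  Subtype.ext (funext fun _ => mul_left_comm _ _ _)

/-- The annihilation operator `A_j = ∂/∂z̄_j + g z_j`. -/
def annihA (g : ℂ) (j : Fin n) : Module.End ℂ (smoothSpace n) := opDzbar j + g • opZ j

/-- The creation operator `A_j^* = -∂/∂z_j + ḡ z̄_j`. -/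
def creatA (g : ℂ) (j : Fin n) : Module.End ℂ (smoothSpace n) :=
  -opDz j + (starRingEnd ℂ) g • opZbar j

/-- The annihilation operator `B_j = ∂/∂z_j + g z̄_j`. -/
def annihB (g : ℂ) (j : Fin n) : Module.End ℂ (smoothSpace n) := opDz j + g • opZbar j

/-- The creation operator `B_j^* = -∂/∂z̄_j + ḡ z_j`. -/
def creatB (g : ℂ) (j : Fin n) : Module.End ℂ (smoothSpace n) :=
  -opDzbar j + (starRingEnd ℂ) g • opZ j

/-! ### Commutation relations of the ladder operators -/

lemma annihA_apply (g : ℂ) (j : Fin n) (f : smoothSpace n) :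
    annihA g j f = opDzbar j f + g • opZ j f := rfl

lemma creatA_apply (g : ℂ) (j : Fin n) (f : smoothSpace n) :
    creatA g j f = -opDz j f + (starRingEnd ℂ) g • opZbar j f := rfl

lemma annihB_apply (g : ℂ) (j : Fin n) (f : smoothSpace n) :
    annihB g j f = opDz j f + g • opZbar j f := rfl

lemma creatB_apply (g : ℂ) (j : Fin n) (f : smoothSpace n) :
    creatB g j f = -opDzbar j f + (starRingEnd ℂ) g • opZ j f := rfl

/-- The commutator collects `ḡ` from `[∂/∂z̄_j, ḡ z̄_k]` and `g` from `[g z_j, -∂/∂z_k]`; all other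
pairs commute. -/
lemma annihA_creatA (g : ℂ) (j k : Fin n) (f : smoothSpace n) :
    annihA g j (creatA g k f) = creatA g k (annihA g j f) +
      ((g + (starRingEnd ℂ) g) * if j = k then 1 else 0) • f := by
  simp only [annihA_apply, creatA_apply, map_add, map_neg, map_smul, opDzbar_opDz, opDzbar_opZbar,
    opDz_opZ, opZ_opZbar, @eq_comm _ k j]
  module

/-- Only `∂/∂z̄` and `z` occur in these two operators, and they commute. -/
lemma annihA_creatB (g : ℂ) (j k : Fin n) (f : smoothSpace n) :
    annihA g j (creatB g k f) = creatB g k (annihA g j f) := by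
  simp only [annihA_apply, creatB_apply, map_add, map_neg, map_smul, opDzbar_opDzbar j k,
    opDzbar_opZ, opZ_opZ j k]
  module

lemma annihB_creatA (g : ℂ) (j k : Fin n) (f : smoothSpace n) :
    annihB g j (creatA g k f) = creatA g k (annihB g j f) := by
  simp only [annihB_apply, creatA_apply, map_add, map_neg, map_smul, opDz_opDz j k,
    opDz_opZbar, opZbar_opZbar j k]
  module

lemma annihB_creatB (g : ℂ) (j k : Fin n) (f : smoothSpace n) :
    annihB g j (creatB g k f) = creatB g k (annihB g j f) +
      ((g + (starRingEnd ℂ) g) * if j = k then 1 else 0) • f := by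
  simp only [annihB_apply, creatB_apply, map_add, map_neg, map_smul, opDzbar_opDz, opDzbar_opZbar,
    opDz_opZ, opZ_opZbar, @eq_comm _ k j]
  module

lemma creatA_creatA (g : ℂ) (j k : Fin n) (f : smoothSpace n) :
    creatA g j (creatA g k f) = creatA g k (creatA g j f) := by
  simp only [creatA_apply, map_add, map_neg, map_smul, opDz_opDz j k,
    opDz_opZbar, opZbar_opZbar j k]
  module

/-- The two nonzero commutators, `[-∂/∂z̄_j, ḡ z̄_k]` and `[ḡ z_j, -∂/∂z_k]`, cancel. -/
lemma creatB_creatA (g : ℂ) (j k : Fin n) (f : smoothSpace n) :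
    creatB g j (creatA g k f) = creatA g k (creatB g j f) := by
  simp only [creatA_apply, creatB_apply, map_add, map_neg, map_smul, opDzbar_opDz, opDzbar_opZbar,
    opDz_opZ, opZ_opZbar, @eq_comm _ k j]
  module

/-- This identity and the next recover the coordinate multiplications from ladder operators;
completeness of the Landau levels rests on them. -/
lemma creatB_add_annihA (g : ℂ) (j : Fin n) (f : smoothSpace n) :
    creatB g j f + annihA g j f = (g + (starRingEnd ℂ) g) • opZ j f := by
  simp only [annihA_apply, creatB_apply]
  module

lemma creatA_add_annihB (g : ℂ) (j : Fin n) (f : smoothSpace n) :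
    creatA g j f + annihB g j f = (g + (starRingEnd ℂ) g) • opZbar j f := by
  simp only [annihB_apply, creatA_apply]
  module

/-! ### The quadratic form and the ground state -/

/-- The function `|z|²`, with complex values. -/
def quad (z : Cn n) : ℂ := ∑ j, z j * (starRingEnd ℂ) (z j)

lemma quad_eq (z : Cn n) : quad z = ((∑ j, ‖z j‖ ^ 2 : ℝ) : ℂ) := by
  simp [quad, Complex.mul_conj, Complex.normSq_eq_norm_sq]

lemma contDiff_quad : ContDiff ℝ ∞ (quad : Cn n → ℂ) :=
  ContDiff.sum fun j _ => (contDiff_coord j).mul (contDiff_conj_coord j)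

lemma dz_quad (j : Fin n) (z : Cn n) : dz j quad z = (starRingEnd ℂ) (z j) := by
  have h : ∀ k ∈ Finset.univ, DifferentiableAt ℝ (fun w : Cn n => w k * (starRingEnd ℂ) (w k)) z :=
    fun k _ => (differentiableAt_coord k z).mul (differentiableAt_conj_coord k z)
  have := dz_sum_apply j Finset.univ h
  simp only [dz_mul_apply j (differentiableAt_coord _ z) (differentiableAt_conj_coord _ z),
    dz_coord, dz_conj_coord] at this
  exact this.trans (by simp)

lemma dzbar_quad (j : Fin n) (z : Cn n) : dzbar j quad z = z j := by
  have h : ∀ k ∈ Finset.univ, DifferentiableAt ℝ (fun w : Cn n => w k * (starRingEnd ℂ) (w k)) z :=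
    fun k _ => (differentiableAt_coord k z).mul (differentiableAt_conj_coord k z)
  have := dzbar_sum_apply j Finset.univ h
  simp only [dzbar_mul_apply j (differentiableAt_coord _ z) (differentiableAt_conj_coord _ z),
    dzbar_coord, dzbar_conj_coord] at this
  exact this.trans (by simp)

lemma contDiff_gaussian (a : ℂ) : ContDiff ℝ ∞ (fun z : Cn n => Complex.exp (a * quad z)) :=
  (contDiff_const.mul contDiff_quad).cexp

lemma dz_gaussian (a : ℂ) (j : Fin n) (z : Cn n) :
    dz j (fun z : Cn n => Complex.exp (a * quad z)) z =
      Complex.exp (a * quad z) * (a * (starRingEnd ℂ) (z j)) := by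
  have hq := differentiable_of_smooth contDiff_quad z
  rw [dz_cexp_apply j (hq.const_mul a), dz_const_mul_apply j a hq, dz_quad]

lemma dzbar_gaussian (a : ℂ) (j : Fin n) (z : Cn n) :
    dzbar j (fun z : Cn n => Complex.exp (a * quad z)) z =
      Complex.exp (a * quad z) * (a * z j) := by
  have hq := differentiable_of_smooth contDiff_quad z
  rw [dzbar_cexp_apply j (hq.const_mul a), dzbar_const_mul_apply j a hq, dzbar_quad]

/-- The ground state `e^{-g|z|²}`. -/
def ground (n : ℕ) (g : ℂ) : smoothSpace n :=
  ⟨fun z => Complex.exp (-g * quad z), contDiff_gaussian (-g)⟩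

lemma ground_apply (g : ℂ) (z : Cn n) : (ground n g).1 z = Complex.exp (-g * quad z) := rfl

lemma annihA_ground (g : ℂ) (j : Fin n) : annihA g j (ground n g) = 0 := by
  refine Subtype.ext (funext fun z => ?_)
  change dzbar j (fun z : Cn n => Complex.exp (-g * quad z)) z +
    g * (z j * Complex.exp (-g * quad z)) = 0
  rw [dzbar_gaussian]
  ring

lemma annihB_ground (g : ℂ) (j : Fin n) : annihB g j (ground n g) = 0 := by
  refine Subtype.ext (funext fun z => ?_)
  change dz j (fun z : Cn n => Complex.exp (-g * quad z)) z +
    g * ((starRingEnd ℂ) (z j) * Complex.exp (-g * quad z)) = 0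
  rw [dz_gaussian]
  ring

/-! ### The Landau levels -/

/-- The functions obtained from the ground state by linear combinations, arbitrary applications of
the operators `B_j^*` and exactly `l` applications of the operators `A_j^*`. -/
inductive IsLandau (g : ℂ) : ℕ → smoothSpace n → Prop
  | ground : IsLandau g 0 (ground n g)
  | zero (l : ℕ) : IsLandau g l 0
  | add {l : ℕ} {f h : smoothSpace n} : IsLandau g l f → IsLandau g l h → IsLandau g l (f + h)
  | smul {l : ℕ} (a : ℂ) {f : smoothSpace n} : IsLandau g l f → IsLandau g l (a • f)
  | creatA {l : ℕ} (j : Fin n) {f : smoothSpace n} : IsLandau g l f →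
      IsLandau g (l + 1) (creatA g j f)
  | creatB {l : ℕ} (j : Fin n) {f : smoothSpace n} : IsLandau g l f →
      IsLandau g l (creatB g j f)

/-- The span of the eigenfunctions of level `l` obtained from the ground state. -/
def landau (n : ℕ) (g : ℂ) (l : ℕ) : Submodule ℂ (smoothSpace n) where
  carrier := {f | IsLandau g l f}
  zero_mem' := .zero l
  add_mem' := .add
  smul_mem' a _ hf := .smul a hf

/-- `A_j` lowers the level by one: it is moved through the creation operators until it meets the
ground state, and each `A_k^*` it passes leaves only a scalar term. Level `0` is treated apart
because nothing lies below it. -/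
lemma annihA_landau (g : ℂ) (j : Fin n) {l : ℕ} {f : smoothSpace n} (hf : IsLandau g l f) :
    (l = 0 → annihA g j f = 0) ∧ ∀ m, l = m + 1 → IsLandau g m (annihA g j f) := by
  induction hf with
  | ground => exact ⟨fun _ => annihA_ground g j, fun m h => by omega⟩
  | zero l => exact ⟨fun _ => map_zero _, fun m _ => by rw [map_zero]; exact .zero m⟩
  | add _ _ h1 h2 =>
    exact ⟨fun h => by rw [map_add, h1.1 h, h2.1 h, add_zero],
      fun m h => by rw [map_add]; exact (h1.2 m h).add (h2.2 m h)⟩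
  | smul a _ h1 =>
    exact ⟨fun h => by rw [map_smul, h1.1 h, smul_zero],
      fun m h => by rw [map_smul]; exact (h1.2 m h).smul a⟩
  | @creatA l k f hf h1 =>
    refine ⟨fun h => by omega, fun m h => ?_⟩
    obtain rfl : l = m := by omega
    rw [annihA_creatA]
    refine .add ?_ (hf.smul _)
    rcases l with _ | l
    · rw [h1.1 rfl, map_zero]; exact .zero _
    · exact (h1.2 l rfl).creatA k
  | creatB k _ h1 =>
    exact ⟨fun h => by rw [annihA_creatB, h1.1 h, map_zero],
      fun m h => by rw [annihA_creatB]; exact (h1.2 m h).creatB k⟩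

/-- `B_j` commutes with every `A_k^*` and has scalar commutators with the `B_k^*`, so the number of
factors `A_k^*` does not change. -/
lemma annihB_landau (g : ℂ) (j : Fin n) {l : ℕ} {f : smoothSpace n} (hf : IsLandau g l f) :
    IsLandau g l (annihB g j f) := by
  induction hf with
  | ground => rw [annihB_ground]; exact .zero _
  | zero l => rw [map_zero]; exact .zero l
  | add _ _ h1 h2 => rw [map_add]; exact h1.add h2
  | smul a _ h1 => rw [map_smul]; exact h1.smul a
  | creatA k _ h1 => rw [annihB_creatA]; exact h1.creatA k
  | creatB k hf h1 => rw [annihB_creatB]; exact (h1.creatB k).add (hf.smul _)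

/-- Each `A_k^*` raises the eigenvalue of the number operator by `g + ḡ`, the `B_k^*` commute with
it, and it kills the ground state. -/
lemma numberOperator_landau (g : ℂ) {l : ℕ} {f : smoothSpace n} (hf : IsLandau g l f) :
    ∑ j, creatA g j (annihA g j f) = ((g + (starRingEnd ℂ) g) * l) • f := by
  induction hf with
  | ground => simp [annihA_ground]
  | zero l => simp
  | add _ _ h1 h2 => simp only [map_add, Finset.sum_add_distrib, h1, h2, smul_add]
  | smul a _ h1 => simp only [map_smul, ← Finset.smul_sum, h1, smul_comm a]
  | @creatA l k f _ h1 =>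
    have h2 : ∑ j, ((g + (starRingEnd ℂ) g) * if j = k then 1 else 0) • creatA g j f =
        (g + (starRingEnd ℂ) g) • creatA g k f := by
      rw [Finset.sum_eq_single k (fun j _ hj => by simp [hj]) (by simp)]
      simp
    simp only [annihA_creatA, map_add, map_smul, Finset.sum_add_distrib, h2]
    have : ∀ j, creatA g j (creatA g k (annihA g j f)) = creatA g k (creatA g j (annihA g j f)) :=
      fun j => creatA_creatA g j k _
    simp only [this, ← map_sum, h1, map_smul]
    push_cast
    module
  | @creatB l k f _ h1 =>
    have : ∀ j, creatA g j (creatB g k (annihA g j f)) = creatB g k (creatA g j (annihA g j f)) :=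
      fun j => (creatB_creatA g k j _).symm
    simp only [annihA_creatB, this, ← map_sum, h1, map_smul]

/-- The gauge parameter `(μ + iν)/2`. -/
def gauge (ν μ : ℝ) : ℂ := ((μ : ℂ) + Complex.I * ν) / 2

lemma gauge_conj (ν μ : ℝ) : (starRingEnd ℂ) (gauge ν μ) = ((μ : ℂ) - Complex.I * ν) / 2 := by
  simp [gauge, Complex.conj_ofNat]; ring

lemma gauge_add_conj (ν μ : ℝ) : gauge ν μ + (starRingEnd ℂ) (gauge ν μ) = μ := by
  rw [gauge_conj, gauge]; ring

lemma gauge_re (ν μ : ℝ) : (gauge ν μ).re = μ / 2 := by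
  simp [gauge]

/-- The value of `g` is dictated by the coefficients: `4g = 2iν + 2μ` multiplies `E`, `-4ḡ = 2iν -
2μ` multiplies `Ē`, and `4|g|² = ν² + μ²` is the potential. Commuting `∂/∂z_j` past `z_j` gives the
constant `4gn = 2iνn + 2μn`, whose second term is subtracted again. -/
lemma magLaplacian_eq (ν μ : ℝ) (f : smoothSpace n) (z : Cn n) :
    magLaplacian ν μ f.1 z =
      -4 * (∑ j, creatA (gauge ν μ) j (annihA (gauge ν μ) j f)).1 z - 2 * μ * n * f.1 z := by
  have h : ∀ j, (creatA (gauge ν μ) j (annihA (gauge ν μ) j f)).1 z =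
      -dz j (dzbar j f.1) z - gauge ν μ * (z j * dz j f.1 z) - gauge ν μ * f.1 z
      + (starRingEnd ℂ) (gauge ν μ) * ((starRingEnd ℂ) (z j) * dzbar j f.1 z)
      + gauge ν μ * (starRingEnd ℂ) (gauge ν μ) * (‖z j‖ ^ 2 : ℝ) * f.1 z := by
    intro j
    have hz : ((‖z j‖ ^ 2 : ℝ) : ℂ) = (starRingEnd ℂ) (z j) * z j := by
      rw [mul_comm, Complex.mul_conj, Complex.normSq_eq_norm_sq]
    have e : creatA (gauge ν μ) j (annihA (gauge ν μ) j f) =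
        -opDz j (opDzbar j f) - gauge ν μ • opZ j (opDz j f) - gauge ν μ • f
        + (starRingEnd ℂ) (gauge ν μ) • opZbar j (opDzbar j f)
        + (gauge ν μ * (starRingEnd ℂ) (gauge ν μ)) • opZbar j (opZ j f) := by
      simp only [annihA_apply, creatA_apply, map_add, map_smul, opDz_opZ, if_true]
      module
    rw [e, hz]
    change -dz j (dzbar j f.1) z - gauge ν μ * (z j * dz j f.1 z) - gauge ν μ * f.1 z
      + (starRingEnd ℂ) (gauge ν μ) * ((starRingEnd ℂ) (z j) * dzbar j f.1 z)
      + gauge ν μ * (starRingEnd ℂ) (gauge ν μ) * ((starRingEnd ℂ) (z j) * (z j * f.1 z)) = _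
    ring
  have h2 : (∑ j, creatA (gauge ν μ) j (annihA (gauge ν μ) j f)).1 z =
      ∑ j, (creatA (gauge ν μ) j (annihA (gauge ν μ) j f)).1 z := by
    rw [AddSubmonoidClass.coe_finsetSum, Finset.sum_apply]
  rw [h2, Finset.sum_congr rfl fun j _ => h j]
  simp only [Finset.sum_add_distrib, Finset.sum_sub_distrib, Finset.sum_neg_distrib,
    ← Finset.mul_sum, ← Finset.sum_mul, magLaplacian, euler, eulerBar, Finset.sum_const,
    Finset.card_univ, Fintype.card_fin, nsmul_eq_mul]
  rw [gauge_conj, gauge]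
  push_cast
  linear_combination (-(ν : ℂ) ^ 2 * (∑ j, (‖z j‖ : ℂ) ^ 2) * f.1 z) * Complex.I_sq

lemma magLaplacian_landau (ν μ : ℝ) {l : ℕ} {f : smoothSpace n} (hf : IsLandau (gauge ν μ) l f)
    (z : Cn n) : magLaplacian ν μ f.1 z = eigval n μ l * f.1 z := by
  rw [magLaplacian_eq, numberOperator_landau _ hf, gauge_add_conj, eigval]
  change -4 * ((μ : ℂ) * l * f.1 z) - _ = _
  ring

/-! ### Gaussian bounds -/

/-- The function `|z|²`. -/
def nsq (z : Cn n) : ℝ := ∑ j, ‖z j‖ ^ 2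

lemma quad_eq_nsq (z : Cn n) : quad z = (nsq z : ℂ) := quad_eq z

lemma nsq_nonneg (z : Cn n) : 0 ≤ nsq z := Finset.sum_nonneg fun _ _ => sq_nonneg _

lemma sq_le_nsq (z : Cn n) (j : Fin n) : ‖z j‖ ^ 2 ≤ nsq z :=
  Finset.single_le_sum (f := fun j => ‖z j‖ ^ 2) (fun _ _ => sq_nonneg _) (Finset.mem_univ j)

lemma integrable_exp_neg_nsq {t : ℝ} (ht : 0 < t) :
    Integrable (fun z : Cn n => Real.exp (-t * nsq z)) := by
  have h1 : Integrable (fun w : ℂ => Real.exp (-t * ‖w‖ ^ 2)) := by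
    have h := (GaussianFourier.integrable_cexp_neg_mul_sq_norm_add (V := ℂ) (b := (t : ℂ))
      (by simpa using ht) 0 0).norm
    refine h.congr (Filter.Eventually.of_forall fun w => ?_)
    simp only [Complex.norm_exp]
    congr 1
    have : (-(t : ℂ) * (‖w‖ : ℂ) ^ 2 + 0 * ((inner ℝ (0 : ℂ) w : ℝ) : ℂ)) =
        ((-t * ‖w‖ ^ 2 : ℝ) : ℂ) := by
      push_cast; ring
    rw [this, Complex.ofReal_re]
  have h2 := Integrable.fintype_prod (ι := Fin n) (f := fun _ w => Real.exp (-t * ‖w‖ ^ 2))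
    (μ := fun _ => (volume : Measure ℂ)) (fun _ => h1)
  refine h2.congr (Filter.Eventually.of_forall fun z => ?_)
  simp only [nsq, Finset.mul_sum, Real.exp_sum]

/-- A continuous function that is bounded by a Gaussian function. -/
def GaussBdd (f : Cn n → ℂ) : Prop :=
  Continuous f ∧ ∃ t > 0, ∃ C, ∀ z, ‖f z‖ ≤ C * Real.exp (-t * nsq z)

lemma GaussBdd.memLp {f : Cn n → ℂ} (hf : GaussBdd f) : MemLp f 2 := by
  obtain ⟨hc, t, ht, C, h⟩ := hf
  rw [memLp_two_iff_integrable_sq_norm hc.aestronglyMeasurable]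
  refine ((integrable_exp_neg_nsq (t := 2 * t) (by positivity)).const_mul (C ^ 2)).mono'
    (hc.norm.pow 2).aestronglyMeasurable (Filter.Eventually.of_forall fun z => ?_)
  rw [Real.norm_of_nonneg (by positivity)]
  calc ‖f z‖ ^ 2 ≤ (C * Real.exp (-t * nsq z)) ^ 2 := by gcongr; exact h z
    _ = C ^ 2 * Real.exp (-(2 * t) * nsq z) := by
      rw [mul_pow, ← Real.exp_nat_mul]; congr 2; push_cast; ring

/-- A linear factor costs an arbitrarily small part of a Gaussian exponent. -/
lemma le_mul_exp_sq {ε : ℝ} (hε : 0 < ε) (x : ℝ) : x ≤ (1 + ε⁻¹) * Real.exp (ε * x ^ 2) := by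
  have h1 : ε * x ^ 2 + 1 ≤ Real.exp (ε * x ^ 2) := Real.add_one_le_exp _
  have h2 : x ^ 2 ≤ ε⁻¹ * Real.exp (ε * x ^ 2) := by
    rw [le_inv_mul_iff₀ hε]; linarith
  have h3 : 1 ≤ Real.exp (ε * x ^ 2) := by nlinarith [mul_nonneg hε.le (sq_nonneg x)]
  nlinarith [sq_nonneg (x - 1)]

/-- The products of `e^{-g|z|²}` with polynomials in the `z_j` and `z̄_j`. -/
inductive IsPolyGauss (g : ℂ) : smoothSpace n → Prop
  | ground : IsPolyGauss g (ground n g)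
  | add {f h : smoothSpace n} : IsPolyGauss g f → IsPolyGauss g h → IsPolyGauss g (f + h)
  | smul (a : ℂ) {f : smoothSpace n} : IsPolyGauss g f → IsPolyGauss g (a • f)
  | opZ (j : Fin n) {f : smoothSpace n} : IsPolyGauss g f → IsPolyGauss g (opZ j f)
  | opZbar (j : Fin n) {f : smoothSpace n} : IsPolyGauss g f → IsPolyGauss g (opZbar j f)

namespace IsPolyGauss

variable {g : ℂ} {f : smoothSpace n}

lemma zero : IsPolyGauss g (0 : smoothSpace n) := by
  simpa using (ground (n := n) (g := g)).smul 0

lemma neg (hf : IsPolyGauss g f) : IsPolyGauss g (-f) := by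
  have h : -f = (-1 : ℂ) • f := by module
  rw [h]
  exact hf.smul _

lemma opDz_ground (j : Fin n) : opDz j (MagneticLaplacian.ground n g) =
    (-g) • MagneticLaplacian.opZbar j (MagneticLaplacian.ground n g) := by
  have h := annihB_ground (n := n) g j
  rw [annihB_apply] at h
  rw [eq_neg_of_add_eq_zero_left h]
  module

lemma opDzbar_ground (j : Fin n) : opDzbar j (MagneticLaplacian.ground n g) =
    (-g) • MagneticLaplacian.opZ j (MagneticLaplacian.ground n g) := by
  have h := annihA_ground (n := n) g j
  rw [annihA_apply] at h
  rw [eq_neg_of_add_eq_zero_left h]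
  module

lemma opDz (hf : IsPolyGauss g f) (j : Fin n) : IsPolyGauss g (opDz j f) := by
  induction hf with
  | ground => rw [opDz_ground]; exact (ground.opZbar j).smul _
  | add _ _ h1 h2 => rw [map_add]; exact h1.add h2
  | smul a _ h1 => rw [map_smul]; exact h1.smul a
  | opZ k hf h1 => rw [opDz_opZ]; exact (h1.opZ k).add (hf.smul _)
  | opZbar k hf h1 => rw [opDz_opZbar]; exact h1.opZbar k

lemma opDzbar (hf : IsPolyGauss g f) (j : Fin n) : IsPolyGauss g (opDzbar j f) := by
  induction hf with
  | ground => rw [opDzbar_ground]; exact (ground.opZ j).smul _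
  | add _ _ h1 h2 => rw [map_add]; exact h1.add h2
  | smul a _ h1 => rw [map_smul]; exact h1.smul a
  | opZ k hf h1 => rw [opDzbar_opZ]; exact h1.opZ k
  | opZbar k hf h1 => rw [opDzbar_opZbar]; exact (h1.opZbar k).add (hf.smul _)

lemma creatA (hf : IsPolyGauss g f) (j : Fin n) : IsPolyGauss g (creatA g j f) := by
  rw [creatA_apply]; exact (hf.opDz j).neg.add ((hf.opZbar j).smul _)

lemma creatB (hf : IsPolyGauss g f) (j : Fin n) : IsPolyGauss g (creatB g j f) := by
  rw [creatB_apply]; exact (hf.opDzbar j).neg.add ((hf.opZ j).smul _)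

lemma annihA (hf : IsPolyGauss g f) (j : Fin n) : IsPolyGauss g (annihA g j f) := by
  rw [annihA_apply]; exact (hf.opDzbar j).add ((hf.opZ j).smul _)

/-- The bound is asserted for every exponent below `Re g`, since each coordinate factor consumes a
little of the exponent and the induction needs room for it. -/
lemma bound (hf : IsPolyGauss g f) : ∀ t < g.re, ∃ C, ∀ z, ‖f.1 z‖ ≤ C * Real.exp (-t * nsq z) := by
  have mul_bound : ∀ (f : smoothSpace n) (p : Cn n → ℂ) (j : Fin n), (∀ z, ‖p z‖ = ‖z j‖) →
      (∀ t < g.re, ∃ C, ∀ z, ‖f.1 z‖ ≤ C * Real.exp (-t * nsq z)) →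
      ∀ t < g.re, ∃ C, ∀ z, ‖p z * f.1 z‖ ≤ C * Real.exp (-t * nsq z) := by
    intro f p j hp hf t ht
    -- The hypothesis is used halfway between `t` and `Re g`; the remaining `(Re g - t)/2` absorbs
    -- `‖z j‖`.
    obtain ⟨C, hC⟩ := hf ((t + g.re) / 2) (by linarith)
    have hε : 0 < (g.re - t) / 2 := by linarith
    refine ⟨(1 + ((g.re - t) / 2)⁻¹) * C, fun z => ?_⟩
    have h1 : ‖z j‖ ≤ (1 + ((g.re - t) / 2)⁻¹) * Real.exp ((g.re - t) / 2 * nsq z) := by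
      refine (le_mul_exp_sq hε _).trans ?_
      gcongr
      exact sq_le_nsq z j
    rw [norm_mul, hp]
    calc ‖z j‖ * ‖f.1 z‖ ≤ ((1 + ((g.re - t) / 2)⁻¹) * Real.exp ((g.re - t) / 2 * nsq z)) *
          (C * Real.exp (-((t + g.re) / 2) * nsq z)) := by
          gcongr
          · exact hC z
      _ = (1 + ((g.re - t) / 2)⁻¹) * C * (Real.exp ((g.re - t) / 2 * nsq z) *
          Real.exp (-((t + g.re) / 2) * nsq z)) := by ring
      _ = _ := by rw [← Real.exp_add]; congr 2; ring
  induction hf with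
  | ground =>
    intro t ht
    refine ⟨1, fun z => ?_⟩
    rw [ground_apply, quad_eq_nsq, Complex.norm_exp, one_mul]
    have : (-g * (nsq z : ℂ)).re = -g.re * nsq z := by simp
    rw [this]
    gcongr
    exact nsq_nonneg z
  | @add f h _ _ h1 h2 =>
    intro t ht
    obtain ⟨C, hC⟩ := h1 t ht
    obtain ⟨D, hD⟩ := h2 t ht
    refine ⟨C + D, fun z => ?_⟩
    rw [add_mul]
    exact (norm_add_le (f.1 z) (h.1 z)).trans (add_le_add (hC z) (hD z))
  | @smul a f _ h1 =>
    intro t ht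
    obtain ⟨C, hC⟩ := h1 t ht
    refine ⟨‖a‖ * C, fun z => ?_⟩
    change ‖a * f.1 z‖ ≤ _
    rw [norm_mul, mul_assoc]
    gcongr
    exact hC z
  | @opZ j f _ h1 => exact mul_bound f _ j (fun _ => rfl) h1
  | @opZbar j f _ h1 => exact mul_bound f _ j (fun z => Complex.norm_conj (z j)) h1

lemma gaussBdd (hf : IsPolyGauss g f) (hg : 0 < g.re) : GaussBdd f.1 := by
  obtain ⟨C, hC⟩ := hf.bound (g.re / 2) (by linarith)
  have hc : ContDiff ℝ ∞ f.1 := f.2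
  exact ⟨hc.continuous, g.re / 2, by linarith, C, hC⟩

end IsPolyGauss

lemma IsLandau.isPolyGauss {g : ℂ} {l : ℕ} {f : smoothSpace n} (hf : IsLandau g l f) :
    IsPolyGauss g f := by
  induction hf with
  | ground => exact .ground
  | zero l => exact .zero
  | add _ _ h1 h2 => exact h1.add h2
  | smul a _ h1 => exact h1.smul a
  | creatA k _ h1 => exact h1.creatA k
  | creatB k _ h1 => exact h1.creatB k

/-- The sum of the levels is stable under all ladder operators, hence under `(g + ḡ) z_j = B_j^* +
A_j` and `(g + ḡ) z̄_j = A_j^* + B_j`, and `g + ḡ ≠ 0`. -/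
lemma mem_iSup_landau_of_isPolyGauss {g : ℂ} (hg : 0 < g.re) {f : smoothSpace n}
    (hf : IsPolyGauss g f) : f ∈ ⨆ l, landau n g l := by
  have hg' : g + (starRingEnd ℂ) g ≠ 0 := by
    rw [Complex.add_conj]
    exact_mod_cast (by positivity : (2 * g.re) ≠ 0)
  have hle : ∀ l, landau n g l ≤ ⨆ l, landau n g l := fun l => le_iSup (fun l => landau n g l) l
  induction hf with
  | ground => exact hle 0 IsLandau.ground
  | add _ _ h1 h2 => exact add_mem h1 h2
  | smul a _ h1 => exact Submodule.smul_mem _ a h1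
  | @opZ j f _ h1 =>
    have key : creatB g j f + annihA g j f ∈ ⨆ l, landau n g l := by
      refine Submodule.iSup_induction (fun l => landau n g l)
        (motive := fun f => creatB g j f + annihA g j f ∈ ⨆ l, landau n g l) h1 (fun l f hf => ?_)
        (by simp) (fun f h hf hh => ?_)
      · refine add_mem (hle l (IsLandau.creatB j hf)) ?_
        rcases l with _ | l
        · rw [(annihA_landau g j hf).1 rfl]; exact zero_mem _
        · exact hle l ((annihA_landau g j hf).2 l rfl)
      · simp only [map_add]
        have := add_mem hf hh
        rwa [add_add_add_comm] at this
    rw [creatB_add_annihA] at key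
    exact (Submodule.smul_mem_iff _ hg').1 key
  | @opZbar j f _ h1 =>
    have key : creatA g j f + annihB g j f ∈ ⨆ l, landau n g l := by
      refine Submodule.iSup_induction (fun l => landau n g l)
        (motive := fun f => creatA g j f + annihB g j f ∈ ⨆ l, landau n g l) h1 (fun l f hf => ?_)
        (by simp) (fun f h hf hh => ?_)
      · exact add_mem (hle (l + 1) (IsLandau.creatA j hf)) (hle l (annihB_landau g j hf))
      · simp only [map_add]
        have := add_mem hf hh
        rwa [add_add_add_comm] at this
    rw [creatA_add_annihB] at key
    exact (Submodule.smul_mem_iff _ hg').1 key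

/-! ### Integration by parts -/

lemma dx_eq_dz_add_dzbar (j : Fin n) (f : Cn n → ℂ) (z : Cn n) :
    fderiv ℝ f z (Pi.single j 1) = dz j f z + dzbar j f z := by
  simp only [dz, dzbar, dx, dy]; ring

lemma dy_eq_dz_sub_dzbar (j : Fin n) (f : Cn n → ℂ) (z : Cn n) :
    fderiv ℝ f z (Pi.single j Complex.I) = Complex.I * (dz j f z - dzbar j f z) := by
  simp only [dz, dzbar, dx, dy]
  linear_combination (fderiv ℝ f z (Pi.single j Complex.I)) * Complex.I_sq

/-- Integration by parts is available in the real directions `x_j` and `y_j`; the two resulting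
identities are the sum and the difference of the two claims, which is why these are proved together.
-/
lemma integral_wirtinger_mul {f g : Cn n → ℂ} (j : Fin n) (hf : Differentiable ℝ f)
    (hg : Differentiable ℝ g) (hfg : Integrable (fun z => f z * g z))
    (h1 : Integrable (fun z => dz j f z * g z)) (h2 : Integrable (fun z => dzbar j f z * g z))
    (h3 : Integrable (fun z => f z * dz j g z)) (h4 : Integrable (fun z => f z * dzbar j g z)) :
    ∫ z, dz j f z * g z = -∫ z, f z * dz j g z ∧
      ∫ z, dzbar j f z * g z = -∫ z, f z * dzbar j g z := by
  have ix : Integrable (fun z => fderiv ℝ f z (Pi.single j 1) * g z) := by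
    simpa only [dx_eq_dz_add_dzbar, add_mul] using! h1.add h2
  have iy : Integrable (fun z => fderiv ℝ f z (Pi.single j Complex.I) * g z) := by
    simpa only [dy_eq_dz_sub_dzbar, sub_mul, mul_assoc] using! (h1.sub h2).const_mul Complex.I
  have ix' : Integrable (fun z => f z * fderiv ℝ g z (Pi.single j 1)) := by
    simpa only [dx_eq_dz_add_dzbar, mul_add] using! h3.add h4
  have iy' : Integrable (fun z => f z * fderiv ℝ g z (Pi.single j Complex.I)) := by
    simpa only [dy_eq_dz_sub_dzbar, mul_left_comm _ Complex.I, mul_sub (f _)] using!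
      (h3.sub h4).const_mul Complex.I
  have ex := integral_mul_fderiv_eq_neg_fderiv_mul_of_integrable ix ix' hfg (fun x _ => hf x) (fun x _ => hg x)
  have ey := integral_mul_fderiv_eq_neg_fderiv_mul_of_integrable iy iy' hfg (fun x _ => hf x) (fun x _ => hg x)
  simp only [dx_eq_dz_add_dzbar, mul_add, add_mul] at ex
  rw [integral_add h3 h4, integral_add h1 h2] at ex
  simp only [dy_eq_dz_sub_dzbar, mul_sub, sub_mul, mul_left_comm _ Complex.I, mul_assoc] at ey
  rw [integral_sub (h3.const_mul _) (h4.const_mul _), integral_sub (h1.const_mul _)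
    (h2.const_mul _)] at ey
  simp only [integral_const_mul] at ey
  have ey' : (∫ z, f z * dz j g z) - ∫ z, f z * dzbar j g z =
      -((∫ z, dz j f z * g z) - ∫ z, dzbar j f z * g z) := by
    have := Complex.I_ne_zero
    apply mul_left_cancel₀ this
    linear_combination ey
  constructor
  · linear_combination (1 / 2 : ℂ) * ex + (1 / 2 : ℂ) * ey'
  · linear_combination (1 / 2 : ℂ) * ex - (1 / 2 : ℂ) * ey'

/-! ### Symmetry of the magnetic Laplacian on smooth functions -/

lemma contDiff_smoothSpace (f : smoothSpace n) : ContDiff ℝ ∞ f.1 := f.2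

lemma continuous_smoothSpace (f : smoothSpace n) : Continuous f.1 :=
  (contDiff_smoothSpace f).continuous

/-- The complex conjugate of a smooth function. -/
def opConj (f : smoothSpace n) : smoothSpace n :=
  ⟨fun z => (starRingEnd ℂ) (f.1 z),
    show ContDiff ℝ ∞ (fun z => (starRingEnd ℂ) (f.1 z)) from
      Complex.conjCLE.contDiff.comp (contDiff_smoothSpace f)⟩

lemma hasCompactSupport_dz {f : Cn n → ℂ} (hf : HasCompactSupport f) (j : Fin n) :
    HasCompactSupport (dz j f) := by
  rw [dz_eq]
  exact ((hf.fderiv_apply (𝕜 := ℝ) _).add ((hf.fderiv_apply (𝕜 := ℝ) _).mul_left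
    (f := fun _ => -Complex.I))).mul_left (f := fun _ => (1 / 2 : ℂ))

lemma hasCompactSupport_dzbar {f : Cn n → ℂ} (hf : HasCompactSupport f) (j : Fin n) :
    HasCompactSupport (dzbar j f) := by
  rw [dzbar_eq]
  exact ((hf.fderiv_apply (𝕜 := ℝ) _).add ((hf.fderiv_apply (𝕜 := ℝ) _).mul_left
    (f := fun _ => Complex.I))).mul_left (f := fun _ => (1 / 2 : ℂ))

lemma hasCompactSupport_annihA {f : smoothSpace n} (hf : HasCompactSupport f.1) (g : ℂ)
    (j : Fin n) : HasCompactSupport (annihA g j f).1 := by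
  have h : HasCompactSupport (dzbar j f.1 + (fun z => g * z j) * f.1) :=
    (hasCompactSupport_dzbar hf j).add hf.mul_left
  convert h using 1
  funext z
  change dzbar j f.1 z + g * (z j * f.1 z) = dzbar j f.1 z + g * z j * f.1 z
  ring

lemma hasCompactSupport_creatA {f : smoothSpace n} (hf : HasCompactSupport f.1) (g : ℂ)
    (j : Fin n) : HasCompactSupport (creatA g j f).1 := by
  have h : HasCompactSupport (-dz j f.1 + (fun z => (starRingEnd ℂ) g * (starRingEnd ℂ) (z j)) *
      f.1) := (hasCompactSupport_dz hf j).neg.add hf.mul_left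
  convert h using 1
  funext z
  change -dz j f.1 z + (starRingEnd ℂ) g * ((starRingEnd ℂ) (z j) * f.1 z) =
    -dz j f.1 z + (starRingEnd ℂ) g * (starRingEnd ℂ) (z j) * f.1 z
  ring

lemma integrable_mul_of_hasCompactSupport {f h : Cn n → ℂ} (hf : Continuous f) (hh : Continuous h)
    (hc : HasCompactSupport f ∨ HasCompactSupport h) : Integrable (fun z => f z * h z) :=
  (hf.mul hh).integrable_of_hasCompactSupport (hc.elim (fun h => h.mul_right) fun h => h.mul_left)

lemma integral_wirtinger_mul_of_hasCompactSupport (f h : smoothSpace n) (j : Fin n)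
    (hc : HasCompactSupport f.1 ∨ HasCompactSupport h.1) :
    ∫ z, dz j f.1 z * h.1 z = -∫ z, f.1 z * dz j h.1 z ∧
      ∫ z, dzbar j f.1 z * h.1 z = -∫ z, f.1 z * dzbar j h.1 z :=
  integral_wirtinger_mul j (differentiableAt_of_mem_smoothSpace f)
    (differentiableAt_of_mem_smoothSpace h)
    (integrable_mul_of_hasCompactSupport (continuous_smoothSpace f) (continuous_smoothSpace h) hc)
    (integrable_mul_of_hasCompactSupport (continuous_smoothSpace (opDz j f))
      (continuous_smoothSpace h) (hc.imp (fun h => hasCompactSupport_dz h j) id))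
    (integrable_mul_of_hasCompactSupport (continuous_smoothSpace (opDzbar j f))
      (continuous_smoothSpace h) (hc.imp (fun h => hasCompactSupport_dzbar h j) id))
    (integrable_mul_of_hasCompactSupport (continuous_smoothSpace f)
      (continuous_smoothSpace (opDz j h)) (hc.imp id fun h => hasCompactSupport_dz h j))
    (integrable_mul_of_hasCompactSupport (continuous_smoothSpace f)
      (continuous_smoothSpace (opDzbar j h)) (hc.imp id fun h => hasCompactSupport_dzbar h j))

/-- Conjugation turns `∂/∂z_j` into `∂/∂z̄_j`, and integration by parts supplies the sign. Compact
support of one factor is enough, so a test function can be paired with any smooth function. -/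
lemma integral_creatA_conj_mul (g : ℂ) (j : Fin n) (f h : smoothSpace n)
    (hc : HasCompactSupport f.1 ∨ HasCompactSupport h.1) :
    ∫ z, (starRingEnd ℂ) ((creatA g j f).1 z) * h.1 z =
      ∫ z, (starRingEnd ℂ) (f.1 z) * (annihA g j h).1 z := by
  have hc' : HasCompactSupport (opConj f).1 ∨ HasCompactSupport h.1 :=
    hc.imp (fun h => h.comp_left (map_zero (starRingEnd ℂ))) id
  have key := (integral_wirtinger_mul_of_hasCompactSupport (opConj f) h j hc').2
  have i1 : Integrable (fun z => dzbar j (opConj f).1 z * h.1 z) :=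
    integrable_mul_of_hasCompactSupport (continuous_smoothSpace (opDzbar j (opConj f)))
      (continuous_smoothSpace h) (hc'.imp (fun h => hasCompactSupport_dzbar h j) id)
  have i2 : Integrable (fun z => (opConj f).1 z * dzbar j h.1 z) :=
    integrable_mul_of_hasCompactSupport (continuous_smoothSpace (opConj f))
      (continuous_smoothSpace (opDzbar j h)) (hc'.imp id fun h => hasCompactSupport_dzbar h j)
  have i3 : Integrable (fun z => (opConj f).1 z * (opZ j h).1 z) :=
    integrable_mul_of_hasCompactSupport (continuous_smoothSpace (opConj f))
      (continuous_smoothSpace (opZ j h)) (hc'.imp id fun h => h.mul_left)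
  have e1 : ∀ z, (starRingEnd ℂ) ((creatA g j f).1 z) * h.1 z =
      -(dzbar j (opConj f).1 z * h.1 z) + g * ((opConj f).1 z * (opZ j h).1 z) := by
    intro z
    have : dzbar j (opConj f).1 z = (starRingEnd ℂ) (dz j f.1 z) :=
      dzbar_conj_apply j (differentiableAt_of_mem_smoothSpace f z)
    rw [this]
    change (starRingEnd ℂ) (-dz j f.1 z + (starRingEnd ℂ) g * ((starRingEnd ℂ) (z j) * f.1 z)) *
      h.1 z = -((starRingEnd ℂ) (dz j f.1 z) * h.1 z) +
      g * ((starRingEnd ℂ) (f.1 z) * (z j * h.1 z))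
    simp only [map_add, map_neg, map_mul, Complex.conj_conj]
    ring
  have e2 : ∀ z, (starRingEnd ℂ) (f.1 z) * (annihA g j h).1 z =
      (opConj f).1 z * dzbar j h.1 z + g * ((opConj f).1 z * (opZ j h).1 z) := by
    intro z
    change (starRingEnd ℂ) (f.1 z) * (dzbar j h.1 z + g * (z j * h.1 z)) =
      (starRingEnd ℂ) (f.1 z) * dzbar j h.1 z + g * ((starRingEnd ℂ) (f.1 z) * (z j * h.1 z))
    ring
  simp only [e1, e2]
  rw [integral_add i1.fun_neg (i3.const_mul g), integral_add i2 (i3.const_mul g), integral_neg,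
    key, neg_neg]

lemma integral_annihA_conj_mul (g : ℂ) (j : Fin n) (f h : smoothSpace n)
    (hc : HasCompactSupport f.1 ∨ HasCompactSupport h.1) :
    ∫ z, (starRingEnd ℂ) ((annihA g j f).1 z) * h.1 z =
      ∫ z, (starRingEnd ℂ) (f.1 z) * (creatA g j h).1 z := by
  have := congrArg (starRingEnd ℂ) (integral_creatA_conj_mul g j h f hc.symm)
  rw [← integral_conj, ← integral_conj] at this
  simp only [map_mul, Complex.conj_conj] at this
  simp only [mul_comm (h.1 _), mul_comm ((creatA g j h).1 _)] at this
  exact this.symm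

/-- The magnetic Laplacian is symmetric. -/
lemma integral_magLaplacian_conj_mul (ν μ : ℝ) (f h : smoothSpace n)
    (hf : HasCompactSupport f.1) :
    ∫ z, (starRingEnd ℂ) (magLaplacian ν μ f.1 z) * h.1 z =
      ∫ z, (starRingEnd ℂ) (f.1 z) * magLaplacian ν μ h.1 z := by
  set g := gauge ν μ with hg
  have hA : ∀ j, HasCompactSupport (annihA g j f).1 := hasCompactSupport_annihA hf g
  have hAA : ∀ j, HasCompactSupport (creatA g j (annihA g j f)).1 := fun j =>
    hasCompactSupport_creatA (hA j) g j
  have conj_supp : ∀ k : smoothSpace n, HasCompactSupport k.1 →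
      HasCompactSupport (opConj k).1 := fun k hk => hk.comp_left (map_zero (starRingEnd ℂ))
  have hsum : ∀ (F : Fin n → smoothSpace n) (z : Cn n), (∑ j, F j).1 z = ∑ j, (F j).1 z :=
    fun F z => by rw [AddSubmonoidClass.coe_finsetSum, Finset.sum_apply]
  have i0 : Integrable (fun z => (starRingEnd ℂ) (f.1 z) * h.1 z) :=
    integrable_mul_of_hasCompactSupport (continuous_smoothSpace (opConj f))
      (continuous_smoothSpace h) (Or.inl (conj_supp f hf))
  have i1 : ∀ j, Integrable
      (fun z => (starRingEnd ℂ) ((creatA g j (annihA g j f)).1 z) * h.1 z) := fun j =>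
    integrable_mul_of_hasCompactSupport (continuous_smoothSpace (opConj _))
      (continuous_smoothSpace h) (Or.inl (conj_supp _ (hAA j)))
  have i2 : ∀ j, Integrable
      (fun z => (starRingEnd ℂ) (f.1 z) * (creatA g j (annihA g j h)).1 z) := fun j =>
    integrable_mul_of_hasCompactSupport (continuous_smoothSpace (opConj f))
      (continuous_smoothSpace _) (Or.inl (conj_supp f hf))
  have e1 : ∀ z, (starRingEnd ℂ) (magLaplacian ν μ f.1 z) * h.1 z =
      -4 * ∑ j, (starRingEnd ℂ) ((creatA g j (annihA g j f)).1 z) * h.1 z -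
        2 * μ * n * ((starRingEnd ℂ) (f.1 z) * h.1 z) := fun z => by
    rw [magLaplacian_eq, hsum, ← Finset.sum_mul]
    simp only [map_sub, map_mul, map_neg, map_sum, Complex.conj_ofReal, Complex.conj_ofNat,
      Complex.conj_natCast]
    ring
  have e2 : ∀ z, (starRingEnd ℂ) (f.1 z) * magLaplacian ν μ h.1 z =
      -4 * ∑ j, (starRingEnd ℂ) (f.1 z) * (creatA g j (annihA g j h)).1 z -
        2 * μ * n * ((starRingEnd ℂ) (f.1 z) * h.1 z) := fun z => by
    rw [magLaplacian_eq, hsum, ← Finset.mul_sum]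
    ring
  simp only [e1, e2]
  rw [integral_sub ((integrable_finsetSum _ fun j _ => i1 j).const_mul _) (i0.const_mul _),
    integral_sub ((integrable_finsetSum _ fun j _ => i2 j).const_mul _) (i0.const_mul _)]
  simp only [integral_const_mul]
  rw [integral_finsetSum _ fun j _ => i1 j, integral_finsetSum _ fun j _ => i2 j]
  congr 2
  refine Finset.sum_congr rfl fun j _ => ?_
  rw [integral_creatA_conj_mul g j _ _ (Or.inl (hA j)), integral_annihA_conj_mul g j _ _ (Or.inl hf)]

/-! ### Dominated convergence in `L²` -/

lemma tendsto_toLp_of_gaussian_bound {u : ℕ → Cn n → ℂ} {v : Cn n → ℂ}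
    (hu : ∀ k, MemLp (u k) 2 (volume : Measure (Cn n)))
    (hv : MemLp v 2 (volume : Measure (Cn n))) {t C : ℝ} (ht : 0 < t)
    (hb : ∀ k z, ‖u k z‖ ≤ C * Real.exp (-t * nsq z))
    (hlim : ∀ z, Filter.Tendsto (fun k => u k z) Filter.atTop (nhds (v z))) :
    Filter.Tendsto (fun k => (hu k).toLp (u k)) Filter.atTop (nhds (hv.toLp v)) := by
  have hvb : ∀ z, ‖v z‖ ≤ C * Real.exp (-t * nsq z) := fun z =>
    le_of_tendsto (hlim z).norm (Filter.Eventually.of_forall fun k => hb k z)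
  rw [Lp.tendsto_Lp_iff_tendsto_eLpNorm'']
  simp only [eLpNorm_eq_lintegral_rpow_enorm_toReal two_ne_zero ENNReal.ofNat_ne_top,
    ENNReal.toReal_ofNat]
  have h0 : Filter.Tendsto (fun k => ∫⁻ z, ‖(u k - v) z‖ₑ ^ (2 : ℝ)) Filter.atTop (nhds 0) := by
    have hbd : Integrable (fun z : Cn n => (2 * C) ^ 2 * Real.exp (-(2 * t) * nsq z)) :=
      (integrable_exp_neg_nsq (by positivity)).const_mul _
    -- The limit obeys the same Gaussian bound, so the squared difference is dominated by `(2C)²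
    -- e^{-2t|z|²}`.
    have := tendsto_lintegral_of_dominated_convergence' (μ := (volume : Measure (Cn n)))
      (F := fun k z => ‖(u k - v) z‖ₑ ^ (2 : ℝ)) (f := fun _ => 0)
      (fun z => ENNReal.ofReal ((2 * C) ^ 2 * Real.exp (-(2 * t) * nsq z)))
      (fun k => ((hu k).1.sub hv.1).enorm.pow_const _)
      (fun k => Filter.Eventually.of_forall fun z => ?_)
      hbd.lintegral_lt_top.ne
      (Filter.Eventually.of_forall fun z => ?_)
    · simpa using this
    · have h1 : ‖u k z - v z‖ ≤ 2 * C * Real.exp (-t * nsq z) :=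
        (norm_sub_le _ _).trans (by linarith [hb k z, hvb z])
      have h2 : ‖u k z - v z‖ ^ 2 ≤ (2 * C) ^ 2 * Real.exp (-(2 * t) * nsq z) := by
        refine (pow_le_pow_left₀ (norm_nonneg _) h1 2).trans_eq ?_
        rw [mul_pow, ← Real.exp_nat_mul]; congr 2; push_cast; ring
      change ‖u k z - v z‖ₑ ^ (2 : ℝ) ≤ ENNReal.ofReal _
      rw [← ofReal_norm, ENNReal.ofReal_rpow_of_nonneg (norm_nonneg _) (by norm_num)]
      exact ENNReal.ofReal_le_ofReal (by exact_mod_cast h2)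
    · have h1 : Filter.Tendsto (fun k => u k z - v z) Filter.atTop (nhds 0) := by
        simpa using (hlim z).sub_const (v z)
      have h2 := (ENNReal.continuous_rpow_const (y := 2)).tendsto 0 |>.comp
        (by simpa using h1.enorm : Filter.Tendsto (fun k => ‖(u k - v) z‖ₑ) Filter.atTop (nhds 0))
      simpa using! h2
  have := (ENNReal.continuous_rpow_const (y := 1 / 2)).tendsto 0 |>.comp h0
  simpa using! this

/-! ### Cutoff functions -/

lemma dz_comp_smul (j : Fin n) (c : ℝ) (f : Cn n → ℂ) (z : Cn n) :
    dz j (fun w => f (c • w)) z = c * dz j f (c • z) := by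
  simp only [dz, dx, dy, fderiv_comp_smul, smul_apply, Complex.real_smul]
  ring

lemma dzbar_comp_smul (j : Fin n) (c : ℝ) (f : Cn n → ℂ) (z : Cn n) :
    dzbar j (fun w => f (c • w)) z = c * dzbar j f (c • z) := by
  simp only [dzbar, dx, dy, fderiv_comp_smul, smul_apply, Complex.real_smul]
  ring

/-- Smooth functions with compact support that converge to `1` locally uniformly together with
their derivatives and have bounded derivatives. -/
lemma exists_cutoff (n : ℕ) : ∃ (χ : ℕ → smoothSpace n) (M : ℝ),
    (∀ k, HasCompactSupport (χ k).1) ∧ (∀ k z, ‖(χ k).1 z‖ ≤ M) ∧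
    (∀ k j z, ‖dz j (χ k).1 z‖ ≤ M) ∧ (∀ k j z, ‖dzbar j (χ k).1 z‖ ≤ M) ∧
    (∀ k j z, ‖dz j (dzbar j (χ k).1) z‖ ≤ M) ∧
    ∀ z, ∀ᶠ k in Filter.atTop, (χ k).1 =ᶠ[nhds z] fun _ => 1 := by
  let b : ContDiffBump (0 : Cn n) := ⟨1, 2, one_pos, one_lt_two⟩
  let f : Cn n → ℂ := fun z => (b z : ℂ)
  have hf : ContDiff ℝ ∞ f := Complex.ofRealCLM.contDiff.comp b.contDiff
  have hc : HasCompactSupport f := b.hasCompactSupport.comp_left Complex.ofReal_zero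
  -- The cutoffs are the dilates `f (z/(k+1))` of one bump. As the factor is at most `1`, the chain
  -- rule only decreases derivatives; as it tends to `0`, every fixed `z` eventually lies where the
  -- dilate is identically `1`.
  let c : ℕ → ℝ := fun k => ((k : ℝ) + 1)⁻¹
  have c_pos : ∀ k, 0 < c k := fun k => by positivity
  have c_le : ∀ k, c k ≤ 1 := fun k => inv_le_one_of_one_le₀ (by simp)
  have hc0 : ∀ k, ‖((c k : ℝ) : ℂ)‖ ≤ 1 := fun k => by
    rw [Complex.norm_real, Real.norm_of_nonneg (c_pos k).le]; exact c_le k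
  have smul_smooth : ∀ k, ContDiff ℝ ∞ (fun w : Cn n => f (c k • w)) := fun k =>
    hf.comp (contDiff_const_smul (c k))
  obtain ⟨M0, hM0⟩ := hc.exists_bound_of_continuous hf.continuous
  choose M1 hM1 using fun j => (hasCompactSupport_dz hc j).exists_bound_of_continuous
    (contDiff_dz j hf).continuous
  choose M2 hM2 using fun j => (hasCompactSupport_dzbar hc j).exists_bound_of_continuous
    (contDiff_dzbar j hf).continuous
  choose M3 hM3 using fun j => (hasCompactSupport_dz (hasCompactSupport_dzbar hc j) j
    ).exists_bound_of_continuous (contDiff_dz j (contDiff_dzbar j hf)).continuous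
  have p0 : 0 ≤ M0 := (norm_nonneg _).trans (hM0 0)
  have p1 : ∀ j, 0 ≤ M1 j := fun j => (norm_nonneg _).trans (hM1 j 0)
  have p2 : ∀ j, 0 ≤ M2 j := fun j => (norm_nonneg _).trans (hM2 j 0)
  have p3 : ∀ j, 0 ≤ M3 j := fun j => (norm_nonneg _).trans (hM3 j 0)
  have q1 : ∀ j, M1 j ≤ ∑ j, M1 j := fun j =>
    Finset.single_le_sum (f := M1) (fun j _ => p1 j) (Finset.mem_univ j)
  have q2 : ∀ j, M2 j ≤ ∑ j, M2 j := fun j =>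
    Finset.single_le_sum (f := M2) (fun j _ => p2 j) (Finset.mem_univ j)
  have q3 : ∀ j, M3 j ≤ ∑ j, M3 j := fun j =>
    Finset.single_le_sum (f := M3) (fun j _ => p3 j) (Finset.mem_univ j)
  have s1 : 0 ≤ ∑ j, M1 j := Finset.sum_nonneg fun j _ => p1 j
  have s2 : 0 ≤ ∑ j, M2 j := Finset.sum_nonneg fun j _ => p2 j
  have s3 : 0 ≤ ∑ j, M3 j := Finset.sum_nonneg fun j _ => p3 j
  have shrink : ∀ (k : ℕ) (a : ℂ), ‖(c k : ℂ) * a‖ ≤ ‖a‖ := fun k a => by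
    rw [norm_mul]; exact mul_le_of_le_one_left (norm_nonneg _) (hc0 k)
  refine ⟨fun k => ⟨fun w => f (c k • w), smul_smooth k⟩,
    M0 + ∑ j, M1 j + ∑ j, M2 j + ∑ j, M3 j, fun k => hc.comp_smul (c_pos k).ne', fun k z => ?_,
    fun k j z => ?_, fun k j z => ?_, fun k j z => ?_, fun z => ?_⟩
  · have := hM0 (c k • z)
    change ‖f (c k • z)‖ ≤ _
    linarith
  · have h := (shrink k _).trans (hM1 j (c k • z))
    change ‖dz j (fun w => f (c k • w)) z‖ ≤ _
    rw [dz_comp_smul]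
    linarith [q1 j]
  · have h := (shrink k _).trans (hM2 j (c k • z))
    change ‖dzbar j (fun w => f (c k • w)) z‖ ≤ _
    rw [dzbar_comp_smul]
    linarith [q2 j]
  · have h := (shrink k _).trans ((shrink k _).trans (hM3 j (c k • z)))
    change ‖dz j (dzbar j (fun w => f (c k • w))) z‖ ≤ _
    have e : dzbar j (fun w => f (c k • w)) = fun w => (c k : ℂ) * dzbar j f (c k • w) :=
      funext fun w => dzbar_comp_smul j (c k) f w
    have hd : ContDiff ℝ ∞ (fun w : Cn n => dzbar j f (c k • w)) :=
      (contDiff_dzbar j hf).comp (contDiff_const_smul (c k))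
    rw [e, dz_const_mul_apply j _ (differentiable_of_smooth hd z), dz_comp_smul]
    linarith [q3 j]
  · have hlim : Filter.Tendsto (fun k => c k • z) Filter.atTop (nhds ((0 : ℝ) • z)) :=
      (tendsto_one_div_add_atTop_nhds_zero_nat.congr fun k => by simp [c]).smul_const z
    rw [zero_smul] at hlim
    filter_upwards [hlim.eventually (Metric.ball_mem_nhds (0 : Cn n) one_pos)] with k hk
    have h1 : b =ᶠ[nhds (c k • z)] 1 := b.eventuallyEq_one_of_mem_ball hk
    have h2 : Filter.Tendsto (fun w : Cn n => c k • w) (nhds z) (nhds (c k • z)) :=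
      (continuous_const_smul (c k)).tendsto z
    filter_upwards [h2.eventually h1] with w hw
    change ((b (c k • w) : ℝ) : ℂ) = 1
    rw [hw]
    simp

/-! ### Leibniz rules for cutoffs and bounds uniform in the cutoff -/

lemma opDzbar_opMul (j : Fin n) (χ f : smoothSpace n) :
    opDzbar j (opMul χ f) = opMul χ (opDzbar j f) + opMul (opDzbar j χ) f :=
  Subtype.ext (funext fun z => (dzbar_mul_apply j (differentiableAt_of_mem_smoothSpace χ z)
    (differentiableAt_of_mem_smoothSpace f z)).trans (add_comm _ _))

lemma opDz_opMul (j : Fin n) (χ f : smoothSpace n) :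
    opDz j (opMul χ f) = opMul χ (opDz j f) + opMul (opDz j χ) f :=
  Subtype.ext (funext fun z => (dz_mul_apply j (differentiableAt_of_mem_smoothSpace χ z)
    (differentiableAt_of_mem_smoothSpace f z)).trans (add_comm _ _))

lemma opZ_opMul (j : Fin n) (χ f : smoothSpace n) : opZ j (opMul χ f) = opMul χ (opZ j f) :=
  Subtype.ext (funext fun _ => mul_left_comm _ _ _)

lemma opZbar_opMul (j : Fin n) (χ f : smoothSpace n) :
    opZbar j (opMul χ f) = opMul χ (opZbar j f) :=
  Subtype.ext (funext fun _ => mul_left_comm _ _ _)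

lemma annihA_opMul (g : ℂ) (j : Fin n) (χ f : smoothSpace n) :
    annihA g j (opMul χ f) = opMul χ (annihA g j f) + opMul (opDzbar j χ) f := by
  simp only [annihA_apply, opDzbar_opMul, opZ_opMul, map_add, map_smul]
  module

lemma creatA_opMul (g : ℂ) (j : Fin n) (χ f : smoothSpace n) :
    creatA g j (opMul χ f) = opMul χ (creatA g j f) - opMul (opDz j χ) f := by
  simp only [creatA_apply, opDz_opMul, opZbar_opMul, map_add, map_smul, map_neg]
  module

lemma creatA_annihA_opMul (g : ℂ) (j : Fin n) (χ f : smoothSpace n) :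
    creatA g j (annihA g j (opMul χ f)) = opMul χ (creatA g j (annihA g j f)) -
      opMul (opDz j χ) (annihA g j f) + opMul (opDzbar j χ) (creatA g j f) -
      opMul (opDz j (opDzbar j χ)) f := by
  rw [annihA_opMul, map_add, creatA_opMul, creatA_opMul]
  module

lemma sum_smoothSpace_apply {ι : Type*} (s : Finset ι) (F : ι → smoothSpace n) (z : Cn n) :
    (∑ j ∈ s, F j).1 z = ∑ j ∈ s, (F j).1 z := by
  rw [AddSubmonoidClass.coe_finsetSum, Finset.sum_apply]

lemma magLaplacian_congr (ν μ : ℝ) {f h : Cn n → ℂ} {z : Cn n} (hfh : f =ᶠ[nhds z] h) :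
    magLaplacian ν μ f z = magLaplacian ν μ h z := by
  have h1 : fderiv ℝ f z = fderiv ℝ h z := hfh.fderiv_eq
  have h2 : ∀ j, fderiv ℝ (dzbar j f) z = fderiv ℝ (dzbar j h) z := fun j => by
    have : dzbar j f =ᶠ[nhds z] dzbar j h := by
      filter_upwards [hfh.fderiv (𝕜 := ℝ)] with w hw
      simp only [dzbar, dx, dy, hw]
    exact this.fderiv_eq
  simp only [magLaplacian, euler, eulerBar, dz, dx, dy, h2]
  simp only [dzbar, dx, dy, h1, hfh.eq_of_nhds]

/-- This supplies the dominating function for `Δ(χ_k f)`. By `creatA_annihA_opMul` each summand is a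
bounded derivative of `χ_k` times a polynomial Gaussian; the exponent `μ/4` lies strictly below `Re
g = μ/2`. -/
lemma exists_gaussian_bound_magLaplacian (ν μ : ℝ) (hμ : 0 < μ) {f : smoothSpace n}
    (hf : IsPolyGauss (gauge ν μ) f) {χ : ℕ → smoothSpace n} {M : ℝ}
    (h0 : ∀ k z, ‖(χ k).1 z‖ ≤ M) (h1 : ∀ k j z, ‖dz j (χ k).1 z‖ ≤ M)
    (h2 : ∀ k j z, ‖dzbar j (χ k).1 z‖ ≤ M) (h3 : ∀ k j z, ‖dz j (dzbar j (χ k).1) z‖ ≤ M) :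
    ∃ C, ∀ k z, ‖magLaplacian ν μ (opMul (χ k) f).1 z‖ ≤ C * Real.exp (-(μ / 4) * nsq z) := by
  set g := gauge ν μ with hg
  have ht : μ / 4 < g.re := by rw [hg, gauge_re]; linarith
  have step : ∀ (p : ℕ → smoothSpace n) (h : smoothSpace n), (∀ k z, ‖(p k).1 z‖ ≤ M) →
      IsPolyGauss g h →
      ∃ C, ∀ k z, ‖(opMul (p k) h).1 z‖ ≤ C * Real.exp (-(μ / 4) * nsq z) := by
    intro p h hp hh
    obtain ⟨C, hC⟩ := hh.bound _ ht
    refine ⟨M * C, fun k z => ?_⟩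
    change ‖(p k).1 z * h.1 z‖ ≤ _
    rw [norm_mul, mul_assoc]
    exact mul_le_mul (hp k z) (hC z) (norm_nonneg _) ((norm_nonneg _).trans (hp k z))
  obtain ⟨C, hC⟩ := step χ f h0 hf
  choose D1 hD1 using fun j => step χ _ h0 ((hf.annihA j).creatA j)
  choose D2 hD2 using fun j => step (fun k => opDz j (χ k)) _ (fun k => h1 k j) (hf.annihA j)
  choose D3 hD3 using fun j => step (fun k => opDzbar j (χ k)) _ (fun k => h2 k j) (hf.creatA j)
  choose D4 hD4 using fun j => step (fun k => opDz j (opDzbar j (χ k))) f (fun k => h3 k j) hf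
  refine ⟨4 * ∑ j, (D1 j + D2 j + D3 j + D4 j) + ‖(2 * μ * n : ℂ)‖ * C, fun k z => ?_⟩
  rw [magLaplacian_eq, sum_smoothSpace_apply]
  refine (norm_sub_le _ _).trans ?_
  rw [add_mul]
  refine add_le_add ?_ ?_
  · rw [norm_mul, norm_neg, Complex.norm_ofNat, mul_assoc, Finset.sum_mul]
    refine mul_le_mul_of_nonneg_left ((norm_sum_le _ _).trans (Finset.sum_le_sum fun j _ => ?_))
      (by norm_num)
    rw [creatA_annihA_opMul]
    change ‖(opMul (χ k) (creatA g j (annihA g j f))).1 z -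
      (opMul (opDz j (χ k)) (annihA g j f)).1 z + (opMul (opDzbar j (χ k)) (creatA g j f)).1 z -
      (opMul (opDz j (opDzbar j (χ k))) f).1 z‖ ≤ _
    refine (norm_sub_le _ _).trans ?_
    rw [add_mul]
    refine add_le_add ?_ (hD4 j k z)
    refine (norm_add_le _ _).trans ?_
    rw [add_mul]
    refine add_le_add ?_ (hD3 j k z)
    refine (norm_sub_le _ _).trans ?_
    rw [add_mul]
    exact add_le_add (hD1 j k z) (hD2 j k z)
  · rw [norm_mul]
    exact (mul_le_mul_of_nonneg_left (hC k z) (norm_nonneg (2 * μ * n : ℂ))).trans_eq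
      (mul_assoc _ _ _).symm

/-! ### The closure of the minimal operator -/

lemma mem_minimalOperator_graph (ν μ : ℝ) (φ : testSpace n) :
    (testToL2 n φ, testToL2 n (testLaplacian n ν μ φ)) ∈ (minimalOperator n ν μ).graph := by
  rw [LinearPMap.mem_graph_iff]
  refine ⟨⟨testToL2 n φ, φ, rfl⟩, rfl, ?_⟩
  change testToL2 n (testLaplacian n ν μ ((LinearEquiv.ofInjective (testToL2 n)
    (testToL2_injective n)).symm ⟨testToL2 n φ, φ, rfl⟩)) = _
  congr 2
  rw [LinearEquiv.symm_apply_eq]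
  rfl

lemma exists_of_mem_minimalOperator_graph (ν μ : ℝ) {p : L2 n × L2 n}
    (hp : p ∈ (minimalOperator n ν μ).graph) :
    ∃ φ : testSpace n, p = (testToL2 n φ, testToL2 n (testLaplacian n ν μ φ)) := by
  rw [LinearPMap.mem_graph_iff] at hp
  obtain ⟨⟨x, φ, rfl⟩, h1, h2⟩ := hp
  refine ⟨φ, Prod.ext h1.symm ?_⟩
  have := mem_minimalOperator_graph ν μ φ
  rw [LinearPMap.mem_graph_iff] at this
  obtain ⟨y, hy1, hy2⟩ := this
  have : y = ⟨testToL2 n φ, φ, rfl⟩ := Subtype.ext hy1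
  rw [this] at hy2
  exact h2.symm.trans hy2

/-- The approximants are `χ_k f`. At each point both `χ_k f` and `Δ(χ_k f)` are eventually equal to
their limits, and the Gaussian bounds upgrade this to convergence in `L²`. -/
lemma mem_closure_graph_of_isPolyGauss (ν μ : ℝ) (hμ : 0 < μ) {f : smoothSpace n}
    (hf : IsPolyGauss (gauge ν μ) f) {F G : L2 n} (hF : F =ᵐ[volume] f.1)
    (hG : G =ᵐ[volume] magLaplacian ν μ f.1) :
    (F, G) ∈ (minimalOperator n ν μ).graph.topologicalClosure := by
  obtain ⟨χ, M, hc, h0, h1, h2, h3, hlim⟩ := exists_cutoff n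
  have ht : μ / 4 < (gauge ν μ).re := by rw [gauge_re]; linarith
  have ht0 : 0 < μ / 4 := by linarith
  have memF : MemLp f.1 2 := (memLp_congr_ae hF).1 (Lp.memLp F)
  have memG : MemLp (magLaplacian ν μ f.1) 2 := (memLp_congr_ae hG).1 (Lp.memLp G)
  let φ : ℕ → testSpace n := fun k => ⟨(opMul (χ k) f).1, contDiff_smoothSpace _,
    (hc k).mul_right⟩
  obtain ⟨C, hC⟩ := hf.bound _ ht
  obtain ⟨D, hD⟩ := exists_gaussian_bound_magLaplacian ν μ hμ hf h0 h1 h2 h3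
  have t1 : Filter.Tendsto (fun k => testToL2 n (φ k)) Filter.atTop (nhds (memF.toLp f.1)) := by
    refine tendsto_toLp_of_gaussian_bound (fun k => memLp_testSpace (φ k)) memF ht0 (C := M * C)
      (fun k z => ?_) (fun z => ?_)
    · change ‖(χ k).1 z * f.1 z‖ ≤ _
      rw [norm_mul, mul_assoc]
      exact mul_le_mul (h0 k z) (hC z) (norm_nonneg _) ((norm_nonneg _).trans (h0 k z))
    · refine tendsto_const_nhds.congr' ?_
      filter_upwards [hlim z] with k hk
      change f.1 z = (χ k).1 z * f.1 z
      rw [hk.eq_of_nhds, one_mul]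
  have t2 : Filter.Tendsto (fun k => testToL2 n (testLaplacian n ν μ (φ k))) Filter.atTop
      (nhds (memG.toLp _)) := by
    refine tendsto_toLp_of_gaussian_bound
      (fun k => memLp_testSpace (testLaplacian n ν μ (φ k))) memG ht0
      (fun k z => hD k z) (fun z => ?_)
    refine tendsto_const_nhds.congr' ?_
    filter_upwards [hlim z] with k hk
    refine (magLaplacian_congr ν μ ?_).symm
    filter_upwards [hk] with w hw
    change (χ k).1 w * f.1 w = f.1 w
    rw [hw, one_mul]
  have eF : F = memF.toLp f.1 := Lp.ext (hF.trans memF.coeFn_toLp.symm)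
  have eG : G = memG.toLp _ := Lp.ext (hG.trans memG.coeFn_toLp.symm)
  rw [eF, eG]
  exact mem_closure_of_tendsto (t1.prodMk_nhds t2)
    (Filter.Eventually.of_forall fun k => mem_minimalOperator_graph ν μ (φ k))

/-! ### Pairing with test functions, symmetry and closability -/

lemma inner_L2_eq {F G : L2 n} {f h : Cn n → ℂ} (hF : F =ᵐ[volume] f) (hG : G =ᵐ[volume] h) :
    inner ℂ F G = ∫ z, (starRingEnd ℂ) (f z) * h z := by
  rw [MeasureTheory.L2.inner_def]
  refine integral_congr_ae ?_
  filter_upwards [hF, hG] with z h1 h2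
  rw [h1, h2, RCLike.inner_apply, mul_comm]

lemma testToL2_ae (φ : testSpace n) : testToL2 n φ =ᵐ[volume] φ.1 :=
  (memLp_testSpace φ).coeFn_toLp

/-- A function in `L²` that is orthogonal to all test functions vanishes. -/
lemma eq_zero_of_inner_testToL2_eq_zero {F : L2 n} (h : ∀ φ, inner ℂ (testToL2 n φ) F = 0) :
    F = 0 := by
  have hloc : LocallyIntegrable F volume := (Lp.memLp F).locallyIntegrable (by norm_num)
  refine Lp.ext ?_
  have := ae_eq_zero_of_integral_contDiff_smul_eq_zero (μ := (volume : Measure (Cn n))) hloc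
    (fun g hg hgc => ?_)
  · filter_upwards [this, Lp.coeFn_zero ℂ 2 (volume : Measure (Cn n))] with z h1 h2
    rw [h1, h2]; rfl
  · let φ : testSpace n := ⟨fun z => (g z : ℂ), Complex.ofRealCLM.contDiff.comp hg,
      hgc.comp_left Complex.ofReal_zero⟩
    have h1 := h φ
    rw [inner_L2_eq (testToL2_ae φ) (Filter.EventuallyEq.refl _ _)] at h1
    rw [← h1]
    refine integral_congr_ae (Filter.Eventually.of_forall fun z => ?_)
    change g z • F z = (starRingEnd ℂ) (g z : ℂ) * F z
    rw [Complex.conj_ofReal, Complex.real_smul]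

lemma inner_testLaplacian (ν μ : ℝ) (φ ψ : testSpace n) :
    inner ℂ (testToL2 n (testLaplacian n ν μ φ)) (testToL2 n ψ) =
      inner ℂ (testToL2 n φ) (testToL2 n (testLaplacian n ν μ ψ)) := by
  rw [inner_L2_eq (testToL2_ae _) (testToL2_ae _), inner_L2_eq (testToL2_ae _) (testToL2_ae _)]
  exact integral_magLaplacian_conj_mul ν μ ⟨φ.1, φ.2.1⟩ ⟨ψ.1, ψ.2.1⟩ φ.2.2

/-- The hypothesis on `q` says that it belongs to the graph of the adjoint of the minimal operator;
the identity is a closed condition on `p`. Asking no more of `q` makes the lemma applicable to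
distributional eigenvectors. -/
lemma inner_eq_inner_of_mem_closure_graph (ν μ : ℝ) {p q : L2 n × L2 n}
    (hp : p ∈ (minimalOperator n ν μ).graph.topologicalClosure)
    (hq : ∀ φ, inner ℂ (testToL2 n (testLaplacian n ν μ φ)) q.1 = inner ℂ (testToL2 n φ) q.2) :
    inner ℂ p.2 q.1 = inner ℂ p.1 q.2 := by
  have hcl : IsClosed {p : L2 n × L2 n | inner ℂ p.2 q.1 = inner ℂ p.1 q.2} :=
    isClosed_eq (by fun_prop) (by fun_prop)
  refine closure_minimal (fun p hp => ?_) hcl hp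
  obtain ⟨φ, rfl⟩ := exists_of_mem_minimalOperator_graph ν μ hp
  exact hq φ

/-- The preceding lemma is used twice, once for each argument, starting from symmetry on test
functions. -/
lemma inner_symm_of_mem_closure_graph (ν μ : ℝ) {p q : L2 n × L2 n}
    (hp : p ∈ (minimalOperator n ν μ).graph.topologicalClosure)
    (hq : q ∈ (minimalOperator n ν μ).graph.topologicalClosure) :
    inner ℂ p.2 q.1 = inner ℂ p.1 q.2 := by
  refine inner_eq_inner_of_mem_closure_graph ν μ hp fun φ => ?_
  have := inner_eq_inner_of_mem_closure_graph ν μ hq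
    (q := (testToL2 n φ, testToL2 n (testLaplacian n ν μ φ)))
    (fun ψ => inner_testLaplacian ν μ ψ φ)
  rw [← inner_conj_symm, ← inner_conj_symm (testToL2 n φ)]
  exact congrArg _ this.symm

/-- A densely defined symmetric operator is closable: if `(0, y)` lies in the closed graph, symmetry
makes `y` orthogonal to all test functions. -/
lemma minimalOperator_isClosable (n : ℕ) (ν μ : ℝ) : (minimalOperator n ν μ).IsClosable := by
  refine ⟨(minimalOperator n ν μ).graph.topologicalClosure.toLinearPMap, ?_⟩
  rw [Submodule.toLinearPMap_graph_eq]
  intro p hp hp1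
  refine eq_zero_of_inner_testToL2_eq_zero fun φ => ?_
  have hφ : (testToL2 n φ, testToL2 n (testLaplacian n ν μ φ)) ∈
      (minimalOperator n ν μ).graph.topologicalClosure :=
    Submodule.le_topologicalClosure _ (mem_minimalOperator_graph ν μ φ)
  have := inner_symm_of_mem_closure_graph ν μ hφ hp
  rw [hp1, inner_zero_right] at this
  exact this.symm

lemma mem_magOperator_graph_iff (ν μ : ℝ) {p : L2 n × L2 n} :
    p ∈ (magOperator n ν μ).graph ↔ p ∈ (minimalOperator n ν μ).graph.topologicalClosure := by
  rw [(minimalOperator_isClosable n ν μ).graph_closure_eq_closure_graph]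
  rfl

lemma isClosed_magOperator_graph (n : ℕ) (ν μ : ℝ) :
    IsClosed ((magOperator n ν μ).graph : Set (L2 n × L2 n)) :=
  (minimalOperator_isClosable n ν μ).closure_isClosed

/-- The closed operator is symmetric. -/
lemma inner_magOperator_graph (ν μ : ℝ) {p q : L2 n × L2 n} (hp : p ∈ (magOperator n ν μ).graph)
    (hq : q ∈ (magOperator n ν μ).graph) : inner ℂ p.2 q.1 = inner ℂ p.1 q.2 :=
  inner_symm_of_mem_closure_graph ν μ ((mem_magOperator_graph_iff ν μ).1 hp)
    ((mem_magOperator_graph_iff ν μ).1 hq)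

/-! ### Completeness of the polynomials times the ground state -/

/-- The positive and negative parts of `h` are densities of two finite measures with the same
characteristic function. The measures agree, so the two parts are equal almost everywhere, and at
each point one of them is zero. -/
lemma ae_eq_zero_of_integral_cexp_mul_eq_zero_real {h : Cn n → ℝ} (hh : Integrable h)
    (h0 : ∀ L : StrongDual ℝ (Cn n), ∫ z, Complex.exp (L z * Complex.I) * (h z : ℂ) = 0) :
    h =ᵐ[volume] 0 := by
  have fin1 : IsFiniteMeasure (volume.withDensity fun z => ENNReal.ofReal (h z)) :=
    isFiniteMeasure_withDensity_ofReal hh.2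
  have fin2 : IsFiniteMeasure (volume.withDensity fun z => ENNReal.ofReal (-h z)) :=
    isFiniteMeasure_withDensity_ofReal hh.fun_neg.2
  have cf : ∀ (k : Cn n → ℝ), Integrable k → ∀ L : StrongDual ℝ (Cn n),
      charFunDual (volume.withDensity fun z => ENNReal.ofReal (k z)) L =
        ∫ z, Complex.exp (L z * Complex.I) * ((max (k z) 0 : ℝ) : ℂ) := by
    intro k hk L
    rw [charFunDual_apply, integral_withDensity_eq_integral_toReal_smul₀
      hk.aestronglyMeasurable.aemeasurable.ennreal_ofReal
      (Filter.Eventually.of_forall fun _ => ENNReal.ofReal_lt_top)]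
    refine integral_congr_ae (Filter.Eventually.of_forall fun z => ?_)
    simp only [ENNReal.toReal_ofReal', Complex.real_smul]
    ring
  have expint : ∀ (k : Cn n → ℝ), Integrable k → ∀ L : StrongDual ℝ (Cn n),
      Integrable fun z => Complex.exp (L z * Complex.I) * (k z : ℂ) := fun k hk L => by
    refine hk.ofReal.bdd_mul (c := 1) (by fun_prop) (Filter.Eventually.of_forall fun z => ?_)
    rw [Complex.norm_exp_ofReal_mul_I]
  have heq : (volume.withDensity fun z => ENNReal.ofReal (h z)) =
      volume.withDensity fun z => ENNReal.ofReal (-h z) := by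
    refine Measure.ext_of_charFunDual (funext fun L => ?_)
    rw [cf _ hh, cf _ hh.fun_neg, ← sub_eq_zero,
      ← integral_sub (expint _ hh.pos_part L) (expint _ hh.fun_neg.pos_part L), ← h0 L]
    refine integral_congr_ae (Filter.Eventually.of_forall fun z => ?_)
    simp only
    rw [← mul_sub, ← Complex.ofReal_sub]
    congr 2
    rcases le_total (h z) 0 with hz | hz
    · rw [max_eq_right hz, max_eq_left (by linarith)]; ring
    · rw [max_eq_left hz, max_eq_right (by linarith)]; ring
  have hae := (withDensity_eq_iff_of_sigmaFinite
    hh.aestronglyMeasurable.aemeasurable.ennreal_ofReal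
    hh.fun_neg.aestronglyMeasurable.aemeasurable.ennreal_ofReal).1 heq
  filter_upwards [hae] with z hz
  change h z = 0
  rcases le_total (h z) 0 with h1 | h1
  · rw [ENNReal.ofReal_of_nonpos h1, eq_comm, ENNReal.ofReal_eq_zero] at hz
    linarith
  · rw [ENNReal.ofReal_of_nonpos (by linarith : -h z ≤ 0), ENNReal.ofReal_eq_zero] at hz
    linarith

/-- The Fourier transform is injective on `L¹`. -/
lemma ae_eq_zero_of_integral_cexp_mul_eq_zero {h : Cn n → ℂ} (hh : Integrable h)
    (h0 : ∀ L : StrongDual ℝ (Cn n), ∫ z, Complex.exp (L z * Complex.I) * h z = 0) :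
    h =ᵐ[volume] 0 := by
  have expint : ∀ (k : Cn n → ℂ), Integrable k → ∀ L : StrongDual ℝ (Cn n),
      Integrable fun z => Complex.exp (L z * Complex.I) * k z := fun k hk L => by
    refine hk.bdd_mul (c := 1) (by fun_prop) (Filter.Eventually.of_forall fun z => ?_)
    rw [Complex.norm_exp_ofReal_mul_I]
  have hconj : Integrable fun z => (starRingEnd ℂ) (h z) :=
    Complex.conjCLE.toContinuousLinearMap.integrable_comp hh
  have h0' : ∀ L : StrongDual ℝ (Cn n),
      ∫ z, Complex.exp (L z * Complex.I) * (starRingEnd ℂ) (h z) = 0 := by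
    intro L
    -- Conjugating the hypothesis at `-L` gives it for `h̄` at `L`, so the real and imaginary parts
    -- can be treated separately.
    have := congrArg (starRingEnd ℂ) (h0 (-L))
    rw [← integral_conj, map_zero] at this
    rw [← this]
    refine integral_congr_ae (Filter.Eventually.of_forall fun z => ?_)
    simp [← Complex.exp_conj]
  have hre : (fun z => (h z).re) =ᵐ[volume] 0 := by
    refine ae_eq_zero_of_integral_cexp_mul_eq_zero_real hh.re fun L => ?_
    have e : ∀ z, Complex.exp (L z * Complex.I) * ((h z).re : ℂ) =
        (1 / 2 : ℂ) * (Complex.exp (L z * Complex.I) * h z +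
          Complex.exp (L z * Complex.I) * (starRingEnd ℂ) (h z)) := fun z => by
      rw [← mul_add, Complex.add_conj]; push_cast; ring
    simp only [e]
    rw [integral_const_mul, integral_add (expint _ hh L) (expint _ hconj L), h0, h0']
    simp
  have him : (fun z => (h z).im) =ᵐ[volume] 0 := by
    refine ae_eq_zero_of_integral_cexp_mul_eq_zero_real hh.im fun L => ?_
    have e : ∀ z, Complex.exp (L z * Complex.I) * ((h z).im : ℂ) =
        (-Complex.I / 2 : ℂ) * (Complex.exp (L z * Complex.I) * h z -
          Complex.exp (L z * Complex.I) * (starRingEnd ℂ) (h z)) := fun z => by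
      rw [← mul_sub, Complex.sub_conj]; push_cast
      linear_combination (Complex.exp (L z * Complex.I) * ((h z).im : ℂ)) * Complex.I_sq
    simp only [e]
    rw [integral_const_mul, integral_sub (expint _ hh L) (expint _ hconj L), h0, h0']
    simp
  filter_upwards [hre, him] with z h1 h2
  exact Complex.ext h1 h2

lemma norm_sq_le_nsq (z : Cn n) : ‖z‖ ^ 2 ≤ nsq z := by
  have h : ‖z‖ ≤ Real.sqrt (nsq z) := (pi_norm_le_iff_of_nonneg (Real.sqrt_nonneg _)).2 fun j =>
    Real.le_sqrt_of_sq_le (sq_le_nsq z j)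
  calc ‖z‖ ^ 2 ≤ Real.sqrt (nsq z) ^ 2 := by gcongr
    _ = nsq z := Real.sq_sqrt (nsq_nonneg z)

/-- Completing the square: `c²/(4ε)` is the maximum of `c x - ε x²`. -/
lemma exp_norm_le {ε : ℝ} (hε : 0 < ε) (c : ℝ) :
    ∃ C > 0, ∀ z : Cn n, Real.exp (c * ‖z‖) ≤ C * Real.exp (ε * nsq z) := by
  refine ⟨Real.exp (c ^ 2 / (4 * ε)), Real.exp_pos _, fun z => ?_⟩
  rw [← Real.exp_add, Real.exp_le_exp]
  have h1 : c * ‖z‖ ≤ c ^ 2 / (4 * ε) + ε * ‖z‖ ^ 2 := by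
    have : c ^ 2 / (4 * ε) + ε * ‖z‖ ^ 2 - c * ‖z‖ = (c - 2 * ε * ‖z‖) ^ 2 / (4 * ε) := by
      field_simp; ring
    have : 0 ≤ (c - 2 * ε * ‖z‖) ^ 2 / (4 * ε) := by positivity
    linarith
  have := mul_le_mul_of_nonneg_left (norm_sq_le_nsq z) hε.le
  linarith

/-- A real linear form as a smooth function. -/
def linForm (L : StrongDual ℝ (Cn n)) : smoothSpace n :=
  ⟨fun z => (L z : ℂ), show ContDiff ℝ ∞ (fun z => (L z : ℂ)) from
    Complex.ofRealCLM.contDiff.comp L.contDiff⟩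

lemma linForm_apply (L : StrongDual ℝ (Cn n)) (z : Cn n) :
    (L z : ℂ) = ∑ j, (((L (Pi.single j 1) : ℂ) - Complex.I * (L (Pi.single j Complex.I) : ℂ)) / 2 *
      z j + ((L (Pi.single j 1) : ℂ) + Complex.I * (L (Pi.single j Complex.I) : ℂ)) / 2 *
      (starRingEnd ℂ) (z j)) := by
  have hz : z = ∑ j, ((z j).re • (Pi.single j 1 : Cn n) +
      (z j).im • (Pi.single j Complex.I : Cn n)) := by
    ext k
    simp only [Finset.sum_apply, Pi.add_apply, Pi.smul_apply, Pi.single_apply]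
    simp [Finset.sum_add_distrib]
  conv_lhs => rw [hz]
  rw [map_sum, Complex.ofReal_sum]
  refine Finset.sum_congr rfl fun j _ => ?_
  simp only [map_add, map_smul, smul_eq_mul, Complex.ofReal_add, Complex.ofReal_mul]
  have h1 : z j = (z j).re + (z j).im * Complex.I := (Complex.re_add_im _).symm
  have h2 : (starRingEnd ℂ) (z j) = (z j).re - (z j).im * Complex.I :=
    Complex.ext (by simp) (by simp)
  rw [h2]
  conv_rhs => rw [h1]
  simp only [Complex.add_re, Complex.ofReal_re, Complex.mul_re, Complex.I_re, mul_zero,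
    Complex.ofReal_im, Complex.I_im, mul_one, sub_self, add_zero, Complex.add_im, Complex.mul_im,
    zero_add]
  linear_combination (((z j).im : ℂ) * (L (Pi.single j Complex.I) : ℂ)) * Complex.I_sq

lemma IsPolyGauss.sum {g : ℂ} {ι : Type*} (s : Finset ι) {f : ι → smoothSpace n}
    (hf : ∀ i ∈ s, IsPolyGauss g (f i)) : IsPolyGauss g (∑ i ∈ s, f i) :=
  Finset.sum_induction f (IsPolyGauss g) (fun _ _ => .add) .zero hf

lemma IsPolyGauss.linForm_mul {g : ℂ} {f : smoothSpace n} (hf : IsPolyGauss g f)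
    (L : StrongDual ℝ (Cn n)) : IsPolyGauss g (opMul (linForm L) f) := by
  have e : opMul (linForm L) f = ∑ j,
      ((((L (Pi.single j 1) : ℂ) - Complex.I * (L (Pi.single j Complex.I) : ℂ)) / 2) •
        MagneticLaplacian.opZ j f +
      (((L (Pi.single j 1) : ℂ) + Complex.I * (L (Pi.single j Complex.I) : ℂ)) / 2) •
        MagneticLaplacian.opZbar j f) := by
    refine Subtype.ext (funext fun z => ?_)
    rw [sum_smoothSpace_apply]
    change (L z : ℂ) * f.1 z = ∑ j, (_ * (z j * f.1 z) + _ * ((starRingEnd ℂ) (z j) * f.1 z))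
    rw [linForm_apply, Finset.sum_mul]
    refine Finset.sum_congr rfl fun j _ => ?_
    ring
  rw [e]
  exact IsPolyGauss.sum _ fun j _ => ((hf.opZ j).smul _).add ((hf.opZbar j).smul _)

/-- Orthogonality to polynomial Gaussians thereby becomes vanishing of the moments along every real
linear form. -/
lemma exists_isPolyGauss_pow (g : ℂ) (L : StrongDual ℝ (Cn n)) (k : ℕ) :
    ∃ f : smoothSpace n, IsPolyGauss g f ∧
      ∀ z, f.1 z = (L z : ℂ) ^ k * Complex.exp (-g * quad z) := by
  induction k with
  | zero => exact ⟨_, .ground, fun z => by rw [pow_zero, one_mul, ground_apply]⟩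
  | succ k ih =>
    obtain ⟨f, hf, h⟩ := ih
    refine ⟨_, hf.linForm_mul L, fun z => ?_⟩
    change (L z : ℂ) * f.1 z = _
    rw [h, pow_succ]; ring

/-- The exponential series is integrated term by term; its partial sums are dominated by `e^{‖L‖‖z‖}
‖G z‖`, which `hint` makes integrable. -/
lemma integral_cexp_mul_eq_zero_of_moments {G : Cn n → ℂ} (hmeas : AEStronglyMeasurable G volume)
    (hint : ∀ c : ℝ, Integrable fun z => Real.exp (c * ‖z‖) * ‖G z‖) (L : StrongDual ℝ (Cn n))
    (h : ∀ k : ℕ, ∫ z, (L z : ℂ) ^ k * G z = 0) :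
    ∫ z, Complex.exp (L z * Complex.I) * G z = 0 := by
  have hz : (fun k : ℕ => ∫ z, ((L z * Complex.I) ^ k / (k.factorial : ℂ)) * G z) = fun _ => 0 := by
    funext k
    have e : ∀ z, ((L z * Complex.I) ^ k / (k.factorial : ℂ)) * G z =
        (Complex.I ^ k / (k.factorial : ℂ)) * ((L z : ℂ) ^ k * G z) := fun z => by ring
    simp only [e]
    rw [integral_const_mul, h, mul_zero]
  have hcont : ∀ k : ℕ, Continuous fun z => (L z * Complex.I) ^ k / (k.factorial : ℂ) := fun k =>
    (((Complex.continuous_ofReal.comp L.continuous).mul continuous_const).pow k).div_const _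
  have hsum : ∀ z, Summable fun k : ℕ => (‖L‖ * ‖z‖) ^ k / (k.factorial : ℝ) * ‖G z‖ := fun z =>
    (Real.summable_pow_div_factorial (‖L‖ * ‖z‖)).mul_right _
  have hbound : ∀ (k : ℕ) z, ‖((L z * Complex.I) ^ k / (k.factorial : ℂ)) * G z‖ ≤
      (‖L‖ * ‖z‖) ^ k / (k.factorial : ℝ) * ‖G z‖ := fun k z => by
    rw [norm_mul]
    refine mul_le_mul_of_nonneg_right ?_ (norm_nonneg _)
    rw [norm_div, norm_pow, norm_mul, Complex.norm_I, mul_one, Complex.norm_real,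
      Complex.norm_natCast]
    exact div_le_div_of_nonneg_right (pow_le_pow_left₀ (norm_nonneg _) (L.le_opNorm z) k)
      (Nat.cast_nonneg _)
  have hint' : Integrable fun z => ∑' k : ℕ, (‖L‖ * ‖z‖) ^ k / (k.factorial : ℝ) * ‖G z‖ := by
    refine (hint ‖L‖).congr (Filter.Eventually.of_forall fun z => ?_)
    simp only [tsum_mul_right]
    rw [Real.exp_eq_exp_ℝ, NormedSpace.exp_eq_tsum_div]
  have hlim : ∀ z, HasSum (fun k : ℕ => ((L z * Complex.I) ^ k / (k.factorial : ℂ)) * G z)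
      (Complex.exp (L z * Complex.I) * G z) := fun z => by
    refine HasSum.mul_right _ ?_
    rw [Complex.exp_eq_exp_ℂ]
    exact NormedSpace.expSeries_div_hasSum_exp _
  have hs := hasSum_integral_of_dominated_convergence (μ := (volume : Measure (Cn n))) _
    (fun k => (hcont k).aestronglyMeasurable.mul hmeas)
    (fun k => Filter.Eventually.of_forall (hbound k)) (Filter.Eventually.of_forall hsum) hint'
    (Filter.Eventually.of_forall hlim)
  simp only [Pi.mul_apply] at hs
  rw [hz] at hs
  exact hs.unique hasSum_zero

lemma norm_gaussian (a : ℂ) (z : Cn n) :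
    ‖Complex.exp (-a * quad z)‖ = Real.exp (-a.re * nsq z) := by
  rw [Complex.norm_exp, quad_eq_nsq]
  congr 1
  simp

lemma gaussBdd_exp_norm_mul_gaussian {a : ℂ} (ha : 0 < a.re) (c : ℝ) :
    GaussBdd (fun z : Cn n => (Real.exp (c * ‖z‖) : ℂ) * Complex.exp (-a * quad z)) := by
  obtain ⟨C, hC, hb⟩ := exp_norm_le (n := n) (half_pos ha) c
  have hq : Continuous (quad : Cn n → ℂ) := contDiff_quad.continuous
  refine ⟨by fun_prop, a.re / 2, by linarith, C, fun z => ?_⟩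
  rw [norm_mul, norm_gaussian, Complex.norm_real, Real.norm_of_nonneg (Real.exp_pos _).le]
  calc _ ≤ C * Real.exp (a.re / 2 * nsq z) * Real.exp (-a.re * nsq z) := by
        gcongr; exact hb z
    _ = _ := by rw [mul_assoc, ← Real.exp_add]; congr 2; ring

lemma integrable_exp_norm_mul_gaussian {a : ℂ} (ha : 0 < a.re) {F : Cn n → ℂ}
    (hF : MemLp F 2 (volume : Measure (Cn n))) (c : ℝ) :
    Integrable fun z => Real.exp (c * ‖z‖) * ‖Complex.exp (-a * quad z) * F z‖ := by
  refine ((gaussBdd_exp_norm_mul_gaussian ha c).memLp.integrable_mul hF).norm.congr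
    (Filter.Eventually.of_forall fun z => ?_)
  simp only [Pi.mul_apply, norm_mul, mul_assoc, Complex.norm_real,
    Real.norm_of_nonneg (Real.exp_pos _).le]

/-- The polynomials times the ground state are total in `L²`. -/
lemma eq_zero_of_forall_isPolyGauss {g : ℂ} (hg : 0 < g.re) {F : L2 n}
    (h : ∀ f : smoothSpace n, IsPolyGauss g f → ∫ z, (starRingEnd ℂ) (f.1 z) * F z = 0) :
    F = 0 := by
  have hg' : 0 < ((starRingEnd ℂ) g).re := by rwa [Complex.conj_re]
  -- The conjugate of `g` appears because the inner product conjugates the polynomial Gaussian. All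
  -- moments of `w F` vanish, hence `w F = 0`, and `w` has no zeros.
  set w : Cn n → ℂ := fun z => Complex.exp (-(starRingEnd ℂ) g * quad z) with hw
  have hmeas : AEStronglyMeasurable (fun z => w z * F z) volume :=
    (contDiff_gaussian _).continuous.aestronglyMeasurable.mul (Lp.memLp F).1
  have hint := integrable_exp_norm_mul_gaussian hg' (Lp.memLp F)
  have hG : Integrable (fun z => w z * F z) := by
    have := hint 0
    simp only [zero_mul, Real.exp_zero, one_mul] at this
    exact (integrable_norm_iff hmeas).1 this
  have key : (fun z => w z * F z) =ᵐ[volume] 0 := by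
    refine ae_eq_zero_of_integral_cexp_mul_eq_zero hG fun L => ?_
    refine integral_cexp_mul_eq_zero_of_moments hmeas hint L fun k => ?_
    obtain ⟨f, hf, hfz⟩ := exists_isPolyGauss_pow (n := n) g L k
    rw [← h f hf]
    refine integral_congr_ae (Filter.Eventually.of_forall fun z => ?_)
    simp only [hfz, map_mul, map_pow, Complex.conj_ofReal, hw, mul_assoc, ← Complex.exp_conj,
      map_neg, quad_eq_nsq]
  refine Lp.ext ?_
  filter_upwards [key, Lp.coeFn_zero ℂ 2 (volume : Measure (Cn n))] with z h1 h2
  rw [h2]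
  exact (mul_eq_zero.1 h1).resolve_left (Complex.exp_ne_zero _)

/-! ### Exponential integral transforms -/

/-- The coordinate `z ↦ z_j` as a real linear map. -/
def coordCLM (j : Fin n) : Cn n →L[ℝ] ℂ :=
  ContinuousLinearMap.proj (R := ℝ) (φ := fun _ : Fin n => ℂ) j

/-- The conjugate coordinate `z ↦ z̄_j` as a real linear map. -/
def conjCoordCLM (j : Fin n) : Cn n →L[ℝ] ℂ :=
  (Complex.conjCLE : ℂ →L[ℝ] ℂ).comp (coordCLM j)

@[simp] lemma coordCLM_apply (j : Fin n) (z : Cn n) : coordCLM j z = z j := rfl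

@[simp] lemma conjCoordCLM_apply (j : Fin n) (z : Cn n) :
    conjCoordCLM j z = (starRingEnd ℂ) (z j) := rfl

/-- The real linear map `z ↦ ∑ (a z_j w̄_j + b z̄_j w_j)`. -/
def phase (a b : ℂ) (w : Cn n) : Cn n →L[ℝ] ℂ :=
  ∑ j, ((a * (starRingEnd ℂ) (w j)) • coordCLM j + (b * w j) • conjCoordCLM j)

lemma phase_apply (a b : ℂ) (w z : Cn n) : phase a b w z =
    ∑ j, (a * (starRingEnd ℂ) (w j) * z j + b * w j * (starRingEnd ℂ) (z j)) := by
  simp only [phase, sum_apply, add_apply, smul_apply, coordCLM_apply, conjCoordCLM_apply,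
    smul_eq_mul]

/-- The kernel can thus be viewed as a function of either variable: derivatives in `z` act under the
integral, those in `w` serve for integration by parts. -/
lemma phase_swap (a b : ℂ) (w z : Cn n) : phase a b w z = phase b a z w := by
  simp only [phase_apply]
  exact Finset.sum_congr rfl fun j _ => by ring

lemma continuous_phase (a b : ℂ) : Continuous (phase a b : Cn n → (Cn n →L[ℝ] ℂ)) := by
  unfold phase
  fun_prop

lemma norm_phase_apply_le (a b : ℂ) (w z : Cn n) :
    ‖phase a b w z‖ ≤ n * (‖a‖ + ‖b‖) * ‖w‖ * ‖z‖ := by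
  rw [phase_apply]
  calc _ ≤ ∑ _j : Fin n, (‖a‖ * ‖w‖ * ‖z‖ + ‖b‖ * ‖w‖ * ‖z‖) := by
        refine (norm_sum_le _ _).trans (Finset.sum_le_sum fun j _ => (norm_add_le _ _).trans ?_)
        simp only [norm_mul, Complex.norm_conj]
        have h1 := norm_le_pi_norm w j
        have h2 := norm_le_pi_norm z j
        gcongr
    _ = _ := by
        rw [Finset.sum_const, Finset.card_univ, Fintype.card_fin, nsmul_eq_mul]; ring

lemma norm_phase_le (a b : ℂ) (w : Cn n) : ‖phase a b w‖ ≤ n * (‖a‖ + ‖b‖) * ‖w‖ :=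
  ContinuousLinearMap.opNorm_le_bound _ (by positivity) fun z => norm_phase_apply_le a b w z

/-- A function whose products with all `e^{c|w|}` are integrable. -/
def ExpIntegrable (G : Cn n → ℂ) : Prop :=
  AEStronglyMeasurable G volume ∧ ∀ c : ℝ, Integrable fun w => Real.exp (c * ‖w‖) * ‖G w‖

/-- Since `‖w‖ ≤ e^{‖w‖}`, raising `c` by one absorbs the factor. This stability is what allows
repeated differentiation under the integral. -/
lemma ExpIntegrable.mul {G : Cn n → ℂ} (hG : ExpIntegrable G) {p : Cn n → ℂ} (hp : Continuous p)
    (hb : ∀ w, ‖p w‖ ≤ ‖w‖) : ExpIntegrable (fun w => p w * G w) := by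
  refine ⟨hp.aestronglyMeasurable.mul hG.1, fun c => ?_⟩
  refine (hG.2 (c + 1)).mono' ((by fun_prop : Continuous fun w : Cn n =>
    Real.exp (c * ‖w‖)).aestronglyMeasurable.mul (hp.aestronglyMeasurable.mul hG.1).norm)
    (Filter.Eventually.of_forall fun w => ?_)
  rw [norm_mul, norm_norm, norm_mul, Real.norm_of_nonneg (Real.exp_pos _).le, ← mul_assoc, add_mul,
    one_mul, Real.exp_add]
  have := (hb w).trans ((by linarith : ‖w‖ ≤ ‖w‖ + 1).trans (Real.add_one_le_exp ‖w‖))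
  gcongr

lemma ExpIntegrable.coord_mul {G : Cn n → ℂ} (hG : ExpIntegrable G) (j : Fin n) :
    ExpIntegrable (fun w => w j * G w) :=
  hG.mul (continuous_apply j) fun w => norm_le_pi_norm w j

lemma ExpIntegrable.conj_coord_mul {G : Cn n → ℂ} (hG : ExpIntegrable G) (j : Fin n) :
    ExpIntegrable (fun w => (starRingEnd ℂ) (w j) * G w) :=
  hG.mul (Complex.continuous_conj.comp (continuous_apply j)) fun w => by
    rw [Complex.norm_conj]; exact norm_le_pi_norm w j

/-- The transform `G ↦ ∫ exp (∑ (a z_j w̄_j + b z̄_j w_j)) G(w) dw`. -/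
def expTransform (a b : ℂ) (G : Cn n → ℂ) (z : Cn n) : ℂ :=
  ∫ w, Complex.exp (phase a b w z) * G w

lemma norm_cexp_phase_le (a b : ℂ) (w z : Cn n) :
    ‖Complex.exp (phase a b w z)‖ ≤ Real.exp (n * (‖a‖ + ‖b‖) * ‖z‖ * ‖w‖) := by
  rw [Complex.norm_exp, Real.exp_le_exp]
  refine (Complex.re_le_norm _).trans ((norm_phase_apply_le a b w z).trans_eq ?_)
  ring

lemma continuous_cexp_phase (a b : ℂ) (z : Cn n) :
    Continuous fun w : Cn n => Complex.exp (phase a b w z) :=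
  Complex.continuous_exp.comp ((continuous_phase a b).clm_apply continuous_const)

lemma ExpIntegrable.integrable {G : Cn n → ℂ} (hG : ExpIntegrable G) (a b : ℂ) (z : Cn n) :
    Integrable fun w => Complex.exp (phase a b w z) * G w := by
  refine (hG.2 (n * (‖a‖ + ‖b‖) * ‖z‖)).mono'
    ((continuous_cexp_phase a b z).aestronglyMeasurable.mul hG.1)
    (Filter.Eventually.of_forall fun w => ?_)
  rw [norm_mul]
  exact mul_le_mul_of_nonneg_right (norm_cexp_phase_le a b w z) (norm_nonneg _)

lemma hasFDerivAt_expTransform (a b : ℂ) {G : Cn n → ℂ} (hG : ExpIntegrable G) (z : Cn n) :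
    HasFDerivAt (expTransform a b G)
      (∑ j, ((a * expTransform a b (fun w => (starRingEnd ℂ) (w j) * G w) z) • coordCLM j +
        (b * expTransform a b (fun w => w j * G w) z) • conjCoordCLM j)) z := by
  set K : ℝ := n * (‖a‖ + ‖b‖) with hK
  have hK0 : 0 ≤ K := by positivity
  have main : HasFDerivAt (expTransform a b G)
      (∫ w, (Complex.exp (phase a b w z) * G w) • phase a b w) z := by
    refine hasFDerivAt_integral_of_dominated_of_fderiv_le (μ := (volume : Measure (Cn n)))
      (F := fun z w => Complex.exp (phase a b w z) * G w)
      (F' := fun z w => (Complex.exp (phase a b w z) * G w) • phase a b w)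
      -- On the unit ball around `z` one has `‖x‖ ≤ ‖z‖ + 1`; the further `+ 1` in the exponent
      -- absorbs the factor `‖w‖` coming from the derivative of the phase.
      (bound := fun w => K * (Real.exp ((K * (‖z‖ + 1) + 1) * ‖w‖) * ‖G w‖))
      (Metric.ball_mem_nhds z one_pos)
      (Filter.Eventually.of_forall fun x => (hG.integrable a b x).1) (hG.integrable a b z)
      ((hG.integrable a b z).1.smul (continuous_phase a b).aestronglyMeasurable)
      (Filter.Eventually.of_forall fun w x hx => ?_) ((hG.2 _).const_mul K)
      (Filter.Eventually.of_forall fun w x _ => ?_)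
    · have hx' : ‖x‖ ≤ ‖z‖ + 1 := by
        have := norm_sub_norm_le x z
        rw [Metric.mem_ball, dist_eq_norm] at hx
        linarith
      rw [norm_smul, norm_mul]
      have h1 : ‖Complex.exp (phase a b w x)‖ ≤ Real.exp (K * (‖z‖ + 1) * ‖w‖) := by
        refine (norm_cexp_phase_le a b w x).trans (Real.exp_le_exp.2 ?_)
        gcongr
      have h2 : ‖phase a b w‖ ≤ K * Real.exp ‖w‖ := by
        refine (norm_phase_le a b w).trans (mul_le_mul_of_nonneg_left ?_ hK0)
        linarith [Real.add_one_le_exp ‖w‖]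
      calc _ ≤ Real.exp (K * (‖z‖ + 1) * ‖w‖) * ‖G w‖ * (K * Real.exp ‖w‖) := by gcongr
        _ = K * ((Real.exp (K * (‖z‖ + 1) * ‖w‖) * Real.exp ‖w‖) * ‖G w‖) := by ring
        _ = _ := by rw [← Real.exp_add]; congr 4; ring
    · have h := ((phase a b w).hasFDerivAt (x := x)).cexp.mul_const (G w)
      refine h.congr_fderiv ?_
      rw [smul_smul, mul_comm]
  convert main using 1
  have i1 : ∀ j, Integrable fun w => Complex.exp (phase a b w z) * ((starRingEnd ℂ) (w j) * G w) :=
    fun j => (hG.conj_coord_mul j).integrable a b z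
  have i2 : ∀ j, Integrable fun w => Complex.exp (phase a b w z) * (w j * G w) :=
    fun j => (hG.coord_mul j).integrable a b z
  have e : ∀ w, (Complex.exp (phase a b w z) * G w) • phase a b w =
      ∑ j, ((a * (Complex.exp (phase a b w z) * ((starRingEnd ℂ) (w j) * G w))) • coordCLM j +
        (b * (Complex.exp (phase a b w z) * (w j * G w))) • conjCoordCLM j) := by
    intro w
    have e0 : ∀ c : ℂ, c • phase a b w =
        ∑ j, (c • (a * (starRingEnd ℂ) (w j)) • coordCLM j + c • (b * w j) • conjCoordCLM j) :=
      fun c => by simp only [phase, Finset.smul_sum, smul_add]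
    rw [e0]
    refine Finset.sum_congr rfl fun j _ => ?_
    rw [smul_smul, smul_smul]
    congr 2 <;> ring
  simp only [e]
  rw [integral_finsetSum _ fun j _ => (((i1 j).const_mul a).smul_const _).add
    (((i2 j).const_mul b).smul_const _)]
  refine Finset.sum_congr rfl fun j _ => ?_
  rw [integral_add (((i1 j).const_mul a).smul_const _) (((i2 j).const_mul b).smul_const _),
    integral_smul_const, integral_smul_const, integral_const_mul, integral_const_mul]
  rfl

/-- The derivative is a combination of transforms of `w_j G` and `w̄_j G`, which are again
`ExpIntegrable`, so induction on the order applies. -/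
lemma contDiff_expTransform (a b : ℂ) {G : Cn n → ℂ} (hG : ExpIntegrable G) :
    ContDiff ℝ ∞ (expTransform a b G) := by
  rw [contDiff_infty]
  intro k
  induction k generalizing G with
  | zero =>
    exact contDiff_zero.2 (continuous_iff_continuousAt.2 fun z =>
      (hasFDerivAt_expTransform a b hG z).continuousAt)
  | succ k ih =>
    rw [Nat.cast_add, Nat.cast_one, contDiff_succ_iff_fderiv]
    refine ⟨fun z => (hasFDerivAt_expTransform a b hG z).differentiableAt, by simp, ?_⟩
    rw [funext fun z => (hasFDerivAt_expTransform a b hG z).fderiv]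
    exact ContDiff.sum fun j _ => ((contDiff_const.mul (ih (hG.conj_coord_mul j))).smul
      contDiff_const).add ((contDiff_const.mul (ih (hG.coord_mul j))).smul contDiff_const)

lemma dz_expTransform (a b : ℂ) {G : Cn n → ℂ} (hG : ExpIntegrable G) (j : Fin n) (z : Cn n) :
    dz j (expTransform a b G) z =
      a * expTransform a b (fun w => (starRingEnd ℂ) (w j) * G w) z := by
  simp only [dz, dx, dy, (hasFDerivAt_expTransform a b hG z).fderiv, sum_apply, add_apply,
    smul_apply, coordCLM_apply, conjCoordCLM_apply, smul_eq_mul]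
  rw [Finset.sum_eq_single j (fun k _ hk => by simp [Pi.single_eq_of_ne hk]) (by simp),
    Finset.sum_eq_single j (fun k _ hk => by simp [Pi.single_eq_of_ne hk]) (by simp)]
  simp only [Pi.single_eq_same, map_one, Complex.conj_I]
  linear_combination (1 / 2 : ℂ) * (b * expTransform a b (fun w => w j * G w) z -
    a * expTransform a b (fun w => (starRingEnd ℂ) (w j) * G w) z) * Complex.I_sq

lemma dzbar_expTransform (a b : ℂ) {G : Cn n → ℂ} (hG : ExpIntegrable G) (j : Fin n) (z : Cn n) :
    dzbar j (expTransform a b G) z = b * expTransform a b (fun w => w j * G w) z := by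
  simp only [dzbar, dx, dy, (hasFDerivAt_expTransform a b hG z).fderiv, sum_apply, add_apply,
    smul_apply, coordCLM_apply, conjCoordCLM_apply, smul_eq_mul]
  rw [Finset.sum_eq_single j (fun k _ hk => by simp [Pi.single_eq_of_ne hk]) (by simp),
    Finset.sum_eq_single j (fun k _ hk => by simp [Pi.single_eq_of_ne hk]) (by simp)]
  simp only [Pi.single_eq_same, map_one, Complex.conj_I]
  linear_combination (-1 / 2 : ℂ) * (b * expTransform a b (fun w => w j * G w) z -
    a * expTransform a b (fun w => (starRingEnd ℂ) (w j) * G w) z) * Complex.I_sq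

/-! ### The Mehler transform -/

lemma dz_phase (a b : ℂ) (w : Cn n) (j : Fin n) (z : Cn n) :
    dz j (phase a b w) z = a * (starRingEnd ℂ) (w j) := by
  simp only [dz, dx, dy, ContinuousLinearMap.fderiv, phase_apply]
  rw [Finset.sum_eq_single j (fun k _ hk => by simp [Pi.single_eq_of_ne hk]) (by simp),
    Finset.sum_eq_single j (fun k _ hk => by simp [Pi.single_eq_of_ne hk]) (by simp)]
  simp only [Pi.single_eq_same, map_one, Complex.conj_I]
  linear_combination (1 / 2 : ℂ) * (b * w j - a * (starRingEnd ℂ) (w j)) * Complex.I_sq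

lemma dzbar_phase (a b : ℂ) (w : Cn n) (j : Fin n) (z : Cn n) :
    dzbar j (phase a b w) z = b * w j := by
  simp only [dzbar, dx, dy, ContinuousLinearMap.fderiv, phase_apply]
  rw [Finset.sum_eq_single j (fun k _ hk => by simp [Pi.single_eq_of_ne hk]) (by simp),
    Finset.sum_eq_single j (fun k _ hk => by simp [Pi.single_eq_of_ne hk]) (by simp)]
  simp only [Pi.single_eq_same, map_one, Complex.conj_I]
  linear_combination (-1 / 2 : ℂ) * (b * w j - a * (starRingEnd ℂ) (w j)) * Complex.I_sq

/-- The kernel `exp (∑ (a z_j w̄_j + b z̄_j w_j) - d|w|²)` as a function of `w`. -/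
def gaussKernel (a b d : ℂ) (z : Cn n) : smoothSpace n :=
  ⟨fun w => Complex.exp (phase b a z w) * Complex.exp (-d * quad w),
    show ContDiff ℝ ∞ (fun w => Complex.exp (phase b a z w) * Complex.exp (-d * quad w)) from
      (phase b a z).contDiff.cexp.mul (contDiff_gaussian (-d))⟩

lemma gaussKernel_apply (a b d : ℂ) (z w : Cn n) : (gaussKernel a b d z).1 w =
    Complex.exp (phase a b w z) * Complex.exp (-d * quad w) := by
  rw [phase_swap]; rfl

lemma opDz_gaussKernel (a b d : ℂ) (z : Cn n) (j : Fin n) : opDz j (gaussKernel a b d z) =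
    (b * (starRingEnd ℂ) (z j)) • gaussKernel a b d z - d • opZbar j (gaussKernel a b d z) := by
  refine Subtype.ext (funext fun w => ?_)
  change dz j (fun w => Complex.exp (phase b a z w) * Complex.exp (-d * quad w)) w =
    b * (starRingEnd ℂ) (z j) * (Complex.exp (phase b a z w) * Complex.exp (-d * quad w)) -
    d * ((starRingEnd ℂ) (w j) * (Complex.exp (phase b a z w) * Complex.exp (-d * quad w)))
  rw [dz_mul_apply j (phase b a z).differentiableAt.cexp
    (differentiable_of_smooth (contDiff_gaussian (-d)) w), dz_gaussian,
    dz_cexp_apply j (phase b a z).differentiableAt, dz_phase]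
  ring

lemma opDzbar_gaussKernel (a b d : ℂ) (z : Cn n) (j : Fin n) : opDzbar j (gaussKernel a b d z) =
    (a * z j) • gaussKernel a b d z - d • opZ j (gaussKernel a b d z) := by
  refine Subtype.ext (funext fun w => ?_)
  change dzbar j (fun w => Complex.exp (phase b a z w) * Complex.exp (-d * quad w)) w =
    a * z j * (Complex.exp (phase b a z w) * Complex.exp (-d * quad w)) -
    d * (w j * (Complex.exp (phase b a z w) * Complex.exp (-d * quad w)))
  rw [dzbar_mul_apply j (phase b a z).differentiableAt.cexp
    (differentiable_of_smooth (contDiff_gaussian (-d)) w), dzbar_gaussian,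
    dzbar_cexp_apply j (phase b a z).differentiableAt, dzbar_phase]
  ring

lemma gaussBdd_gaussKernel (a b : ℂ) {d : ℂ} (hd : 0 < d.re) (z : Cn n) :
    GaussBdd (gaussKernel a b d z).1 := by
  obtain ⟨_, t, ht, C, h⟩ := gaussBdd_exp_norm_mul_gaussian (n := n) hd (n * (‖a‖ + ‖b‖) * ‖z‖)
  refine ⟨continuous_smoothSpace _, t, ht, C, fun w => le_trans ?_ (h w)⟩
  rw [gaussKernel_apply, norm_mul, norm_mul, Complex.norm_real,
    Real.norm_of_nonneg (Real.exp_pos _).le]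
  exact mul_le_mul_of_nonneg_right (norm_cexp_phase_le a b w z) (norm_nonneg _)

lemma integrable_gaussKernel_mul (a b : ℂ) {d : ℂ} (hd : 0 < d.re) (z : Cn n) {f : Cn n → ℂ}
    (hf : MemLp f 2 (volume : Measure (Cn n))) :
    Integrable fun w => (gaussKernel a b d z).1 w * f w :=
  (gaussBdd_gaussKernel a b hd z).memLp.integrable_mul hf

lemma expIntegrable_gaussian_mul {d : ℂ} (hd : 0 < d.re) {f : Cn n → ℂ}
    (hf : MemLp f 2 (volume : Measure (Cn n))) :
    ExpIntegrable (fun w => Complex.exp (-d * quad w) * f w) :=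
  ⟨(contDiff_gaussian (-d)).continuous.aestronglyMeasurable.mul hf.1,
    integrable_exp_norm_mul_gaussian hd hf⟩

/-- The integral operator with the kernel `exp (∑ (a z_j w̄_j + b z̄_j w_j) - d|w|²)`. -/
def gaussTransform (a b d : ℂ) (f : Cn n → ℂ) : Cn n → ℂ :=
  expTransform a b (fun w => Complex.exp (-d * quad w) * f w)

lemma gaussTransform_eq (a b d : ℂ) (f : Cn n → ℂ) (z : Cn n) :
    gaussTransform a b d f z = ∫ w, (gaussKernel a b d z).1 w * f w := by
  simp only [gaussTransform, expTransform, gaussKernel_apply, mul_assoc]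

section

variable (a b : ℂ) {d g : ℂ} (hd : 0 < d.re) (hg : 0 < g.re) {f : smoothSpace n}

include hd hg

lemma dz_gaussTransform (hf : IsPolyGauss g f) (j : Fin n) (z : Cn n) :
    dz j (gaussTransform a b d f.1) z = a * gaussTransform a b d (opZbar j f).1 z := by
  refine (dz_expTransform a b (expIntegrable_gaussian_mul hd (hf.gaussBdd hg).memLp) j z).trans ?_
  simp only [gaussTransform, opZbar_apply, mul_left_comm]

lemma dzbar_gaussTransform (hf : IsPolyGauss g f) (j : Fin n) (z : Cn n) :
    dzbar j (gaussTransform a b d f.1) z = b * gaussTransform a b d (opZ j f).1 z := by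
  refine (dzbar_expTransform a b (expIntegrable_gaussian_mul hd (hf.gaussBdd hg).memLp) j z).trans ?_
  simp only [gaussTransform, opZ_apply, mul_left_comm]

lemma gaussTransform_add {h : smoothSpace n} (hf : IsPolyGauss g f) (hh : IsPolyGauss g h)
    (z : Cn n) : gaussTransform a b d (f + h).1 z =
      gaussTransform a b d f.1 z + gaussTransform a b d h.1 z := by
  simp only [gaussTransform_eq]
  rw [← integral_add (integrable_gaussKernel_mul a b hd z (hf.gaussBdd hg).memLp)
    (integrable_gaussKernel_mul a b hd z (hh.gaussBdd hg).memLp)]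
  exact integral_congr_ae (Filter.Eventually.of_forall fun w => mul_add _ _ _)

omit hd hg in
lemma gaussTransform_smul (c : ℂ) (f : smoothSpace n) (z : Cn n) :
    gaussTransform a b d (c • f).1 z = c * gaussTransform a b d f.1 z := by
  simp only [gaussTransform_eq]
  rw [← integral_const_mul]
  exact integral_congr_ae (Filter.Eventually.of_forall fun w => mul_left_comm _ _ _)

/-- The derivative is moved onto the kernel. Together with `dz_gaussTransform` and
`dzbar_gaussTransform` this expresses the transforms of derivatives of `f` through the transform of
`f` and its own derivatives. -/
lemma integral_wirtinger_gaussKernel_mul (hf : IsPolyGauss g f) (j : Fin n) (z : Cn n) :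
    gaussTransform a b d (opDz j f).1 z = -(b * (starRingEnd ℂ) (z j)) * gaussTransform a b d f.1 z
        + d * gaussTransform a b d (opZbar j f).1 z ∧
      gaussTransform a b d (opDzbar j f).1 z = -(a * z j) * gaussTransform a b d f.1 z
        + d * gaussTransform a b d (opZ j f).1 z := by
  have hint : ∀ h : smoothSpace n, IsPolyGauss g h →
      Integrable fun w => (gaussKernel a b d z).1 w * h.1 w := fun h hh =>
    integrable_gaussKernel_mul a b hd z (hh.gaussBdd hg).memLp
  have e1 : ∀ w, dz j (gaussKernel a b d z).1 w * f.1 w =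
      b * (starRingEnd ℂ) (z j) * ((gaussKernel a b d z).1 w * f.1 w) -
        d * ((gaussKernel a b d z).1 w * (opZbar j f).1 w) := fun w => by
    rw [← opDz_apply, opDz_gaussKernel]
    change (b * (starRingEnd ℂ) (z j) * (gaussKernel a b d z).1 w -
      d * ((starRingEnd ℂ) (w j) * (gaussKernel a b d z).1 w)) * f.1 w = _
    rw [opZbar_apply]
    ring
  have e2 : ∀ w, dzbar j (gaussKernel a b d z).1 w * f.1 w =
      a * z j * ((gaussKernel a b d z).1 w * f.1 w) -
        d * ((gaussKernel a b d z).1 w * (opZ j f).1 w) := fun w => by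
    rw [← opDzbar_apply, opDzbar_gaussKernel]
    change (a * z j * (gaussKernel a b d z).1 w -
      d * (w j * (gaussKernel a b d z).1 w)) * f.1 w = _
    rw [opZ_apply]
    ring
  have i0 := hint f hf
  have i1 : Integrable fun w => dz j (gaussKernel a b d z).1 w * f.1 w := by
    simp only [e1]
    exact (i0.const_mul _).sub ((hint _ (hf.opZbar j)).const_mul _)
  have i2 : Integrable fun w => dzbar j (gaussKernel a b d z).1 w * f.1 w := by
    simp only [e2]
    exact (i0.const_mul _).sub ((hint _ (hf.opZ j)).const_mul _)
  obtain ⟨h1, h2⟩ := integral_wirtinger_mul j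
    (differentiableAt_of_mem_smoothSpace (gaussKernel a b d z))
    (differentiableAt_of_mem_smoothSpace f) i0 i1 i2 (hint _ (hf.opDz j)) (hint _ (hf.opDzbar j))
  simp only [e1] at h1
  simp only [e2] at h2
  rw [integral_sub (i0.const_mul _) ((hint _ (hf.opZbar j)).const_mul _), integral_const_mul,
    integral_const_mul] at h1
  rw [integral_sub (i0.const_mul _) ((hint _ (hf.opZ j)).const_mul _), integral_const_mul,
    integral_const_mul] at h2
  simp only [gaussTransform_eq, opDz_apply, opDzbar_apply]
  exact ⟨by linear_combination h1, by linear_combination h2⟩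

end

/-- The integral operator of the Mehler kernel at the parameter `1/2`, up to a Gaussian factor. -/
def mehler (g : ℂ) (f : Cn n → ℂ) : Cn n → ℂ :=
  gaussTransform (2 * (g + (starRingEnd ℂ) g)) (g + (starRingEnd ℂ) g)
    (2 * (starRingEnd ℂ) g + g) f

section

variable {g : ℂ} (hg : 0 < g.re)

include hg

lemma mehler_re_pos : 0 < (2 * (starRingEnd ℂ) g + g).re := by
  simp only [Complex.add_re, Complex.mul_re, Complex.re_ofNat, Complex.conj_re, Complex.im_ofNat,
    zero_mul, sub_zero]
  linarith

lemma add_conj_ne_zero : g + (starRingEnd ℂ) g ≠ 0 := by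
  rw [Complex.add_conj]
  exact_mod_cast (by positivity : (2 * g.re) ≠ 0)

lemma contDiff_mehler {F : Cn n → ℂ} (hF : MemLp F 2 (volume : Measure (Cn n))) :
    ContDiff ℝ ∞ (mehler g F) :=
  contDiff_expTransform _ _ (expIntegrable_gaussian_mul (mehler_re_pos hg) hF)

/-- Write `m = g + ḡ`. Integration by parts against the ground state, with `d + g = 2m`, shows that
both the transform and `e^{m|z|²}` solve `∂u/∂z_j = m z̄_j u`, `∂u/∂z̄_j = m z_j u`; hence they are
proportional. -/
lemma mehler_ground (z : Cn n) : mehler g (ground n g).1 z =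
    mehler g (ground n g).1 0 * Complex.exp ((g + (starRingEnd ℂ) g) * quad z) := by
  set m := g + (starRingEnd ℂ) g with hm
  have hm0 : m ≠ 0 := add_conj_ne_zero hg
  have hd := mehler_re_pos hg
  have hgr : IsPolyGauss g (ground n g) := .ground
  have hsm : ContDiff ℝ ∞ (mehler g (ground n g).1) := contDiff_mehler hg (hgr.gaussBdd hg).memLp
  have h1 : ∀ j z, dz j (mehler g (ground n g).1) z =
      m * (starRingEnd ℂ) (z j) * mehler g (ground n g).1 z := by
    intro j z
    have e := (integral_wirtinger_gaussKernel_mul (2 * m) m hd hg hgr j z).1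
    rw [IsPolyGauss.opDz_ground, gaussTransform_smul] at e
    refine (dz_gaussTransform (2 * m) m hd hg hgr j z).trans ?_
    change _ = m * (starRingEnd ℂ) (z j) * gaussTransform (2 * m) m _ (ground n g).1 z
    rw [hm] at e ⊢
    linear_combination -e
  have h2 : ∀ j z, dzbar j (mehler g (ground n g).1) z =
      m * z j * mehler g (ground n g).1 z := by
    intro j z
    have e := (integral_wirtinger_gaussKernel_mul (2 * m) m hd hg hgr j z).2
    rw [IsPolyGauss.opDzbar_ground, gaussTransform_smul] at e
    refine (dzbar_gaussTransform (2 * m) m hd hg hgr j z).trans ?_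
    change _ = m * z j * gaussTransform (2 * m) m _ (ground n g).1 z
    rw [hm] at e ⊢
    linear_combination (-1 / 2 : ℂ) * e
  have hgd : ∀ z : Cn n, DifferentiableAt ℝ (fun z : Cn n => Complex.exp (-m * quad z)) z :=
    fun z => differentiable_of_smooth (contDiff_gaussian (-m)) z
  have hmd := differentiable_of_smooth hsm
  have key := eq_of_dz_dzbar_eq_zero
    (f := fun z => Complex.exp (-m * quad z) * mehler g (ground n g).1 z)
    (fun z => (hgd z).mul (hmd z))
    (fun j z => by
      rw [dz_mul_apply j (hgd z) (hmd z), dz_gaussian, h1]; ring)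
    (fun j z => by
      rw [dzbar_mul_apply j (hgd z) (hmd z), dzbar_gaussian, h2]; ring) z 0
  have hq0 : quad (0 : Cn n) = 0 := by simp [quad]
  simp only [hq0, mul_zero, Complex.exp_zero, one_mul] at key
  rw [← key, mul_comm, ← mul_assoc, ← Complex.exp_add]
  have : m * quad z + -m * quad z = 0 := by ring
  rw [this, Complex.exp_zero, one_mul]

/-- At `z = 0` the exponents add up to `-2(g + ḡ)|w|² = -4 Re g |w|²`, which is real, so the
integrand is positive. -/
lemma mehler_ground_zero_ne_zero : mehler g (ground n g).1 0 ≠ 0 := by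
  have e : mehler g (ground n g).1 0 =
      ((∫ w : Cn n, Real.exp (-(4 * g.re) * nsq w) : ℝ) : ℂ) := by
    rw [mehler, gaussTransform_eq, ← integral_complex_ofReal]
    refine integral_congr_ae (Filter.Eventually.of_forall fun w => ?_)
    simp only [gaussKernel_apply, map_zero, Complex.exp_zero, one_mul, ground_apply]
    rw [← Complex.exp_add, quad_eq_nsq, Complex.ofReal_exp]
    congr 1
    have := Complex.add_conj g
    push_cast at this ⊢
    linear_combination (-2 * (nsq w : ℂ)) * this
  rw [e]
  have hi := integrable_exp_neg_nsq (n := n) (t := 4 * g.re) (by linarith)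
  exact_mod_cast (integral_exp_pos hi).ne'

/-- The Mehler transform acts on the Landau levels as a scalar times a Gaussian factor. -/
lemma mehler_landau {l : ℕ} {f : smoothSpace n} (hf : IsLandau g l f) (z : Cn n) :
    mehler g f.1 z = mehler g (ground n g).1 0 * (1 / 2) ^ l *
      (Complex.exp ((2 * g + (starRingEnd ℂ) g) * quad z) * f.1 z) := by
  have hd := mehler_re_pos hg
  set C := mehler g (ground n g).1 0
  set p := 2 * g + (starRingEnd ℂ) g with hp
  have hgd : ∀ z : Cn n, DifferentiableAt ℝ (fun z : Cn n => Complex.exp (p * quad z)) z :=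
    fun z => differentiable_of_smooth (contDiff_gaussian p) z
  have hder : ∀ (l : ℕ) (f : smoothSpace n), (∀ z, mehler g f.1 z = C * (1 / 2) ^ l *
      (Complex.exp (p * quad z) * f.1 z)) → ∀ j z,
      dz j (mehler g f.1) z = C * (1 / 2) ^ l * (Complex.exp (p * quad z) *
        (p * (starRingEnd ℂ) (z j) * f.1 z + dz j f.1 z)) ∧
      dzbar j (mehler g f.1) z = C * (1 / 2) ^ l * (Complex.exp (p * quad z) *
        (p * z j * f.1 z + dzbar j f.1 z)) := by
    intro l f h j z
    have hfd := differentiableAt_of_mem_smoothSpace f z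
    have hprod : DifferentiableAt ℝ (fun w => Complex.exp (p * quad w) * f.1 w) z :=
      (hgd z).mul hfd
    rw [funext h]
    constructor
    · rw [dz_const_mul_apply j _ hprod, dz_mul_apply j (hgd z) hfd, dz_gaussian]
      ring
    · rw [dzbar_const_mul_apply j _ hprod, dzbar_mul_apply j (hgd z) hfd,
        dzbar_gaussian]
      ring
  induction hf generalizing z with
  | ground =>
    rw [mehler_ground hg, pow_zero, mul_one, ground_apply, ← Complex.exp_add]
    congr 2
    rw [hp]
    ring
  | zero l =>
    have := gaussTransform_smul (2 * (g + (starRingEnd ℂ) g)) (g + (starRingEnd ℂ) g)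
      (d := 2 * (starRingEnd ℂ) g + g) 0 (0 : smoothSpace n) z
    rw [zero_smul, zero_mul] at this
    refine this.trans ?_
    change 0 = _ * (_ * 0)
    ring
  | @add l f h hf hh h1 h2 =>
    refine (gaussTransform_add _ _ hd hg hf.isPolyGauss hh.isPolyGauss z).trans ?_
    have e1 := h1 z
    have e2 := h2 z
    simp only [mehler] at e1 e2
    rw [e1, e2]
    change _ = _ * (_ * (f.1 z + h.1 z))
    ring
  | @smul l c f hf h1 =>
    refine (gaussTransform_smul _ _ c f z).trans ?_
    have e1 := h1 z
    simp only [mehler] at e1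
    rw [e1]
    change _ = _ * (_ * (c * f.1 z))
    ring
  -- With `T` the transform and `m = g + ḡ`, one finds `T(A_j^* f) = m z̄_j Tf - ½ ∂Tf/∂z_j`. On `Tf
  -- = c e^{p|z|²} f` this is `½ c e^{p|z|²} A_j^* f`, because `2m - p = ḡ`; here the factor `1/2`
  -- per level arises.
  | @creatA l j f hf h1 =>
    have hP := hf.isPolyGauss
    have e1 := (hder l f h1 j z).1
    have e2 := (integral_wirtinger_gaussKernel_mul (2 * (g + (starRingEnd ℂ) g))
      (g + (starRingEnd ℂ) g) hd hg hP j z).1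
    have e3 := dz_gaussTransform (2 * (g + (starRingEnd ℂ) g)) (g + (starRingEnd ℂ) g) hd hg hP j z
    have e4 := gaussTransform_add (2 * (g + (starRingEnd ℂ) g)) (g + (starRingEnd ℂ) g) hd hg
      (hP.opDz j).neg ((hP.opZbar j).smul ((starRingEnd ℂ) g)) z
    have e5 := gaussTransform_smul (2 * (g + (starRingEnd ℂ) g)) (g + (starRingEnd ℂ) g)
      (d := 2 * (starRingEnd ℂ) g + g) (-1) (opDz j f) z
    have e6 := gaussTransform_smul (2 * (g + (starRingEnd ℂ) g)) (g + (starRingEnd ℂ) g)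
      (d := 2 * (starRingEnd ℂ) g + g) ((starRingEnd ℂ) g) (opZbar j f) z
    have hneg : (-1 : ℂ) • opDz j f = -opDz j f := by module
    rw [hneg] at e5
    have e7 := h1 z
    rw [creatA_apply]
    change _ = C * (1 / 2) ^ (l + 1) * (Complex.exp (p * quad z) *
      (-dz j f.1 z + (starRingEnd ℂ) g * ((starRingEnd ℂ) (z j) * f.1 z)))
    simp only [mehler] at e1 e7 ⊢
    rw [e4, e5, e6, e2]
    rw [e3] at e1
    rw [e7]
    rw [hp] at e1 ⊢
    rw [pow_succ]
    linear_combination (-1 / 2 : ℂ) * e1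
  -- Here `T(B_j^* f) = 2m z_j Tf - ∂Tf/∂z̄_j`, and `2m - p = ḡ` now gives `c e^{p|z|²} B_j^* f`,
  -- with no extra factor.
  | @creatB l j f hf h1 =>
    have hP := hf.isPolyGauss
    have e1 := (hder l f h1 j z).2
    have e2 := (integral_wirtinger_gaussKernel_mul (2 * (g + (starRingEnd ℂ) g))
      (g + (starRingEnd ℂ) g) hd hg hP j z).2
    have e3 := dzbar_gaussTransform (2 * (g + (starRingEnd ℂ) g)) (g + (starRingEnd ℂ) g) hd hg
      hP j z
    have e4 := gaussTransform_add (2 * (g + (starRingEnd ℂ) g)) (g + (starRingEnd ℂ) g) hd hg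
      (hP.opDzbar j).neg ((hP.opZ j).smul ((starRingEnd ℂ) g)) z
    have e5 := gaussTransform_smul (2 * (g + (starRingEnd ℂ) g)) (g + (starRingEnd ℂ) g)
      (d := 2 * (starRingEnd ℂ) g + g) (-1) (opDzbar j f) z
    have e6 := gaussTransform_smul (2 * (g + (starRingEnd ℂ) g)) (g + (starRingEnd ℂ) g)
      (d := 2 * (starRingEnd ℂ) g + g) ((starRingEnd ℂ) g) (opZ j f) z
    have hneg : (-1 : ℂ) • opDzbar j f = -opDzbar j f := by module
    rw [hneg] at e5
    have e7 := h1 z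
    rw [creatB_apply]
    change _ = C * (1 / 2) ^ l * (Complex.exp (p * quad z) *
      (-dzbar j f.1 z + (starRingEnd ℂ) g * (z j * f.1 z)))
    simp only [mehler] at e1 e7 ⊢
    rw [e4, e5, e6, e2]
    rw [e3] at e1
    rw [e7]
    rw [hp] at e1 ⊢
    linear_combination -e1

end

/-! ### Closures of the Landau levels -/

/-- The classes in `L²` of the functions in the span of the eigenfunctions of level `l`. -/
def landauL2 (n : ℕ) (g : ℂ) (l : ℕ) : Submodule ℂ (L2 n) where
  carrier := {F | ∃ f : smoothSpace n, IsLandau g l f ∧ F =ᵐ[volume] f.1}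
  zero_mem' := ⟨0, .zero l, Lp.coeFn_zero _ _ _⟩
  add_mem' := by
    rintro F G ⟨f, hf, hF⟩ ⟨h, hh, hG⟩
    exact ⟨f + h, hf.add hh, (Lp.coeFn_add F G).trans (hF.add hG)⟩
  smul_mem' := by
    rintro c F ⟨f, hf, hF⟩
    exact ⟨c • f, hf.smul c, (Lp.coeFn_smul c F).trans (hF.const_smul c)⟩

lemma mehler_congr (g : ℂ) {f h : Cn n → ℂ} (hfh : f =ᵐ[volume] h) : mehler g f = mehler g h := by
  funext z
  simp only [mehler, gaussTransform_eq]
  refine integral_congr_ae ?_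
  filter_upwards [hfh] with w hw
  rw [hw]

/-- For fixed `z` the transform is the inner product with a Gaussian kernel in `L²`, a continuous
functional. -/
lemma tendsto_mehler {g : ℂ} (hg : 0 < g.re) {F : ℕ → L2 n} {G : L2 n}
    (h : Filter.Tendsto F Filter.atTop (nhds G)) (z : Cn n) :
    Filter.Tendsto (fun k => mehler g (F k) z) Filter.atTop (nhds (mehler g G z)) := by
  set K := gaussKernel (2 * (g + (starRingEnd ℂ) g)) (g + (starRingEnd ℂ) g)
    (2 * (starRingEnd ℂ) g + g) z with hK
  have hKm : MemLp (opConj K).1 2 (volume : Measure (Cn n)) :=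
    (gaussBdd_gaussKernel _ _ (mehler_re_pos hg) z).memLp.star
  have e : ∀ G : L2 n, mehler g G z = inner ℂ (hKm.toLp _) G := fun G => by
    rw [inner_L2_eq hKm.coeFn_toLp (Filter.EventuallyEq.refl _ _), mehler, gaussTransform_eq]
    refine integral_congr_ae (Filter.Eventually.of_forall fun w => ?_)
    change K.1 w * G w = (starRingEnd ℂ) ((starRingEnd ℂ) (K.1 w)) * G w
    rw [Complex.conj_conj]
  simp only [e]
  exact tendsto_const_nhds.inner h

/-- The elements of the closure of a Landau level have smooth representatives. -/
lemma exists_smooth_of_mem_closure_landauL2 {g : ℂ} (hg : 0 < g.re) {l : ℕ} {F : L2 n}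
    (hF : F ∈ (landauL2 n g l).topologicalClosure) :
    ∃ f : smoothSpace n, F =ᵐ[volume] f.1 := by
  obtain ⟨u, hu, hlim⟩ := mem_closure_iff_seq_limit.1 hF
  choose f hf huf using hu
  set C := mehler g (ground n g).1 0 * (1 / 2) ^ l with hC
  have hC0 : C ≠ 0 := mul_ne_zero (mehler_ground_zero_ne_zero hg)
    (pow_ne_zero _ (by norm_num))
  set p := 2 * g + (starRingEnd ℂ) g with hp
  -- On level `l` the transform is inverted by an explicit formula whose right-hand side is smooth
  -- and converges pointwise when `u k` converges in `L²`.
  have hfz : ∀ k z, (f k).1 z = C⁻¹ * (Complex.exp (-p * quad z) * mehler g (u k) z) := by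
    intro k z
    rw [mehler_congr g (huf k), mehler_landau hg (hf k)]
    have : Complex.exp (-p * quad z) * Complex.exp (p * quad z) = 1 := by
      rw [← Complex.exp_add]; simp
    rw [eq_inv_mul_iff_mul_eq₀ hC0]
    linear_combination (-C * (f k).1 z) * this
  refine ⟨⟨fun z => C⁻¹ * (Complex.exp (-p * quad z) * mehler g F z),
    show ContDiff ℝ ∞ (fun z => C⁻¹ * (Complex.exp (-p * quad z) * mehler g F z)) from
      contDiff_const.mul ((contDiff_gaussian (-p)).mul (contDiff_mehler hg (Lp.memLp F)))⟩, ?_⟩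
  -- An almost everywhere convergent subsequence identifies the pointwise limit of this formula with
  -- `F`.
  obtain ⟨ns, hns, hae⟩ := (tendstoInMeasure_of_tendsto_Lp hlim).exists_seq_tendsto_ae
  filter_upwards [hae, ae_all_iff.2 huf] with z h1 h2
  refine tendsto_nhds_unique h1 ?_
  simp only [h2, hfz]
  exact (((tendsto_mehler hg hlim z).comp hns.tendsto_atTop).const_mul _).const_mul _

/-- A smooth function that satisfies the eigenvalue equation weakly satisfies it pointwise. -/
lemma magLaplacian_eq_of_weak (ν μ : ℝ) {κ : ℂ} {F : L2 n} {f : smoothSpace n}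
    (hF : F =ᵐ[volume] f.1)
    (h : ∀ φ, inner ℂ (testToL2 n (testLaplacian n ν μ φ)) F = κ * inner ℂ (testToL2 n φ) F)
    (z : Cn n) : magLaplacian ν μ f.1 z = κ * f.1 z := by
  have hL : ContDiff ℝ ∞ (magLaplacian ν μ f.1) := contDiff_magLaplacian ν μ f.2
  have hcont : Continuous fun z => magLaplacian ν μ f.1 z - κ * f.1 z :=
    hL.continuous.sub (continuous_const.mul (continuous_smoothSpace f))
  have hae := ae_eq_zero_of_integral_contDiff_smul_eq_zero (μ := (volume : Measure (Cn n)))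
    hcont.locallyIntegrable (fun u hu huc => ?_)
  · have := (Continuous.ae_eq_iff_eq volume hcont continuous_const).1 hae
    exact sub_eq_zero.1 (congrFun this z)
  · let φ : testSpace n := ⟨fun z => (u z : ℂ), Complex.ofRealCLM.contDiff.comp hu,
      huc.comp_left Complex.ofReal_zero⟩
    have h1 := h φ
    rw [inner_L2_eq (testToL2_ae _) hF, inner_L2_eq (testToL2_ae _) hF] at h1
    have h2 := integral_magLaplacian_conj_mul ν μ ⟨φ.1, φ.2.1⟩ f φ.2.2
    have h3 := h2.symm.trans h1
    have hφ : Continuous fun z => (starRingEnd ℂ) (φ.1 z) :=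
      Complex.continuous_conj.comp φ.2.1.continuous
    have hφc : HasCompactSupport fun z => (starRingEnd ℂ) (φ.1 z) :=
      φ.2.2.comp_left (map_zero (starRingEnd ℂ))
    have i1 := integrable_mul_of_hasCompactSupport hφ hL.continuous (Or.inl hφc)
    have i2 := integrable_mul_of_hasCompactSupport hφ (continuous_smoothSpace f) (Or.inl hφc)
    have e : ∀ z, u z • (magLaplacian ν μ f.1 z - κ * f.1 z) =
        (starRingEnd ℂ) (φ.1 z) * magLaplacian ν μ f.1 z -
          κ * ((starRingEnd ℂ) (φ.1 z) * f.1 z) := fun z => by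
      change u z • _ = (starRingEnd ℂ) (u z : ℂ) * _ - κ * ((starRingEnd ℂ) (u z : ℂ) * f.1 z)
      rw [Complex.conj_ofReal, Complex.real_smul]
      ring
    simp only [e]
    rw [integral_sub i1 (i2.const_mul κ), integral_const_mul, sub_eq_zero]
    exact h3

/-! ### Operators that are diagonal with respect to an orthogonal decomposition -/

/-- A closed operator which acts as the scalar `κ l` on the members of a complete orthogonal family
and which is symmetric with respect to these has `c` in its resolvent set as soon as `c` keeps a
positive distance from the scalars. -/
lemma mem_resolventSet_of_isHilbertSum {H : Type*} [NormedAddCommGroup H] [InnerProductSpace ℂ H]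
    [CompleteSpace H] {T : H →ₗ.[ℂ] H} (hT : IsClosed (T.graph : Set (H × H)))
    {W : ℕ → Submodule ℂ H} (hW : IsHilbertSum ℂ (fun l => W l) fun l => (W l).subtypeₗᵢ)
    {κ : ℕ → ℂ} (h1 : ∀ l, ∀ x ∈ W l, (x, κ l • x) ∈ T.graph)
    (h2 : ∀ l, ∀ s ∈ W l, ∀ p ∈ T.graph, inner ℂ s p.2 = κ l * inner ℂ s p.1)
    {c : ℂ} {d : ℝ} (hd : 0 < d) (hc : ∀ l, d ≤ ‖κ l - c‖) : c ∈ resolventSet T := by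
  have hne : ∀ l, κ l - c ≠ 0 := fun l => norm_pos_iff.1 (hd.trans_le (hc l))
  let V := hW.linearIsometryEquiv
  -- The candidate resolvent multiplies the component in `W l` by `(κ l - c)⁻¹`; the distance `d`
  -- bounds its norm by `d⁻¹`.
  let D : lp (fun l => W l) 2 →L[ℂ] lp (fun l => W l) 2 :=
    lp.mapCLM 2 (fun l => (κ l - c)⁻¹ • ContinuousLinearMap.id ℂ (W l)) (K := d⁻¹)
      (by positivity) fun l => by
        refine (norm_smul_le _ _).trans ?_
        rw [norm_inv]
        calc ‖κ l - c‖⁻¹ * ‖ContinuousLinearMap.id ℂ (W l)‖ ≤ ‖κ l - c‖⁻¹ * 1 := by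
              gcongr; exact ContinuousLinearMap.norm_id_le
          _ ≤ d⁻¹ := by rw [mul_one]; exact inv_anti₀ hd (hc l)
  let R : H →L[ℂ] H := (V.symm.toContinuousLinearEquiv : _ →L[ℂ] H) ∘L D ∘L
    (V.toContinuousLinearEquiv : H →L[ℂ] _)
  have hR : ∀ l, ∀ x ∈ W l, R x = (κ l - c)⁻¹ • x := by
    intro l x hx
    change V.symm (D (V x)) = _
    have e : V x = lp.single 2 l (⟨x, hx⟩ : W l) := by
      rw [← V.symm.injective.eq_iff, V.symm_apply_apply]
      exact (hW.linearIsometryEquiv_symm_apply_single (⟨x, hx⟩ : W l)).symm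
    have e2 : D (V x) = (κ l - c)⁻¹ • V x := by
      rw [e]
      ext m
      by_cases hm : m = l
      · subst hm; simp [D]
      · simp [D, lp.single_apply, Pi.single_eq_of_ne hm]
    rw [e2, map_smul, V.symm_apply_apply]
  have hdense : (⨆ l, W l).topologicalClosure = ⊤ := by
    rw [eq_top_iff]
    intro x _
    have := hW.hasSum_linearIsometryEquiv_symm (V x)
    rw [V.symm_apply_apply] at this
    exact mem_closure_of_tendsto this (Filter.Eventually.of_forall fun s =>
      Submodule.sum_mem _ fun l _ => Submodule.mem_iSup_of_mem l (V x l).2)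
  -- This says `(T - c) R y = y`. It holds on each `W l`, hence on their dense span, and extends to
  -- all `y` since the graph is closed.
  have hgr : ∀ y, (R y, y + c • R y) ∈ T.graph := by
    let L : H →L[ℂ] H × H := R.prod (ContinuousLinearMap.id ℂ H + c • R)
    have hcl : IsClosed ((T.graph.comap L.toLinearMap : Submodule ℂ H) : Set H) :=
      hT.preimage L.continuous
    have hle : (⨆ l, W l) ≤ T.graph.comap L.toLinearMap := by
      refine iSup_le fun l x hx => ?_
      change (R x, x + c • R x) ∈ T.graph
      have : (R x, x + c • R x) = (κ l - c)⁻¹ • (x, κ l • x) := by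
        rw [hR l x hx, Prod.smul_mk, Prod.mk.injEq]
        refine ⟨rfl, ?_⟩
        have h3 : x = ((κ l - c)⁻¹ * (κ l - c)) • x := by rw [inv_mul_cancel₀ (hne l), one_smul]
        nth_rewrite 1 [h3]
        module
      rw [this]
      exact Submodule.smul_mem _ _ (h1 l x hx)
    intro y
    have := Submodule.topologicalClosure_minimal _ hle hcl
    rw [hdense] at this
    exact this (Submodule.mem_top (x := y))
  refine ⟨R, fun x => ?_, fun y => ?_⟩
  · have hz := Submodule.sub_mem _ (hgr (T x - c • (x : H))) (T.mem_graph x)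
    -- This defect is a solution of `T z = c z`; pairing it with each `W l` and using `κ l ≠ c`
    -- makes it orthogonal to a dense subspace.
    set z := R (T x - c • (x : H)) - x with hz'
    have hz2 : (z, c • z) ∈ T.graph := by
      convert hz using 1
      rw [Prod.mk_sub_mk, Prod.mk.injEq]
      exact ⟨rfl, by rw [hz']; module⟩
    have horth : ∀ l, ∀ s ∈ W l, inner ℂ s z = 0 := by
      intro l s hs
      have := h2 l s hs _ hz2
      simp only [inner_smul_right] at this
      have h3 : (κ l - c) * inner ℂ s z = 0 := by linear_combination -this
      exact (mul_eq_zero.1 h3).resolve_left (hne l)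
    have : z ∈ (⨆ l, W l)ᗮ := by
      rw [← Submodule.iInf_orthogonal, Submodule.mem_iInf]
      exact fun l => (Submodule.mem_orthogonal _ _).2 (horth l)
    rw [← Submodule.orthogonal_closure, hdense, Submodule.top_orthogonal_eq_bot,
      Submodule.mem_bot] at this
    exact sub_eq_zero.1 this
  · obtain ⟨x, hx, hx2⟩ := (LinearPMap.mem_graph_iff _).1 (hgr y)
    refine ⟨x, hx, ?_⟩
    rw [hx2, hx]
    simp

/-! ### Weak solutions of the eigenvalue equation -/

/-- The classes `F` in `L²` with `Δ_{ν,μ} F = κ F` in the sense of distributions. -/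
def weakEigenspace (n : ℕ) (ν μ : ℝ) (κ : ℂ) : Submodule ℂ (L2 n) where
  carrier := {F | ∀ φ, inner ℂ (testToL2 n (testLaplacian n ν μ φ)) F =
    κ * inner ℂ (testToL2 n φ) F}
  zero_mem' φ := by simp only [inner_zero_right, mul_zero]
  add_mem' hF hG φ := by
    simp only [inner_add_right]
    rw [hF φ, hG φ]
    ring
  smul_mem' c F hF φ := by
    simp only [inner_smul_right]
    rw [hF φ]
    ring

lemma mem_weakEigenspace_of_mem_graph (ν μ : ℝ) {κ : ℂ} {F : L2 n}
    (hF : (F, κ • F) ∈ (magOperator n ν μ).graph) : F ∈ weakEigenspace n ν μ κ := by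
  intro φ
  have h := inner_magOperator_graph ν μ (p := (testToL2 n φ, testToL2 n (testLaplacian n ν μ φ)))
    ((mem_magOperator_graph_iff ν μ).2
      (Submodule.le_topologicalClosure _ (mem_minimalOperator_graph ν μ φ))) hF
  rw [h, inner_smul_right]

lemma L2Eigenspace_le_weakEigenspace (n : ℕ) (ν μ : ℝ) (lam : ℂ) :
    L2Eigenspace n ν μ lam ≤ weakEigenspace n ν μ (eigval n μ lam) := by
  rintro F ⟨f, ⟨hf, hf'⟩, hF⟩ φ
  rw [inner_L2_eq (testToL2_ae _) hF, inner_L2_eq (testToL2_ae _) hF, ← integral_const_mul]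
  refine (integral_magLaplacian_conj_mul ν μ ⟨φ.1, φ.2.1⟩ ⟨f, hf⟩ φ.2.2).trans
    (integral_congr_ae (Filter.Eventually.of_forall fun z => ?_))
  simp only [hf' z]
  ring

lemma conj_eigval_natCast (n : ℕ) (μ : ℝ) (l : ℕ) :
    (starRingEnd ℂ) (eigval n μ l) = eigval n μ l := by
  simp [eigval, Complex.conj_ofNat]

lemma eigval_injective (n : ℕ) {μ : ℝ} (hμ : 0 < μ) : Function.Injective (eigval n μ) := by
  intro a b h
  have h0 : (μ : ℂ) ≠ 0 := by exact_mod_cast hμ.ne'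
  simp only [eigval] at h
  have h1 : (-2 * (μ : ℂ)) ≠ 0 := mul_ne_zero (by norm_num) h0
  have h2 := mul_left_cancel₀ h1 h
  linear_combination h2 / 2

lemma eigenvalueSet_subset_unboundedSpectrum {H : Type*} [NormedAddCommGroup H] [NormedSpace ℂ H]
    (T : H →ₗ.[ℂ] H) : eigenvalueSet T ⊆ unboundedSpectrum T := by
  rintro c ⟨x, hx, hxc⟩ ⟨R, hR, -⟩
  refine hx ?_
  rw [← hR x, hxc, sub_self, map_zero]

lemma isClosed_range_natCast_complex : IsClosed (Set.range fun l : ℕ => (l : ℂ)) :=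
  (Complex.isometry_ofReal.isClosedEmbedding.comp Nat.isClosedEmbedding_coe_real).isClosed_range

/-- The canonical commutation relations have no solution in nonzero finite dimension. -/
lemma finrank_eq_zero_of_commutator {V : Type*} [AddCommGroup V] [Module ℂ V]
    [FiniteDimensional ℂ V] {a b : V →ₗ[ℂ] V} {c : ℂ} (hc : c ≠ 0)
    (h : ∀ x, a (b x) = b (a x) + c • x) : Module.finrank ℂ V = 0 := by
  have hab : a * b = b * a + c • 1 := LinearMap.ext h
  -- A commutator has trace zero, whereas `c • 1` has trace `c` times the dimension.
  have htr := congrArg (LinearMap.trace ℂ V) hab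
  rw [map_add, LinearMap.trace_mul_comm, left_eq_add, map_smul, LinearMap.trace_one, smul_eq_mul,
    mul_eq_zero] at htr
  exact_mod_cast htr.resolve_left hc

/-! ### The closed Landau levels -/

/-- The closure in `L²` of a Landau level. -/
def closedLandau (n : ℕ) (g : ℂ) (l : ℕ) : Submodule ℂ (L2 n) :=
  (landauL2 n g l).topologicalClosure

instance (g : ℂ) (l : ℕ) : CompleteSpace (closedLandau n g l) :=
  (landauL2 n g l).isClosed_topologicalClosure.completeSpace_coe

section

variable {ν μ : ℝ} (hμ : 0 < μ)
include hμ

/-- Functions of the level itself are covered by the cutoff argument; the eigenvalue equation is a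
closed condition because the graph is closed. -/
lemma mem_magOperator_graph_of_mem_closedLandau {l : ℕ} {F : L2 n}
    (hF : F ∈ closedLandau n (gauge ν μ) l) :
    (F, eigval n μ l • F) ∈ (magOperator n ν μ).graph := by
  have hcl : IsClosed {F : L2 n | (F, eigval n μ l • F) ∈ (magOperator n ν μ).graph} :=
    (isClosed_magOperator_graph n ν μ).preimage (by fun_prop)
  refine closure_minimal (fun F hF => ?_) hcl hF
  obtain ⟨f, hf, hFf⟩ := hF
  refine (mem_magOperator_graph_iff ν μ).2
    (mem_closure_graph_of_isPolyGauss ν μ hμ hf.isPolyGauss hFf ?_)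
  filter_upwards [Lp.coeFn_smul (eigval n μ l) F, hFf] with z h1 h2
  rw [h1, Pi.smul_apply, h2, smul_eq_mul, magLaplacian_landau ν μ hf]

lemma closedLandau_le_weakEigenspace (l : ℕ) :
    closedLandau n (gauge ν μ) l ≤ weakEigenspace n ν μ (eigval n μ l) :=
  fun _ hF => mem_weakEigenspace_of_mem_graph ν μ (mem_magOperator_graph_of_mem_closedLandau hμ hF)

/-- Weak eigenvectors are orthogonal to the Landau levels of other eigenvalues. -/
lemma inner_eq_zero_of_mem_weakEigenspace {l : ℕ} {κ : ℂ} (hκ : κ ≠ eigval n μ l) {S F : L2 n}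
    (hS : S ∈ closedLandau n (gauge ν μ) l) (hF : F ∈ weakEigenspace n ν μ κ) :
    inner ℂ S F = 0 := by
  have h := inner_eq_inner_of_mem_closure_graph ν μ (p := (S, eigval n μ l • S)) (q := (F, κ • F))
    ((mem_magOperator_graph_iff ν μ).1 (mem_magOperator_graph_of_mem_closedLandau hμ hS))
    (fun φ => by rw [inner_smul_right]; exact hF φ)
  simp only [inner_smul_left, inner_smul_right, conj_eigval_natCast] at h
  have : (κ - eigval n μ l) * inner ℂ S F = 0 := by linear_combination -h
  exact (mul_eq_zero.1 this).resolve_left (sub_ne_zero.2 hκ)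

lemma gauge_re_pos : 0 < (gauge ν μ).re := by
  rw [gauge_re]
  linarith

/-- The Landau levels exhaust `L²`. -/
lemma eq_zero_of_forall_closedLandau {F : L2 n}
    (h : ∀ l, ∀ S ∈ closedLandau n (gauge ν μ) l, inner ℂ S F = 0) : F = 0 := by
  refine eq_zero_of_forall_isPolyGauss (gauge_re_pos (ν := ν) hμ) fun f hf => ?_
  have key : ∃ S : L2 n, S =ᵐ[volume] f.1 ∧ inner ℂ S F = 0 := by
    refine Submodule.iSup_induction (fun l => landau n (gauge ν μ) l)
      (motive := fun f => ∃ S : L2 n, S =ᵐ[volume] f.1 ∧ inner ℂ S F = 0)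
      (mem_iSup_landau_of_isPolyGauss (gauge_re_pos (ν := ν) hμ) hf) (fun l f hf => ?_)
      ⟨0, Lp.coeFn_zero _ _ _, inner_zero_left _⟩ ?_
    · have hm := ((IsLandau.isPolyGauss hf).gaussBdd (gauge_re_pos (ν := ν) hμ)).memLp
      exact ⟨hm.toLp _, hm.coeFn_toLp, h l _
        (Submodule.le_topologicalClosure _ ⟨f, hf, hm.coeFn_toLp⟩)⟩
    · rintro f₁ f₂ ⟨S₁, h1, h1'⟩ ⟨S₂, h2, h2'⟩
      exact ⟨S₁ + S₂, (Lp.coeFn_add _ _).trans (h1.add h2), by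
        rw [inner_add_left, h1', h2', add_zero]⟩
  obtain ⟨S, hS, hS0⟩ := key
  rw [← hS0, inner_L2_eq hS (Filter.EventuallyEq.refl _ _)]

/-- Such a weak eigenvector is orthogonal to every Landau level, and these exhaust `L²`. -/
lemma weakEigenspace_eq_bot {lam : ℂ} (hlam : ∀ l : ℕ, lam ≠ l) :
    weakEigenspace n ν μ (eigval n μ lam) = ⊥ := by
  refine (Submodule.eq_bot_iff _).2 fun F hF => eq_zero_of_forall_closedLandau (ν := ν) hμ
    fun l S hS => inner_eq_zero_of_mem_weakEigenspace hμ ?_ hS hF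
  exact fun h => hlam l (eigval_injective n hμ h)

/-- After subtracting the projection onto level `l`, the remainder is still a weak eigenvector. It
is orthogonal to level `l` by construction and to the others since their eigenvalues differ, so it
vanishes. -/
lemma weakEigenspace_le_closedLandau (l : ℕ) :
    weakEigenspace n ν μ (eigval n μ l) ≤ closedLandau n (gauge ν μ) l := by
  intro F hF
  obtain ⟨P, hP, Q, hQ, rfl⟩ := (closedLandau n (gauge ν μ) l).exists_add_mem_mem_orthogonal F
  have hQw : Q ∈ weakEigenspace n ν μ (eigval n μ l) := by
    have := Submodule.sub_mem _ hF (closedLandau_le_weakEigenspace hμ l hP)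
    rwa [add_sub_cancel_left] at this
  have hQ0 : Q = 0 := eq_zero_of_forall_closedLandau (ν := ν) hμ fun m S hS => by
    rcases eq_or_ne m l with rfl | hml
    · exact (Submodule.mem_orthogonal _ _).1 hQ S hS
    · exact inner_eq_zero_of_mem_weakEigenspace hμ
        (fun h => hml (by exact_mod_cast (eigval_injective n hμ h).symm)) hS hQw
  rwa [hQ0, add_zero]

/-- The `L²`-eigenspaces consist of all weak solutions. -/
lemma L2Eigenspace_eq_weakEigenspace (lam : ℂ) :
    L2Eigenspace n ν μ lam = weakEigenspace n ν μ (eigval n μ lam) := by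
  refine le_antisymm (L2Eigenspace_le_weakEigenspace n ν μ lam) ?_
  by_cases h : ∃ l : ℕ, lam = l
  · obtain ⟨l, rfl⟩ := h
    intro F hF
    -- Regularity comes from the Mehler transform: a weak solution lies in a closed level and so has
    -- a smooth representative, for which the equation holds pointwise.
    obtain ⟨f, hf⟩ := exists_smooth_of_mem_closure_landauL2 (gauge_re_pos (ν := ν) hμ)
      (weakEigenspace_le_closedLandau hμ l hF)
    exact ⟨f.1, ⟨f.2, magLaplacian_eq_of_weak ν μ hf hF⟩, hf⟩
  · rw [weakEigenspace_eq_bot hμ (not_exists.1 h)]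
    exact bot_le

lemma L2Eigenspace_eq_closedLandau (l : ℕ) :
    L2Eigenspace n ν μ l = closedLandau n (gauge ν μ) l := by
  rw [L2Eigenspace_eq_weakEigenspace hμ]
  exact le_antisymm (weakEigenspace_le_closedLandau hμ l) (closedLandau_le_weakEigenspace hμ l)

lemma L2Eigenspace_eq_bot {lam : ℂ} (hlam : ∀ l : ℕ, lam ≠ l) : L2Eigenspace n ν μ lam = ⊥ := by
  rw [L2Eigenspace_eq_weakEigenspace hμ, weakEigenspace_eq_bot hμ hlam]

lemma isClosed_L2Eigenspace (lam : ℂ) : IsClosed (L2Eigenspace n ν μ lam : Set (L2 n)) := by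
  by_cases h : ∃ l : ℕ, lam = l
  · obtain ⟨l, rfl⟩ := h
    rw [L2Eigenspace_eq_closedLandau hμ]
    exact (landauL2 n (gauge ν μ) l).isClosed_topologicalClosure
  · rw [L2Eigenspace_eq_bot hμ (not_exists.1 h)]
    exact isClosed_singleton

lemma isOrtho_L2Eigenspace {l m : ℕ} (hlm : l ≠ m) :
    L2Eigenspace n ν μ l ⟂ L2Eigenspace n ν μ m := by
  rw [Submodule.isOrtho_iff_inner_eq, L2Eigenspace_eq_closedLandau hμ,
    L2Eigenspace_eq_weakEigenspace hμ]
  exact fun S hS F hF => inner_eq_zero_of_mem_weakEigenspace hμ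
    (fun h => hlm (by exact_mod_cast (eigval_injective n hμ h).symm)) hS hF

lemma isHilbertSum_L2Eigenspace : IsHilbertSum ℂ (fun l : ℕ => L2Eigenspace n ν μ (l : ℂ))
    (fun l : ℕ => (L2Eigenspace n ν μ (l : ℂ)).subtypeₗᵢ) := by
  have : ∀ l : ℕ, CompleteSpace (L2Eigenspace n ν μ (l : ℂ)) := fun l =>
    (isClosed_L2Eigenspace hμ _).completeSpace_coe
  refine IsHilbertSum.mkInternal _ (OrthogonalFamily.of_pairwise fun l m hlm =>
    isOrtho_L2Eigenspace hμ hlm) ?_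
  rw [top_le_iff, Submodule.topologicalClosure_eq_top_iff, Submodule.eq_bot_iff]
  refine fun F hF => eq_zero_of_forall_closedLandau (ν := ν) hμ fun l S hS => ?_
  rw [← L2Eigenspace_eq_closedLandau hμ] at hS
  exact (Submodule.mem_orthogonal _ _).1 hF S (Submodule.mem_iSup_of_mem l hS)

lemma mem_L2Eigenspace_iff_mem_graph {lam : ℂ} {F : L2 n} :
    F ∈ L2Eigenspace n ν μ lam ↔ (F, eigval n μ lam • F) ∈ (magOperator n ν μ).graph := by
  refine ⟨fun hF => ?_, fun hF => ?_⟩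
  · by_cases h : ∃ l : ℕ, lam = l
    · obtain ⟨l, rfl⟩ := h
      rw [L2Eigenspace_eq_closedLandau hμ] at hF
      exact mem_magOperator_graph_of_mem_closedLandau hμ hF
    · rw [L2Eigenspace_eq_bot hμ (not_exists.1 h), Submodule.mem_bot] at hF
      rw [hF, smul_zero]
      exact Submodule.zero_mem _
  · rw [L2Eigenspace_eq_weakEigenspace hμ]
    exact mem_weakEigenspace_of_mem_graph ν μ hF

/-! ### The Landau levels are infinite dimensional -/

/-- If every `A_j^*` killed some `f ≠ 0` of level `l`, the commutation relation would give `∑ A_j^*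
A_j f = -nμ f`, while the left side is `μl f`; this contradicts `μ(l + n) > 0`. -/
lemma landau_ne_bot (hn : 1 ≤ n) (l : ℕ) : landau n (gauge ν μ) l ≠ ⊥ := by
  induction l with
  | zero =>
    intro h
    have h1 : ground n (gauge ν μ) ∈ landau n (gauge ν μ) 0 := IsLandau.ground
    rw [h, Submodule.mem_bot] at h1
    have h2 := congrFun (congrArg Subtype.val h1) 0
    rw [ground_apply] at h2
    exact Complex.exp_ne_zero _ h2
  | succ l ih =>
    obtain ⟨f, hf, hf0⟩ := (Submodule.ne_bot_iff _).1 ih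
    refine (Submodule.ne_bot_iff _).2 ?_
    by_contra! hcon
    have h0 : ∀ j, creatA (gauge ν μ) j f = 0 := fun j => hcon _ (IsLandau.creatA j hf)
    have hc : ∀ j, creatA (gauge ν μ) j (annihA (gauge ν μ) j f) = -((μ : ℂ) • f) := fun j => by
      have := annihA_creatA (gauge ν μ) j j f
      rw [h0, map_zero, gauge_add_conj, if_pos rfl, mul_one] at this
      exact eq_neg_of_add_eq_zero_left this.symm
    have hN := numberOperator_landau (gauge ν μ) hf
    simp only [hc, Finset.sum_const, Finset.card_univ, Fintype.card_fin, gauge_add_conj] at hN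
    have h1 : ((μ : ℂ) * (l + n)) • f = 0 := by
      rw [smul_neg, ← Nat.cast_smul_eq_nsmul ℂ, eq_comm, eq_neg_iff_add_eq_zero] at hN
      rw [← hN]
      module
    have h2 : (μ : ℂ) * (l + n) ≠ 0 := by
      have : (0 : ℝ) < μ * (l + n) := by positivity
      exact_mod_cast this.ne'
    exact hf0 ((smul_eq_zero.1 h1).resolve_left h2)

/-- `B_j` and `B_j^*` preserve the level and their commutator there is the nonzero scalar `μ`. -/
lemma not_finiteDimensional_landau (hn : 1 ≤ n) (l : ℕ) :
    ¬ FiniteDimensional ℂ (landau n (gauge ν μ) l) := by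
  intro hfin
  let j : Fin n := ⟨0, hn⟩
  have h := finrank_eq_zero_of_commutator (V := landau n (gauge ν μ) l)
    (a := (annihB (gauge ν μ) j).restrict fun f hf => annihB_landau (gauge ν μ) j hf)
    (b := (creatB (gauge ν μ) j).restrict fun f hf => IsLandau.creatB j hf)
    (c := (μ : ℂ)) (by exact_mod_cast hμ.ne') fun f => Subtype.ext (by
      change annihB (gauge ν μ) j (creatB (gauge ν μ) j f.1) =
        creatB (gauge ν μ) j (annihB (gauge ν μ) j f.1) + (μ : ℂ) • f.1
      rw [annihB_creatB, gauge_add_conj, if_pos rfl, mul_one])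
  exact landau_ne_bot hμ hn l (Submodule.finrank_eq_zero.1 h)

/-- The level embeds in the eigenspace, because continuous functions that agree almost everywhere
are equal. -/
lemma not_finiteDimensional_L2Eigenspace (hn : 1 ≤ n) (l : ℕ) :
    ¬ FiniteDimensional ℂ (L2Eigenspace n ν μ (l : ℂ)) := by
  intro hfin
  rw [L2Eigenspace_eq_closedLandau hμ] at hfin
  have hm : ∀ f : landau n (gauge ν μ) l, MemLp f.1.1 2 (volume : Measure (Cn n)) := fun f =>
    ((IsLandau.isPolyGauss f.2).gaussBdd (gauge_re_pos hμ)).memLp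
  let T : landau n (gauge ν μ) l →ₗ[ℂ] closedLandau n (gauge ν μ) l :=
    { toFun := fun f => ⟨(hm f).toLp f.1.1,
        Submodule.le_topologicalClosure _ ⟨f.1, f.2, (hm f).coeFn_toLp⟩⟩
      map_add' := fun f h => Subtype.ext (MemLp.toLp_add (hm f) (hm h))
      map_smul' := fun c f => Subtype.ext (MemLp.toLp_const_smul c (hm f)) }
  refine not_finiteDimensional_landau hμ hn l
    (FiniteDimensional.of_injective T fun f h hfh => ?_)
  have h1 := (MemLp.toLp_eq_toLp_iff (hm f) (hm h)).1 (congrArg Subtype.val hfh)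
  exact Subtype.ext (Subtype.ext ((Continuous.ae_eq_iff_eq volume (continuous_smoothSpace f.1)
    (continuous_smoothSpace h.1)).1 h1))

lemma L2Eigenspace_natCast_ne_bot (hn : 1 ≤ n) (l : ℕ) : L2Eigenspace n ν μ (l : ℂ) ≠ ⊥ := by
  intro h
  refine not_finiteDimensional_L2Eigenspace (ν := ν) hμ hn l ?_
  rw [h]
  infer_instance

/-! ### The spectrum -/

lemma norm_eigval_sub (n : ℕ) (lam lam' : ℂ) :
    ‖eigval n μ lam - eigval n μ lam'‖ = 4 * μ * ‖lam - lam'‖ := by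
  have : eigval n μ lam - eigval n μ lam' = -((4 * μ : ℝ) : ℂ) * (lam - lam') := by
    simp only [eigval]
    push_cast
    ring
  rw [this, norm_mul, norm_neg, Complex.norm_real, Real.norm_of_nonneg (by positivity)]

lemma eigenvalueSet_magOperator (hn : 1 ≤ n) :
    eigenvalueSet (magOperator n ν μ) = Set.range fun l : ℕ => eigval n μ l := by
  have h0 : (μ : ℂ) ≠ 0 := by exact_mod_cast hμ.ne'
  ext c
  constructor
  · rintro ⟨x, hx, hxc⟩
    -- Since `μ ≠ 0`, every complex number is `-2μ(2λ+n)` for some `λ`, so the description of the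
    -- spaces `L2Eigenspace` applies to an arbitrary eigenvalue.
    have hc : c = eigval n μ ((c / (-2 * μ) - n) / 2) := by
      rw [eigval]; field_simp; ring
    have hmem : (x : L2 n) ∈ L2Eigenspace n ν μ ((c / (-2 * μ) - n) / 2) := by
      rw [mem_L2Eigenspace_iff_mem_graph hμ, ← hc, ← hxc]
      exact LinearPMap.mem_graph _ x
    by_contra hcon
    rw [L2Eigenspace_eq_bot hμ fun l hl => hcon ⟨l, by rw [hc, hl]⟩] at hmem
    exact hx hmem
  · rintro ⟨l, rfl⟩
    obtain ⟨F, hF, hF0⟩ := (Submodule.ne_bot_iff _).1 (L2Eigenspace_natCast_ne_bot (ν := ν) hμ hn l)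
    rw [mem_L2Eigenspace_iff_mem_graph hμ, LinearPMap.mem_graph_iff] at hF
    obtain ⟨x, hx, hx'⟩ := hF
    exact ⟨x, by rwa [hx], by rw [hx', hx]⟩

/-- A parameter `λ` outside the closed set `ℕ ⊆ ℂ` has a positive distance `d` from it, so `c` is at
distance at least `4μd` from all eigenvalues and the diagonal resolvent is bounded. Conversely
eigenvalues always lie in the spectrum. -/
lemma unboundedSpectrum_magOperator (hn : 1 ≤ n) :
    unboundedSpectrum (magOperator n ν μ) = Set.range fun l : ℕ => eigval n μ l := by
  have h0 : (μ : ℂ) ≠ 0 := by exact_mod_cast hμ.ne'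
  refine Set.Subset.antisymm (fun c hc => ?_) ?_
  · by_contra hcon
    refine hc ?_
    set lam : ℂ := (c / (-2 * μ) - n) / 2 with hlam
    have hc' : c = eigval n μ lam := by rw [hlam, eigval]; field_simp; ring
    have hmem : lam ∈ (Set.range fun l : ℕ => (l : ℂ))ᶜ := by
      rintro ⟨l, hl⟩
      exact hcon ⟨l, by rw [hc', ← hl]⟩
    obtain ⟨d, hd, hball⟩ := Metric.isOpen_iff.1
      isClosed_range_natCast_complex.isOpen_compl lam hmem
    refine mem_resolventSet_of_isHilbertSum (isClosed_magOperator_graph n ν μ)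
      (isHilbertSum_L2Eigenspace hμ) (κ := fun l => eigval n μ l)
      (fun l x hx => (mem_L2Eigenspace_iff_mem_graph hμ).1 hx) (fun l s hs p hp => ?_)
      (d := 4 * μ * d) (by positivity) fun l => ?_
    · have := inner_magOperator_graph ν μ ((mem_L2Eigenspace_iff_mem_graph hμ).1 hs) hp
      rw [← this, inner_smul_left, conj_eigval_natCast]
    · rw [hc', norm_eigval_sub hμ]
      gcongr
      by_contra! hlt
      exact hball (by rwa [Metric.mem_ball, dist_eq_norm]) ⟨l, rfl⟩
  · rw [← eigenvalueSet_magOperator (ν := ν) hμ hn]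
    exact eigenvalueSet_subset_unboundedSpectrum _

/-- Distinct eigenvalues are at least `4μ` apart. -/
lemma discreteTopology_range_eigval (n : ℕ) :
    DiscreteTopology (Set.range fun l : ℕ => eigval n μ l) := by
  have hpos : 0 < 4 * μ := by linarith
  refine DiscreteTopology.of_forall_le_dist hpos ?_
  rintro ⟨_, l, rfl⟩ ⟨_, m, rfl⟩ hne
  have hlm : l ≠ m := fun h => hne (by subst h; rfl)
  rw [Subtype.dist_eq, dist_eq_norm, norm_eigval_sub hμ]
  have h1 : (1 : ℝ) ≤ ‖((l : ℂ) - m)‖ := by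
    have h2 : (l : ℤ) - m ≠ 0 := sub_ne_zero.2 (by exact_mod_cast hlm)
    have h3 : ((l : ℂ) - m) = (((l : ℤ) - m : ℤ) : ℂ) := by push_cast; rfl
    rw [h3, Complex.norm_intCast, ← Int.cast_abs]
    exact_mod_cast Int.one_le_abs h2
  nlinarith

end

end MagneticLaplacian

end

theorem mainTheorem1 (n : ℕ) (hn : 1 ≤ n) (ν μ : ℝ) (hμ : 0 < μ) :
    (∀ lam : ℂ, IsClosed (MagneticLaplacian.L2Eigenspace n ν μ lam : Set (MagneticLaplacian.L2 n))) ∧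
    (∀ lam : ℂ, MagneticLaplacian.L2Eigenspace n ν μ lam ≠ ⊥ ↔ ∃ l : ℕ, lam = (l : ℂ)) ∧
    (∀ l m : ℕ, l ≠ m →
      MagneticLaplacian.L2Eigenspace n ν μ (l : ℂ) ⟂ MagneticLaplacian.L2Eigenspace n ν μ (m : ℂ)) ∧
    IsHilbertSum ℂ (fun l : ℕ => MagneticLaplacian.L2Eigenspace n ν μ (l : ℂ))
      (fun l : ℕ => (MagneticLaplacian.L2Eigenspace n ν μ (l : ℂ)).subtypeₗᵢ) ∧
    (∀ l : ℕ, ¬ FiniteDimensional ℂ (MagneticLaplacian.L2Eigenspace n ν μ (l : ℂ))) ∧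
    (∀ (lam : ℂ) (F : MagneticLaplacian.L2 n), F ∈ MagneticLaplacian.L2Eigenspace n ν μ lam ↔
      ∃ x : (MagneticLaplacian.magOperator n ν μ).domain, (x : MagneticLaplacian.L2 n) = F ∧
        MagneticLaplacian.magOperator n ν μ x = (-2 * (μ : ℂ) * (2 * lam + (n : ℂ))) • F) ∧
    MagneticLaplacian.unboundedSpectrum (MagneticLaplacian.magOperator n ν μ) =
      Set.range (fun l : ℕ => (-2 * (μ : ℂ) * (2 * (l : ℂ) + (n : ℂ)))) ∧
    MagneticLaplacian.eigenvalueSet (MagneticLaplacian.magOperator n ν μ) =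
      Set.range (fun l : ℕ => (-2 * (μ : ℂ) * (2 * (l : ℂ) + (n : ℂ)))) ∧
    DiscreteTopology (MagneticLaplacian.unboundedSpectrum (MagneticLaplacian.magOperator n ν μ)) := by
  refine ⟨MagneticLaplacian.isClosed_L2Eigenspace hμ, fun lam => ⟨fun h => ?_, ?_⟩,
    fun l m => MagneticLaplacian.isOrtho_L2Eigenspace hμ,
    MagneticLaplacian.isHilbertSum_L2Eigenspace hμ,
    MagneticLaplacian.not_finiteDimensional_L2Eigenspace hμ hn, fun lam F => ?_,
    MagneticLaplacian.unboundedSpectrum_magOperator hμ hn,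
    MagneticLaplacian.eigenvalueSet_magOperator hμ hn, ?_⟩
  · by_contra hcon
    exact h (MagneticLaplacian.L2Eigenspace_eq_bot hμ (not_exists.1 hcon))
  · rintro ⟨l, rfl⟩
    exact MagneticLaplacian.L2Eigenspace_natCast_ne_bot hμ hn l
  · rw [MagneticLaplacian.mem_L2Eigenspace_iff_mem_graph hμ, LinearPMap.mem_graph_iff]
    rfl
  · rw [MagneticLaplacian.unboundedSpectrum_magOperator hμ hn]
    exact MagneticLaplacian.discreteTopology_range_eigval hμ n
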